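/- **Setting.** Let $h\in(0,\infty)$ and $\mathbb Z_h:=\{hk:k\in\mathbb Z\}$. An *upwards skip-free Lévy chain* (for this $h$) is a compound Poisson process $X=(X_t)_{t\ge 0}$, $X_0=0$ a.s., with càdlàg paths, whose (finite, nonzero) Lévy measure $\lambda$ satisfies $\mathrm{supp}(\lambda)\subset\mathbb Z_h$ and $\mathrm{supp}(\lambda|_{(0,\infty)})=\{h\}$; thus $\mathsf E[e^{ipX_t}]=\exp\{t\int(e^{ipy}-1)\lambda(dy)\}$. Put $\psi(\beta):=\int(e^{\beta y}-1)\lambda(dy)$ for $\beta\ge 0$, and let $\Phi(0)$ be the largest zero of $\psi$ on $[0,\infty)$. *Strict ascending ladder heights process.* Let $L^*_t$ be the amount of time up to $t$ that $X$ has spent at a new maximum (i.e. the Lebesgue measure of the set of $s\in[0,t]$ for which there is $a\le s$ with $X_r<X_a$ for all $r<a$ and $X_r=X_a$ for all $r\in[a,s]$), let $L^{*-1}_t:=\inf\{s\geq 0:L^*_s>t\}$ ($\inf\emptyset=\infty$), and $H^*_t:=X_{L^{*-1}_t}$ if $L^{*-1}_t<\infty$, $H^*_t:=+\infty$ otherwise.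 It has killing rate $\gamma$ if $\mathsf P(H^*_t<\infty)=e^{-\gamma t}$ for all $t\ge 0$. *Descending ladder heights process.* Let $\hat L_t:=e^{\Phi(0)h}\int_0^t\mathbb 1\{X_s=\inf_{r\le s}X_r\}\,ds$ be the local time at the minimum (with this choice of normalization), $\hat L^{-1}_t:=\inf\{s\geq 0:\hat L_s>t\}$, and $\hat H_t:=-X_{\hat L^{-1}_t}$ if $\hat L^{-1}_t<\infty$, $\hat H_t:=+\infty$ otherwise. Its Laplace exponent is $\beta\mapsto-\log\mathsf E[e^{-\beta\hat H_1}\mathbb 1(\hat H_1<\infty)]$, $\beta\ge 0$. **Theorem.** Let $h\in(0,\infty)$, $\gamma,q\in[0,\infty)$ and $(\phi_k)_{k\ge1}\subset[0,\infty)$ with $q+\sum_{k\ge1}\phi_k\in(0,\infty)$. There exists an upwards skip-free Lévy chain $X$ (on some probability space) with values in $\mathbb Z_h$ such that (i) $\gamma$ is the killing rate of its strict ascending ladder heights process, and (ii) $\phi(\beta)=q+\sum_{k\ge1}\phi_k(1-e^{-\beta kh})$, $\beta\ge0$, is the Laplace exponent of its descending ladder heights process, if and only if the following two conditions hold: (1)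 $\gamma q=0$; (2) setting $x:=1$ when $\gamma=0$, and otherwise letting $x$ be the unique solution in $(1,\infty)$ of $$\gamma=\Bigl(1-\frac1x\Bigr)\Bigl(\phi_1+x\sum_{k\ge1}\phi_k\Bigr)$$ (it is part of the condition that such an $x$ exists; there is always at most one), one has $\lambda_{-k}:=x\phi_k-\phi_{k+1}\ge0$ for all $k\ge1$. Such an $X$ is then unique in law, its Lévy measure is $\lambda=\sum_{k\ge1}\lambda_{-k}\delta_{-kh}+\lambda_1\delta_h$ with $\lambda_1:=q+\sum_{k\ge1}\phi_k$, and $x=e^{\Phi(0)h}$. -/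

import Mathlib

open MeasureTheory ProbabilityTheory Filter Topology Set
open scoped NNReal ENNReal

universe u v

namespace SkipFree

noncomputable section

/-- The lattice `ℤ_h = {h k : k ∈ ℤ}`. -/
def lattice (h : ℝ) : Set ℝ := Set.range (fun k : ℤ => h * (k : ℝ))

/-- The path `f` is right-continuous and has left limits. -/
def IsCadlag (f : ℝ≥0 → ℝ) : Prop :=
  ∀ t : ℝ≥0, ContinuousWithinAt f (Set.Ici t) t ∧ ∃ l : ℝ, Tendsto f (𝓝[<] t) (𝓝 l)

/-- `X` is a (real-valued) Lévy process with càdlàg sample paths. -/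
structure IsLevyProcess {Ω : Type*} [MeasurableSpace Ω] (X : ℝ≥0 → Ω → ℝ) (P : Measure Ω) :
    Prop where
  measurable : ∀ t, Measurable (X t)
  cadlag : ∀ ω, IsCadlag (fun t => X t ω)
  zero : ∀ᵐ ω ∂P, X 0 ω = 0
  indep : HasIndepIncrements X P
  stationary : ∀ s t, IdentDistrib (fun ω => X (s + t) ω - X s ω) (X t) P P

/-- `X` is a compound Poisson process with Lévy measure `ν`: a Lévy process with characteristic
function `E[exp(i p X_t)] = exp(t ∫ (exp(i p x) - 1) ν(dx))`, where `ν` is a nonzero finite measure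
that does not charge `0`. -/
structure IsCompoundPoisson {Ω : Type*} [MeasurableSpace Ω] (X : ℝ≥0 → Ω → ℝ) (P : Measure Ω)
    (ν : Measure ℝ) : Prop extends IsLevyProcess X P where
  finite : IsFiniteMeasure ν
  ne_zero : ν ≠ 0
  no_atom_zero : ν {0} = 0
  charFun_eq : ∀ (t : ℝ≥0) (p : ℝ), charFun (P.map (X t)) p =
    Complex.exp ((t : ℂ) * ∫ x : ℝ, (Complex.exp (Complex.I * p * x) - 1) ∂ν)

/-- `X` is an upwards skip-free Lévy chain with Lévy measure `ν` and lattice span `h`. -/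
structure IsUpwardsSkipFreeLevyChain {Ω : Type*} [MeasurableSpace Ω] (h : ℝ)
    (X : ℝ≥0 → Ω → ℝ) (P : Measure Ω) (ν : Measure ℝ) : Prop extends
    IsCompoundPoisson X P ν where
  supp_lattice : ν.support ⊆ lattice h
  supp_pos : (ν.restrict (Set.Ioi 0)).support = {h}

/-- The Laplace exponent `ψ(β) = ∫ (exp(β x) - 1) ν(dx)`, for `β ≥ 0`, of a compound Poisson process
with Lévy measure `ν`. -/
def psi (ν : Measure ℝ) (β : ℝ) : ℝ := ∫ x : ℝ, (Real.exp (β * x) - 1) ∂ν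

/-- `Φ(0)`, the largest root of `ψ` on `[0, ∞)`. -/
def Phi0 (ν : Measure ℝ) : ℝ := sSup {β : ℝ | 0 ≤ β ∧ psi ν β = 0}

/-- Right-continuous inverse `t ↦ inf {s ≥ 0 : L s > t}` (which is `∞` if there is no such `s`). -/
def rightInverse (L : ℝ≥0 → ℝ≥0∞) (t : ℝ≥0) : ℝ≥0∞ :=
  ⨅ (s : ℝ≥0) (_ : (t : ℝ≥0∞) < L s), (s : ℝ≥0∞)

/-- The path `f` evaluated at the time `τ ∈ [0, ∞]`, with the value `+∞` at `τ = ∞`. -/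
def evalAt (f : ℝ≥0 → ℝ) (τ : ℝ≥0∞) : EReal :=
  if τ = ⊤ then ⊤ else ((f τ.toNNReal : ℝ) : EReal)

/-- At time `s` the path `f` is at a new maximum: at some time `a ≤ s` the path attained a level that
was strictly above all its previous values, and it has stayed there during the whole of `[a, s]`. (The
starting level is the first such maximum, attained at `a = 0`.) -/
def AtNewMax (f : ℝ≥0 → ℝ) (s : ℝ≥0) : Prop :=
  ∃ a ≤ s, (∀ r < a, f r < f a) ∧ ∀ r, a ≤ r → r ≤ s → f r = f a

/-- `L*_t`: the amount of time up to `t` which the path `f` has spent at a new maximum. -/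
def newMaxTime (f : ℝ≥0 → ℝ) (t : ℝ≥0) : ℝ≥0∞ :=
  volume ((fun s : ℝ≥0 => (s : ℝ)) '' {s | s ≤ t ∧ AtNewMax f s})

/-- The amount of time up to `t` which the path `f` has spent at its running minimum. -/
def minTime (f : ℝ≥0 → ℝ) (t : ℝ≥0) : ℝ≥0∞ :=
  volume ((fun s : ℝ≥0 => (s : ℝ)) '' {s | s ≤ t ∧ ∀ r ≤ s, f s ≤ f r})

/-- The strict ascending ladder heights process `H*_t = X(L*⁻¹_t)`. -/
def strictAscLadderHeight {Ω : Type*} (X : ℝ≥0 → Ω → ℝ) (t : ℝ≥0) (ω : Ω) : EReal :=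
  evalAt (fun s => X s ω) (rightInverse (newMaxTime (fun s => X s ω)) t)

/-- The local time at the minimum, normalized as `exp(Φ(0) h)` times the time spent at the running
minimum. -/
def localTimeMin (h : ℝ) (ν : Measure ℝ) (f : ℝ≥0 → ℝ) (t : ℝ≥0) : ℝ≥0∞ :=
  ENNReal.ofReal (Real.exp (Phi0 ν * h)) * minTime f t

/-- The (weak) descending ladder heights process, with values in `[0, ∞]`: `-X` evaluated at the
right-continuous inverse of the local time at the minimum. -/
def descLadderHeight {Ω : Type*} (h : ℝ) (ν : Measure ℝ) (X : ℝ≥0 → Ω → ℝ) (t : ℝ≥0) (ω : Ω) :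
    EReal :=
  evalAt (fun s => -X s ω) (rightInverse (localTimeMin h ν (fun s => X s ω)) t)

/-- The killed subordinator `H` (with cemetery `+∞`) has killing rate `γ`: its lifetime is
exponentially distributed with rate `γ` (infinite if `γ = 0`). -/
def HasKillingRate {Ω : Type*} [MeasurableSpace Ω] (H : ℝ≥0 → Ω → EReal) (P : Measure Ω) (γ : ℝ) :
    Prop :=
  ∀ t : ℝ≥0, P {ω | H t ω ≠ ⊤} = ENNReal.ofReal (Real.exp (-(γ * t)))

/-- The killed subordinator `H` (with cemetery `+∞`) has Laplace exponent `φ` on `[0, ∞)`, i.e.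
`E[exp(-β H_1) 1(H_1 < ∞)] = exp(-φ(β))`. -/
def HasLaplaceExponent {Ω : Type*} [MeasurableSpace Ω] (H : ℝ≥0 → Ω → EReal) (P : Measure Ω)
    (φ : ℝ → ℝ) : Prop :=
  ∀ β : ℝ, 0 ≤ β →
    ∫ ω, (if H 1 ω = ⊤ then 0 else Real.exp (-(β * (H 1 ω).toReal))) ∂P = Real.exp (-φ β)

/-- `X` (under `P`, with Lévy measure `ν`) is an upwards skip-free Lévy chain with values in `ℤ_h`,
whose strict ascending ladder heights process has killing rate `γ` and whose descending ladder heights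
process has Laplace exponent `φ(β) = q + ∑_{k ≥ 1} φ_k (1 - exp(-β k h))`. -/
structure IsParentProcess {Ω : Type*} [MeasurableSpace Ω] (h γ q : ℝ) (φ : ℕ+ → ℝ)
    (X : ℝ≥0 → Ω → ℝ) (P : Measure Ω) (ν : Measure ℝ) : Prop where
  chain : IsUpwardsSkipFreeLevyChain h X P ν
  mem_lattice : ∀ t ω, X t ω ∈ lattice h
  killing : HasKillingRate (strictAscLadderHeight X) P γ
  laplace : HasLaplaceExponent (descLadderHeight h ν X) P
    (fun β => q + ∑' k : ℕ+, φ k * (1 - Real.exp (-(β * (k : ℝ) * h))))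

/-- `x = 1` if `γ = 0`, and otherwise `x` is a solution in `(1, ∞)` of
`γ = (1 - 1 / x) (φ_1 + x ∑_k φ_k)`. -/
def IsRatio (γ : ℝ) (φ : ℕ+ → ℝ) (x : ℝ) : Prop :=
  (γ = 0 → x = 1) ∧
  (γ ≠ 0 → 1 < x ∧ γ = (1 - 1 / x) * (φ 1 + x * ∑' k : ℕ+, φ k))

/-- The measure `∑_{k ≥ 1} (x φ_k - φ_{k+1}) δ_{-kh} + (q + ∑_k φ_k) δ_h`. -/
def parentLevyMeasure (h q : ℝ) (φ : ℕ+ → ℝ) (x : ℝ) : Measure ℝ :=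
  Measure.sum (fun k : ℕ+ =>
      ENNReal.ofReal (x * φ k - φ (k + 1)) • Measure.dirac (-((k : ℝ) * h))) +
    ENNReal.ofReal (q + ∑' k : ℕ+, φ k) • Measure.dirac h

end

end SkipFree

/-! A chain of total jump rate `lam` is a walk making i.i.d. moves `h * (1 - k)`, with `k` of law
`p` on `ℕ`, after i.i.d. exponential holding times. The code `0` is the upward move, and `p 1 = 0`
excludes void moves. Let F be the generating function of `p` (`pgf`). Then ψ(β) = lam (e^{βh}
F(e^{-βh}) - 1), so the zeros of ψ are the fixed points y = e^{-βh} of F. The largest zero belongs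
to the smallest fixed point r, and x = e^{Φ(0)h} = 1/r (`Phi0_walkMeasure`).

Each ladder process runs on the time that a Markov chain on `ℕ` spends at `0`: the distance to the
next strict record in the ascending case, the height above the running minimum in the descending
one. On that clock the relevant expectation solves a renewal equation, hence equals exp(-lam (1 - κ)
t), where κ is the expected weight of a return to `0` (`iSup_excursion_eq_exp`). Ascending, κ is the
probability of ever reaching the next level, which is r (`returnWeight_up`), so the killing rate is
γ = lam (1 - r). Descending, with weight s = e^{-βh} per unit of new depth, a generating function
argument gives κ(s) = (F(s) - r)/(s - r), read as a limit at s = r (`returnSum_down_of_harmonic`,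
`tendsto_returnWeight_down`). The normalization of the local time contributes a factor r. The
descending exponent Λ(s) therefore satisfies the Wiener–Hopf identity lam (F(s) - s) = (1 - x s)
Λ(s).

The theorem is a comparison of coefficients in this identity (`hasSum_levyCoeff`). At s = 1 it gives
(1 - x) q = 0, that is, γ q = 0. The coefficient of s gives lam = x (q + ∑ φ_k) + φ_1, which turns γ
= lam (1 - 1/x) into the equation for x. The remaining coefficients are those of the Lévy measure
and must be nonnegative. Conversely, under the two conditions these coefficients divided by lam form
a probability law, and positivity of Λ on [0, 1) makes 1/x the smallest fixed point.

All ladder computations are made on the explicit model `walkPath`. Every admissible Lévy measure is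
that of a model (`IsUpwardsSkipFreeLevyChain.exists_eq_walkMeasure`), the Lévy measure determines
the law, and the ladder functionals are measurable on the space of right-continuous lattice paths,
so the results pass to an arbitrary chain. -/

namespace SkipFree

/-! ### Weighted hitting functionals of a Markov chain on `ℕ` driven by i.i.d. steps -/

/-- The expected weight collected up to the hitting time of `0` by a chain started at `d`, when
`0` is hit within `N` steps. -/
noncomputable def hit (p : ℕ → ℝ≥0∞) (m : ℕ → ℕ → ℝ≥0∞) (τ : ℕ → ℕ → ℕ) : ℕ → ℕ → ℝ≥0∞
  | 0, d => if d = 0 then 1 else 0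
  | N + 1, d => if d = 0 then 1 else ∑' k, p k * (m d k * hit p m τ N (τ d k))

/-- The expected weight collected up to the hitting time of `0` by a chain started at `d`. -/
noncomputable def hitLim (p : ℕ → ℝ≥0∞) (m : ℕ → ℕ → ℝ≥0∞) (τ : ℕ → ℕ → ℕ) (d : ℕ) : ℝ≥0∞ :=
  ⨆ N, hit p m τ N d

/-- The expected weight of a return to `0`. -/
noncomputable def returnWeight (p : ℕ → ℝ≥0∞) (m : ℕ → ℕ → ℝ≥0∞) (τ : ℕ → ℕ → ℕ) : ℝ≥0∞ :=
  ∑' k, p k * (m 0 k * hitLim p m τ (τ 0 k))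

/-- Monotone convergence for the counting measure. -/
lemma tsum_iSup_of_monotone {f : ℕ → ℕ → ℝ≥0∞} (hf : ∀ k, Monotone fun N => f N k) :
    ∑' k, ⨆ N, f N k = ⨆ N, ∑' k, f N k := by
  simp_rw [← lintegral_count]
  rw [lintegral_iSup (fun _ => measurable_of_countable _)]
  exact fun a b hab k => hf k hab

section hit

variable (p : ℕ → ℝ≥0∞) (m : ℕ → ℕ → ℝ≥0∞) (τ : ℕ → ℕ → ℕ)

@[simp] lemma hit_zero_right (N : ℕ) : hit p m τ N 0 = 1 := by
  cases N <;> simp [hit]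

lemma hit_succ_of_ne {d : ℕ} (hd : d ≠ 0) (N : ℕ) :
    hit p m τ (N + 1) d = ∑' k, p k * (m d k * hit p m τ N (τ d k)) := by
  simp [hit, hd]

lemma hit_le_hit_succ (N : ℕ) : ∀ d, hit p m τ N d ≤ hit p m τ (N + 1) d := by
  induction N with
  | zero =>
    intro d
    by_cases hd : d = 0
    · simp [hd]
    · simp [hit, hd]
  | succ N ih =>
    intro d
    by_cases hd : d = 0
    · simp [hd]
    · rw [hit_succ_of_ne _ _ _ hd, hit_succ_of_ne _ _ _ hd]
      gcongr
      exact ih _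

lemma hit_mono (d : ℕ) : Monotone fun N => hit p m τ N d :=
  monotone_nat_of_le_succ fun N => hit_le_hit_succ p m τ N d

@[simp] lemma hitLim_zero : hitLim p m τ 0 = 1 := by simp [hitLim]

lemma hitLim_of_ne {d : ℕ} (hd : d ≠ 0) :
    hitLim p m τ d = ∑' k, p k * (m d k * hitLim p m τ (τ d k)) := by
  have h1 : hitLim p m τ d = ⨆ N, hit p m τ (N + 1) d :=
    ((hit_mono p m τ d).iSup_nat_add 1).symm
  rw [h1]
  simp_rw [hit_succ_of_ne p m τ hd, hitLim, ENNReal.mul_iSup]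
  rw [tsum_iSup_of_monotone]
  intro k a b hab
  dsimp only
  gcongr
  exact hit_mono p m τ _ hab

lemma returnWeight_eq_iSup :
    returnWeight p m τ = ⨆ N, ∑' k, p k * (m 0 k * hit p m τ N (τ 0 k)) := by
  simp_rw [returnWeight, hitLim, ENNReal.mul_iSup]
  rw [tsum_iSup_of_monotone]
  intro k a b hab
  dsimp only
  gcongr
  exact hit_mono p m τ _ hab

/-- Minimality of the hitting functional: the iteration starts from the indicator of `0`, which lies
below any such `g`, and each step preserves the domination. -/
lemma hit_le_of_super {g : ℕ → ℝ≥0∞} (h0 : 1 ≤ g 0)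
    (hg : ∀ d, d ≠ 0 → ∑' k, p k * (m d k * g (τ d k)) ≤ g d) (N : ℕ) :
    ∀ d, hit p m τ N d ≤ g d := by
  induction N with
  | zero =>
    intro d
    by_cases hd : d = 0
    · simpa [hd] using h0
    · simp [hit, hd]
  | succ N ih =>
    intro d
    by_cases hd : d = 0
    · simpa [hd] using h0
    · rw [hit_succ_of_ne _ _ _ hd]
      refine le_trans ?_ (hg d hd)
      gcongr
      exact ih _

lemma hitLim_le_of_super {g : ℕ → ℝ≥0∞} (h0 : 1 ≤ g 0)
    (hg : ∀ d, d ≠ 0 → ∑' k, p k * (m d k * g (τ d k)) ≤ g d) (d : ℕ) :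
    hitLim p m τ d ≤ g d :=
  iSup_le fun N => hit_le_of_super p m τ h0 hg N d

variable {p m}

lemma tsum_mul_mul_le_one (hp : ∑' k, p k ≤ 1) {a b : ℕ → ℝ≥0∞} (ha : ∀ k, a k ≤ 1)
    (hb : ∀ k, b k ≤ 1) : ∑' k, p k * (a k * b k) ≤ 1 := by
  refine le_trans (ENNReal.tsum_le_tsum fun k => ?_) hp
  calc p k * (a k * b k) ≤ p k * (1 * 1) := by gcongr <;> simp [ha, hb]
    _ = p k := by simp

lemma hitLim_le_one (hp : ∑' k, p k ≤ 1) (hm : ∀ d k, m d k ≤ 1) (d : ℕ) :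
    hitLim p m τ d ≤ 1 :=
  hitLim_le_of_super p m τ (g := fun _ => 1) le_rfl
    (fun d _ => tsum_mul_mul_le_one hp (hm d) fun _ => le_rfl) d

lemma returnWeight_le_one (hp : ∑' k, p k ≤ 1) (hm : ∀ d k, m d k ≤ 1) :
    returnWeight p m τ ≤ 1 :=
  tsum_mul_mul_le_one hp (hm 0) fun _ => hitLim_le_one τ hp hm _

/-- Survival with probability `δ` at each step costs a path of at most `N` steps a factor no smaller
than `δ ^ N`. This gives convergence of killed functionals to unkilled ones as `δ → 1`. -/
lemma hit_killed_le {δ : ℝ≥0∞} (hδ : δ ≤ 1) (N : ℕ) :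
    ∀ d, δ ^ N * hit p m τ N d ≤ hit (fun k => δ * p k) m τ N d := by
  induction N with
  | zero => intro d; simp [hit]
  | succ N ih =>
    intro d
    by_cases hd : d = 0
    · simpa [hd] using pow_le_one₀ (zero_le) hδ
    · rw [hit_succ_of_ne _ _ _ hd, hit_succ_of_ne _ _ _ hd, ← ENNReal.tsum_mul_left]
      refine ENNReal.tsum_le_tsum fun k => ?_
      calc δ ^ (N + 1) * (p k * (m d k * hit p m τ N (τ d k)))
          = δ * p k * (m d k * (δ ^ N * hit p m τ N (τ d k))) := by ring
        _ ≤ _ := by gcongr; exact ih _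

lemma hit_mono_left {p' : ℕ → ℝ≥0∞} (hp : ∀ k, p k ≤ p' k) (N : ℕ) :
    ∀ d, hit p m τ N d ≤ hit p' m τ N d := by
  induction N with
  | zero => intro d; simp [hit]
  | succ N ih =>
    intro d
    by_cases hd : d = 0
    · simp [hd]
    · rw [hit_succ_of_ne _ _ _ hd, hit_succ_of_ne _ _ _ hd]
      gcongr with k
      · exact hp k
      · exact ih _

end hit

/-! ### Hitting from below: upwards skip-free chains -/

section up

variable {p : ℕ → ℝ≥0∞}

/-- The chain descends by at most one per step, so on its way from `e + d` to `0` it must stop at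
`d`; until then it moves as a chain started at `e`. -/
lemma hitLim_up_add_le (N : ℕ) : ∀ e d : ℕ,
    hit p (fun _ _ => 1) (fun d k => d - 1 + k) N (e + d) ≤
      hitLim p (fun _ _ => 1) (fun d k => d - 1 + k) e *
        hitLim p (fun _ _ => 1) (fun d k => d - 1 + k) d := by
  induction N with
  | zero =>
    intro e d
    by_cases h : e + d = 0
    · obtain ⟨rfl, rfl⟩ : e = 0 ∧ d = 0 := by omega
      simp
    · rw [hit, if_neg h]
      exact zero_le
  | succ N ih =>
    intro e d
    by_cases he : e = 0
    · subst he
      simp only [zero_add, hitLim_zero, one_mul]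
      exact le_iSup (fun N => hit p _ (fun d k => d - 1 + k) N d) (N + 1)
    · rw [hit_succ_of_ne _ _ _ (by omega), hitLim_of_ne _ _ _ he, ← ENNReal.tsum_mul_right]
      refine ENNReal.tsum_le_tsum fun k => ?_
      rw [mul_assoc, one_mul, one_mul]
      gcongr
      have := ih (e - 1 + k) d
      rwa [show e - 1 + k + d = e + d - 1 + k by omega] at this

lemma le_hitLim_up_add (N : ℕ) : ∀ e d : ℕ,
    hit p (fun _ _ => 1) (fun d k => d - 1 + k) N e *
        hitLim p (fun _ _ => 1) (fun d k => d - 1 + k) d ≤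
      hitLim p (fun _ _ => 1) (fun d k => d - 1 + k) (e + d) := by
  induction N with
  | zero =>
    intro e d
    by_cases he : e = 0
    · simp [he]
    · simp [hit, he]
  | succ N ih =>
    intro e d
    by_cases he : e = 0
    · simp [he]
    · rw [hit_succ_of_ne _ _ _ he, hitLim_of_ne _ _ _ (d := e + d) (by omega),
        ← ENNReal.tsum_mul_right]
      refine ENNReal.tsum_le_tsum fun k => ?_
      rw [mul_assoc, one_mul, one_mul]
      gcongr
      have := ih (e - 1 + k) d
      rwa [show e - 1 + k + d = e + d - 1 + k by omega] at this

lemma hitLim_up_add (e d : ℕ) :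
    hitLim p (fun _ _ => 1) (fun d k => d - 1 + k) (e + d) =
      hitLim p (fun _ _ => 1) (fun d k => d - 1 + k) e *
        hitLim p (fun _ _ => 1) (fun d k => d - 1 + k) d := by
  refine le_antisymm (iSup_le fun N => hitLim_up_add_le N e d) ?_
  rw [hitLim, ENNReal.iSup_mul]
  exact iSup_le fun N => le_hitLim_up_add N e d

lemma hitLim_up_eq_pow (d : ℕ) :
    hitLim p (fun _ _ => 1) (fun d k => d - 1 + k) d =
      hitLim p (fun _ _ => 1) (fun d k => d - 1 + k) 1 ^ d := by
  induction d with
  | zero => simp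
  | succ d ih => rw [hitLim_up_add, ih, pow_succ]

/-- The hitting probability of the next level is the smallest fixed point of the generating
function of the steps, and it is the return weight. -/
lemma returnWeight_up {r : ℝ≥0∞} (hr : ∑' k, p k * r ^ k = r)
    (hmin : ∀ y, y ≤ r → y ≠ 0 → ∑' k, p k * y ^ k = y → y = r) (hp0 : p 0 ≠ 0) :
    returnWeight p (fun _ _ => 1) (fun d k => d - 1 + k) = r := by
  set C := hitLim p (fun _ _ => 1) (fun d k => d - 1 + k) with hC
  have hle : ∀ d, C d ≤ r ^ d := by
    -- Since `r` is a fixed point, `r ^ d` is harmonic away from `0`.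
    refine hitLim_le_of_super _ _ _ (by simp) fun d hd => ?_
    obtain ⟨d, rfl⟩ := Nat.exists_eq_succ_of_ne_zero hd
    simp only [Nat.succ_eq_add_one, add_tsub_cancel_right, one_mul, pow_add, pow_one]
    rw [show ∑' k, p k * (r ^ d * r ^ k) = r ^ d * ∑' k, p k * r ^ k by
      rw [← ENNReal.tsum_mul_left]; congr with k; ring, hr]
  -- First-step analysis at `1` combined with `C k = C 1 ^ k`: thus `C 1` is itself a nonzero fixed
  -- point below `r`, hence equal to `r`.
  have hfix : ∑' k, p k * C 1 ^ k = C 1 := by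
    conv_rhs => rw [hC, hitLim_of_ne _ _ _ one_ne_zero]
    simp only [tsub_self, zero_add, one_mul]
    congr with k
    rw [← hitLim_up_eq_pow]
  have hne : C 1 ≠ 0 := by
    rw [← hfix]
    intro h0
    rw [ENNReal.tsum_eq_zero] at h0
    simpa [hp0] using h0 0
  have h1 : C 1 = r := hmin _ (by simpa using hle 1) hne hfix
  rw [returnWeight]
  -- By truncated subtraction the move out of `0` leads to `k`, exactly as from `1`: after a record
  -- the next target lies one level higher.
  simp only [Nat.zero_sub, zero_add, one_mul]
  rw [← h1]
  conv_rhs => rw [← hfix]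
  congr with k
  rw [← hitLim_up_eq_pow]

end up

/-! ### Hitting from above: the descending ladder structure -/

/-- For a fixed step `k`, the terms `n < k` overshoot the minimum and form a finite geometric sum,
while the terms `n ≥ k` are a shifted copy of the generating function of `c`. -/
lemma tsum_pow_mul_overshoot {s z : ℝ} (hz : 0 < z) (hz1 : z < 1)
    (hzs : z ≠ s) {c : ℕ → ℝ} (hc0 : ∀ n, 0 ≤ c n) (hc1 : ∀ n, c n ≤ 1) (k : ℕ) :
    HasSum (fun n => z ^ n * (s ^ (k - n) * c (n - k)))
      (s * (s ^ k - z ^ k) / (s - z) * c 0 + z ^ k * ∑' n, z ^ n * c n) := by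
  have hsum : Summable fun n => z ^ n * c n :=
    Summable.of_nonneg_of_le (fun n => mul_nonneg (by positivity) (hc0 n))
      (fun n => mul_le_of_le_one_right (by positivity) (hc1 n))
      (summable_geometric_of_lt_one hz.le hz1)
  rw [← hasSum_nat_add_iff' k]
  have h1 : ∑ n ∈ Finset.range k, z ^ n * (s ^ (k - n) * c (n - k)) =
      s * (s ^ k - z ^ k) / (s - z) * c 0 := by
    have h2 : s - z ≠ 0 := sub_ne_zero.2 hzs.symm
    rw [mul_div_assoc, show (s ^ k - z ^ k) / (s - z) = (z ^ k - s ^ k) / (z - s) by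
      rw [← neg_sub, ← neg_sub z s, neg_div_neg_eq], ← Commute.geom_sum₂ (Commute.all _ _) hzs,
      Finset.mul_sum, Finset.sum_mul]
    refine Finset.sum_congr rfl fun n hn => ?_
    have hn' := Finset.mem_range.1 hn
    rw [show n - k = 0 by omega, show k - n = (k - 1 - n) + 1 by omega, pow_succ]
    ring
  have h3 : (fun n => z ^ (n + k) * (s ^ (k - (n + k)) * c (n + k - k))) =
      fun n => z ^ k * (z ^ n * c n) := by
    ext n
    rw [show k - (n + k) = 0 by omega, Nat.add_sub_cancel, pow_add]
    ring
  rw [h1, h3, add_sub_cancel_left]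
  exact hsum.hasSum.mul_left (z ^ k)

/-- The double sum of `z ^ n * b k * s ^ (k - n) * c (n - k)` is evaluated in both orders. The
generating function of `c` is unknown, but at a fixed point `z` it enters both evaluations as the
same term and cancels, which leaves the return sum. -/
lemma returnSum_down_of_harmonic {s z : ℝ} (hs : 0 < s) (hs1 : s ≤ 1) (hz : 0 < z) (hz1 : z < 1)
    (hzs : z ≠ s) {b : ℕ → ℝ} (hb : ∀ k, 0 ≤ b k) (hbs : Summable b)
    (hbz : ∑' k, b k * z ^ k = z) {c : ℕ → ℝ} (hc0 : ∀ n, 0 ≤ c n) (hc1 : ∀ n, c n ≤ 1)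
    (h0 : c 0 = 1)
    (hc : ∀ d, d ≠ 0 → c d = ∑' k, b k * (s ^ (k - (d + 1)) * c (d + 1 - k))) :
    ∑' k, b k * (s ^ (k - 1) * c (1 - k)) = (∑' k, b k * s ^ k - z) / (s - z) := by
  set g : ℕ → ℕ → ℝ := fun n k => s ^ (k - n) * c (n - k) with hg
  have hg0 : ∀ n k, 0 ≤ g n k := fun n k => mul_nonneg (by positivity) (hc0 _)
  have hg1 : ∀ n k, g n k ≤ 1 := fun n k =>
    mul_le_one₀ (pow_le_one₀ hs.le hs1) (hc0 _) (hc1 _)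
  have hsum : Summable fun x : ℕ × ℕ => z ^ x.1 * (b x.2 * g x.1 x.2) := by
    refine Summable.of_nonneg_of_le (fun x => ?_) (fun x => ?_)
      ((summable_geometric_of_lt_one hz.le hz1).mul_of_nonneg hbs (fun n => by positivity) hb)
    · exact mul_nonneg (by positivity) (mul_nonneg (hb _) (hg0 _ _))
    · exact mul_le_mul_of_nonneg_left (mul_le_of_le_one_right (hb _) (hg1 _ _)) (by positivity)
  have hsumc : Summable fun n => z ^ n * c n :=
    Summable.of_nonneg_of_le (fun n => mul_nonneg (by positivity) (hc0 n))
      (fun n => mul_le_of_le_one_right (by positivity) (hc1 n))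
      (summable_geometric_of_lt_one hz.le hz1)
  have hpow : ∀ y, 0 ≤ y → y ≤ 1 → Summable fun k => b k * y ^ k := fun y hy hy1 =>
    Summable.of_nonneg_of_le (fun k => mul_nonneg (hb k) (by positivity))
      (fun k => mul_le_of_le_one_right (hb k) (pow_le_one₀ hy hy1)) hbs
  set G := ∑' n, z ^ n * c n with hG
  have hsz : s - z ≠ 0 := sub_ne_zero.2 hzs.symm
  -- Sum over `n` first; `hbz` turns the coefficient of `G` into `z`.
  have key1 : ∑' n, ∑' k, z ^ n * (b k * g n k) =
      s * (∑' k, b k * s ^ k - z) / (s - z) + z * G := by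
    rw [← hsum.tsum_comm]
    have h3 : ∀ k, ∑' n, z ^ n * (b k * g n k) =
        s / (s - z) * (b k * s ^ k) - s / (s - z) * (b k * z ^ k) + (b k * z ^ k) * G := by
      intro k
      have := (tsum_pow_mul_overshoot hz hz1 hzs hc0 hc1 k).mul_left (b k)
      rw [h0] at this
      rw [show (fun n => z ^ n * (b k * g n k)) =
        fun n => b k * (z ^ n * (s ^ (k - n) * c (n - k))) by ext n; simp only [hg]; ring,
        this.tsum_eq]
      ring
    simp_rw [h3]
    rw [Summable.tsum_add (((hpow s hs.le hs1).mul_left _).sub ((hpow z hz.le hz1.le).mul_left _))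
      ((hpow z hz.le hz1.le).mul_right _), Summable.tsum_sub ((hpow s hs.le hs1).mul_left _)
      ((hpow z hz.le hz1.le).mul_left _), tsum_mul_left, tsum_mul_left, tsum_mul_right, hbz]
    ring
  have hrow : Summable fun n => ∑' k, z ^ n * (b k * g n k) := hsum.prod
  -- Sum over `k` first: row `0` is the generating function at `s`, row `1` carries the return sum,
  -- and row `n + 2` reduces to `c (n + 1)` by harmonicity.
  have key2 : ∑' n, ∑' k, z ^ n * (b k * g n k) =
      ∑' k, b k * s ^ k + z * ∑' k, b k * g 1 k + z * (G - 1) := by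
    rw [hrow.tsum_eq_zero_add, ((summable_nat_add_iff 1).2 hrow).tsum_eq_zero_add, ← add_assoc]
    congr 1
    · congr 1
      · simp [hg, h0]
      · simp [tsum_mul_left]
    · rw [hG, hsumc.tsum_eq_zero_add]
      simp only [pow_zero, h0, mul_one, add_sub_cancel_left]
      rw [← tsum_mul_left]
      congr with n
      rw [tsum_mul_left, hc (n + 1) (by omega)]
      ring
  have : z * ∑' k, b k * g 1 k = z * ((∑' k, b k * s ^ k - z) / (s - z)) := by
    have := key1.symm.trans key2
    have h4 : s * (∑' k, b k * s ^ k - z) / (s - z) =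
      (∑' k, b k * s ^ k - z) + z * ((∑' k, b k * s ^ k - z) / (s - z)) := by
      field_simp
      ring
    linarith
  exact mul_left_cancel₀ hz.ne' this

/-- The weight `s ^ (undershoot)` for the height above the running minimum. -/
noncomputable def downWeight (s : ℝ) (d k : ℕ) : ℝ≥0∞ := ENNReal.ofReal s ^ (k - (d + 1))

lemma downWeight_le_one {s : ℝ} (hs1 : s ≤ 1) (d k : ℕ) : downWeight s d k ≤ 1 :=
  pow_le_one₀ zero_le (by simpa using hs1)

lemma summable_toReal_of_tsum_le_one {p : ℕ → ℝ≥0∞} (hp : ∑' k, p k ≤ 1) :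
    Summable fun k => (p k).toReal :=
  ENNReal.summable_toReal (ne_top_of_le_ne_top ENNReal.one_ne_top hp)

lemma ne_top_of_tsum_le_one {p : ℕ → ℝ≥0∞} (hp : ∑' k, p k ≤ 1) (k : ℕ) : p k ≠ ⊤ :=
  ne_top_of_le_ne_top ENNReal.one_ne_top ((ENNReal.le_tsum k).trans hp)

/-- The total mass may be less than one, which makes room for killed steps: killing produces fixed
points `z` strictly below `1`. -/
lemma returnWeight_down_of_fixed {p : ℕ → ℝ≥0∞} (hp : ∑' k, p k ≤ 1) {s z : ℝ} (hs : 0 < s)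
    (hs1 : s ≤ 1) (hz : 0 < z) (hz1 : z < 1) (hzs : z ≠ s)
    (hpz : ∑' k, (p k).toReal * z ^ k = z) :
    (returnWeight p (downWeight s) (fun d k => d + 1 - k)).toReal =
      (∑' k, (p k).toReal * s ^ k - z) / (s - z) := by
  set c := hitLim p (downWeight s) (fun d k => d + 1 - k) with hcdef
  have hc1 : ∀ d, c d ≤ 1 := hitLim_le_one _ hp (downWeight_le_one hs1)
  have hcr1 : ∀ d, (c d).toReal ≤ 1 := fun d =>
    (ENNReal.toReal_mono ENNReal.one_ne_top (hc1 d)).trans_eq ENNReal.toReal_one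
  have hreal : ∀ d, (∑' k, p k * (downWeight s d k * c (d + 1 - k))).toReal =
      ∑' k, (p k).toReal * (s ^ (k - (d + 1)) * (c (d + 1 - k)).toReal) := by
    intro d
    rw [ENNReal.tsum_toReal_eq]
    · congr with k
      simp [downWeight, ENNReal.toReal_ofReal hs.le]
    · intro k
      exact ENNReal.mul_ne_top (ne_top_of_tsum_le_one hp k) (ENNReal.mul_ne_top
        (ne_top_of_le_ne_top ENNReal.one_ne_top (downWeight_le_one hs1 d k))
        (ne_top_of_le_ne_top ENNReal.one_ne_top (hc1 _)))
  have := returnSum_down_of_harmonic hs hs1 hz hz1 hzs (fun k => ENNReal.toReal_nonneg)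
    (summable_toReal_of_tsum_le_one hp) hpz (c := fun n => (c n).toReal)
    (fun _ => ENNReal.toReal_nonneg) hcr1 (by simp [hcdef])
    (fun d hd => by
      rw [← hreal d]
      conv_lhs => rw [hcdef, hitLim_of_ne _ _ _ hd])
  rw [← this, returnWeight, ← hreal 0]

/-- The return weight of the reflection at the minimum, as the limit of the difference quotients
of the generating function at its smallest fixed point. -/
lemma tendsto_returnWeight_down {p : ℕ → ℝ≥0∞} (hp : ∑' k, p k = 1) {s r : ℝ} (hs : 0 < s)
    (hs1 : s ≤ 1) (hr : 0 < r) (hr1 : r ≤ 1) (hpr : ∑' k, (p k).toReal * r ^ k = r)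
    (hlt : ∀ z, 0 < z → z < r → z < ∑' k, (p k).toReal * z ^ k) :
    Tendsto (fun z => (∑' k, (p k).toReal * s ^ k - ∑' k, (p k).toReal * z ^ k) / (s - z))
      (𝓝[<] r) (𝓝 (returnWeight p (downWeight s) (fun d k => d + 1 - k)).toReal) := by
  set F : ℝ → ℝ := fun y => ∑' k, (p k).toReal * y ^ k with hF
  set κ := returnWeight p (downWeight s) (fun d k => d + 1 - k) with hκ
  have hκ1 : κ ≤ 1 := returnWeight_le_one _ hp.le (downWeight_le_one hs1)
  have hsp := summable_toReal_of_tsum_le_one hp.le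
  have hFc : ContinuousOn F (Icc 0 1) := by
    refine continuousOn_tsum (fun k => by fun_prop) hsp fun k y hy => ?_
    rw [norm_mul, norm_pow, Real.norm_of_nonneg ENNReal.toReal_nonneg, Real.norm_of_nonneg hy.1]
    exact mul_le_of_le_one_right ENNReal.toReal_nonneg (pow_le_one₀ hy.1 hy.2)
  have hFt : Tendsto F (𝓝[<] r) (𝓝 r) := by
    have h1 : ContinuousWithinAt F (Icc 0 1) r := hFc r ⟨hr.le, hr1⟩
    have h2 : F r = r := hpr
    have h3 : Tendsto F (𝓝[Icc 0 1] r) (𝓝 r) := by simpa [ContinuousWithinAt, h2] using h1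
    refine h3.mono_left ?_
    rw [← nhdsWithin_Ioo_eq_nhdsLT hr]
    exact nhdsWithin_mono _ fun y hy => ⟨hy.1.le, hy.2.le.trans hr1⟩
  have hIoo : ∀ᶠ z in 𝓝[<] r, z ∈ Ioo 0 r := Ioo_mem_nhdsLT hr
  have hne : ∀ᶠ z in 𝓝[<] r, z ≠ s := by
    rcases eq_or_ne r s with rfl | h
    · filter_upwards [hIoo] with z hz using hz.2.ne
    · exact (eventually_ne_nhds h).filter_mono nhdsWithin_le_nhds
  -- The killing factor `z / F z` is chosen so that `z` becomes a fixed point of the generating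
  -- function of the killed weights. It is below `1` for `z < r` and tends to `1` at `r`.
  have hδt : Tendsto (fun z => z / F z) (𝓝[<] r) (𝓝 1) := by
    have := (tendsto_id.mono_left (nhdsWithin_le_nhds (a := r) (s := Iio r))).div hFt hr.ne'
    rw [div_self hr.ne'] at this
    exact this
  -- the killed return weight
  set K : ℝ → ℝ := fun z => (returnWeight (fun k => ENNReal.ofReal (z / F z) * p k)
    (downWeight s) (fun d k => d + 1 - k)).toReal with hK
  have hKeq : ∀ᶠ z in 𝓝[<] r, K z = z / F z * ((F s - F z) / (s - z)) := by
    filter_upwards [hIoo, hne] with z hz hzs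
    have hFz : z < F z := hlt z hz.1 hz.2
    have hFz0 : 0 < F z := hz.1.trans hFz
    have hδ0 : 0 ≤ z / F z := div_nonneg hz.1.le hFz0.le
    have hδ1 : z / F z ≤ 1 := (div_le_one hFz0).2 hFz.le
    have hp' : ∑' k, ENNReal.ofReal (z / F z) * p k ≤ 1 := by
      rw [ENNReal.tsum_mul_left, hp, mul_one]
      simpa using hδ1
    have hsum : ∀ y, ∑' k, (ENNReal.ofReal (z / F z) * p k).toReal * y ^ k = z / F z * F y := by
      intro y
      rw [hF, ← tsum_mul_left]
      congr with k
      rw [ENNReal.toReal_mul, ENNReal.toReal_ofReal hδ0]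
      ring
    have := returnWeight_down_of_fixed hp' hs hs1 hz.1 (hz.2.trans_le hr1) hzs
      (by rw [hsum z]; field_simp)
    rw [hK]
    dsimp only
    rw [this, hsum s]
    field_simp
  have hKle : ∀ᶠ z in 𝓝[<] r, K z ≤ κ.toReal := by
    filter_upwards [hIoo] with z hz
    have hFz : z < F z := hlt z hz.1 hz.2
    have hδ1 : z / F z ≤ 1 := (div_le_one (hz.1.trans hFz)).2 hFz.le
    refine ENNReal.toReal_mono (ne_top_of_le_ne_top ENNReal.one_ne_top hκ1) ?_
    rw [hκ, returnWeight_eq_iSup, returnWeight_eq_iSup]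
    have hle : ∀ k, ENNReal.ofReal (z / F z) * p k ≤ p k := fun k =>
      mul_le_of_le_one_left zero_le (by simpa using hδ1)
    gcongr with N k
    · exact hle k
    · exact hit_mono_left _ hle N _
  -- The exponent is `N + 1` because the step out of `0` precedes the at most `N` steps back.
  have hKge : ∀ N, ∀ᶠ z in 𝓝[<] r, (z / F z) ^ (N + 1) *
      (∑' k, p k * (downWeight s 0 k * hit p (downWeight s) (fun d k => d + 1 - k) N (0 + 1 - k))).toReal
        ≤ K z := by
    intro N
    filter_upwards [hIoo] with z hz
    have hFz : z < F z := hlt z hz.1 hz.2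
    have hFz0 : 0 < F z := hz.1.trans hFz
    have hδ0 : 0 ≤ z / F z := div_nonneg hz.1.le hFz0.le
    have hδ1 : z / F z ≤ 1 := (div_le_one hFz0).2 hFz.le
    have hδ1' : ENNReal.ofReal (z / F z) ≤ 1 := by simpa using hδ1
    have hp' : ∑' k, ENNReal.ofReal (z / F z) * p k ≤ 1 := by
      rw [ENNReal.tsum_mul_left, hp, mul_one]
      exact hδ1'
    rw [← ENNReal.toReal_ofReal (pow_nonneg hδ0 (N + 1)), ← ENNReal.toReal_mul]
    refine ENNReal.toReal_mono (ne_top_of_le_ne_top ENNReal.one_ne_top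
      (returnWeight_le_one _ hp' (downWeight_le_one hs1))) ?_
    rw [returnWeight_eq_iSup, ← ENNReal.tsum_mul_left, ENNReal.ofReal_pow hδ0]
    refine le_trans ?_ (le_iSup _ N)
    refine ENNReal.tsum_le_tsum fun k => ?_
    calc _ = ENNReal.ofReal (z / F z) * p k * (downWeight s 0 k * (ENNReal.ofReal (z / F z) ^ N *
          hit p (downWeight s) (fun d k => d + 1 - k) N (0 + 1 - k))) := by ring
      _ ≤ _ := by gcongr; exact hit_killed_le _ hδ1' N _
  have hKt : Tendsto K (𝓝[<] r) (𝓝 κ.toReal) := by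
    refine tendsto_order.2 ⟨fun a ha => ?_, fun a ha => hKle.mono fun z hz => hz.trans_lt ha⟩
    obtain ⟨N, hN⟩ : ∃ N, a < (∑' k, p k * (downWeight s 0 k *
        hit p (downWeight s) (fun d k => d + 1 - k) N (0 + 1 - k))).toReal := by
      rcases lt_or_ge a 0 with h | h
      · exact ⟨0, h.trans_le ENNReal.toReal_nonneg⟩
      · have : ENNReal.ofReal a < κ := (ENNReal.ofReal_lt_iff_lt_toReal h
          (ne_top_of_le_ne_top ENNReal.one_ne_top hκ1)).2 ha
        rw [hκ, returnWeight_eq_iSup, lt_iSup_iff] at this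
        obtain ⟨N, hN⟩ := this
        refine ⟨N, (ENNReal.ofReal_lt_iff_lt_toReal h ?_).1 hN⟩
        exact ne_top_of_le_ne_top ENNReal.one_ne_top (tsum_mul_mul_le_one hp.le
          (downWeight_le_one hs1 0) fun k => (le_iSup (fun N => hit p _ _ N (0 + 1 - k)) N).trans
            (hitLim_le_one _ hp.le (downWeight_le_one hs1) _))
    have ht := (hδt.pow (N + 1)).mul_const (∑' k, p k * (downWeight s 0 k *
        hit p (downWeight s) (fun d k => d + 1 - k) N (0 + 1 - k))).toReal
    rw [one_pow, one_mul] at ht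
    filter_upwards [hKge N, ht.eventually (lt_mem_nhds hN)] with z h1 h2 using h2.trans_le h1
  have hlim := hKt.div hδt one_ne_zero
  rw [div_one] at hlim
  refine hlim.congr' ?_
  filter_upwards [hKeq, hIoo] with z hz hz'
  have hFz : z < F z := hlt z hz'.1 hz'.2
  have hFz0 : 0 < F z := hz'.1.trans hFz
  have : z / F z ≠ 0 := (div_pos hz'.1 hFz0).ne'
  simp only [Pi.div_apply, hz]
  rw [mul_div_cancel_left₀ _ this]


/-! ### The exponential law on `ℝ≥0` -/

/-- The exponential distribution of rate `lam`, as a measure on `ℝ≥0`. -/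
noncomputable def expLaw (lam : ℝ) : Measure ℝ≥0 :=
  ((volume.restrict (Ioi (0 : ℝ))).withDensity
    fun x => ENNReal.ofReal (lam * Real.exp (-(lam * x)))).map Real.toNNReal

section expLaw

variable {lam : ℝ}

lemma measurable_expDensity :
    Measurable fun x : ℝ => ENNReal.ofReal (lam * Real.exp (-(lam * x))) := by fun_prop

lemma lintegral_expLaw {g : ℝ≥0 → ℝ≥0∞} (hg : Measurable g) :
    ∫⁻ e, g e ∂expLaw lam =
      ∫⁻ x in Ioi (0 : ℝ), ENNReal.ofReal (lam * Real.exp (-(lam * x))) * g x.toNNReal := by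
  rw [expLaw, lintegral_map hg measurable_real_toNNReal,
    lintegral_withDensity_eq_lintegral_mul _ measurable_expDensity (by fun_prop)]
  rfl

lemma lintegral_expDensity_Ioi (hl : 0 < lam) (t : ℝ) :
    ∫⁻ x in Ioi t, ENNReal.ofReal (lam * Real.exp (-(lam * x))) =
      ENNReal.ofReal (Real.exp (-(lam * t))) := by
  have hint : IntegrableOn (fun x => lam * Real.exp (-(lam * x))) (Ioi t) := by
    have := (integrableOn_exp_mul_Ioi (a := -lam) (by linarith) t).const_mul lam
    simp only [neg_mul] at this
    exact this
  rw [← ofReal_integral_eq_lintegral_ofReal hint (ae_of_all _ fun x => by positivity)]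
  congr 1
  rw [integral_const_mul]
  have := integral_exp_mul_Ioi (a := -lam) (by linarith) t
  simp only [neg_mul] at this
  rw [this]
  field_simp

lemma setLIntegral_expLaw_Ioi (g : ℝ≥0 → ℝ≥0∞) (hg : Measurable g) (t : ℝ≥0) :
    ∫⁻ e in Ioi t, g e ∂expLaw lam =
      ∫⁻ x in Ioi (t : ℝ), ENNReal.ofReal (lam * Real.exp (-(lam * x))) * g x.toNNReal := by
  rw [← lintegral_indicator measurableSet_Ioi, lintegral_expLaw (hg.indicator measurableSet_Ioi),
    ← lintegral_indicator measurableSet_Ioi, ← lintegral_indicator measurableSet_Ioi]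
  congr with x
  by_cases hx : (t : ℝ) < x
  · have h0 : 0 < x := t.coe_nonneg.trans_lt hx
    have h1 : t < x.toNNReal := by rwa [Real.lt_toNNReal_iff_coe_lt]
    simp [indicator, hx, h0, h1]
  · have h1 : ¬ t < x.toNNReal := by rwa [Real.lt_toNNReal_iff_coe_lt]
    simp [indicator, hx, h1]

instance isProbabilityMeasure_expLaw [Fact (0 < lam)] : IsProbabilityMeasure (expLaw lam) := by
  constructor
  have h := lintegral_expLaw (lam := lam) (g := fun _ => 1) measurable_const
  rw [lintegral_one] at h
  rw [h]
  simp only [mul_one]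
  rw [lintegral_expDensity_Ioi (Fact.out : 0 < lam)]
  simp

lemma expLaw_zero : expLaw lam {0} = 0 := by
  have h := lintegral_expLaw (lam := lam) (g := ({0} : Set ℝ≥0).indicator 1)
    (measurable_one.indicator (measurableSet_singleton 0))
  rw [lintegral_indicator_one (measurableSet_singleton 0)] at h
  rw [h, setLIntegral_congr_fun (g := fun _ => 0) measurableSet_Ioi]
  · simp
  · intro x hx
    have : x.toNNReal ≠ 0 := by simpa using hx
    simp [indicator, this]

/-- The lack of memory of the exponential law. -/
lemma expLaw_memoryless {g : ℝ≥0 → ℝ≥0∞} (hg : Measurable g) (t : ℝ≥0) :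
    ∫⁻ e in Ioi t, g (e - t) ∂expLaw lam =
      ENNReal.ofReal (Real.exp (-(lam * t))) * ∫⁻ e, g e ∂expLaw lam := by
  rw [setLIntegral_expLaw_Ioi _ (by fun_prop), lintegral_expLaw hg,
    ← lintegral_const_mul _ (by fun_prop), ← lintegral_indicator measurableSet_Ioi,
    ← lintegral_indicator measurableSet_Ioi, ← lintegral_add_right_eq_self _ (t : ℝ)]
  congr with x
  by_cases hx : 0 < x
  · have h1 : (t : ℝ) < x + t := by linarith
    have h2 : (x + t).toNNReal - t = x.toNNReal := by
      rw [Real.toNNReal_add hx.le t.coe_nonneg, Real.toNNReal_coe, add_tsub_cancel_right]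
    rw [indicator_of_mem (show x + (t : ℝ) ∈ Ioi (t : ℝ) from h1),
      indicator_of_mem (show x ∈ Ioi (0 : ℝ) from hx), h2, ← mul_assoc,
      ← ENNReal.ofReal_mul (by positivity)]
    congr 2
    rw [mul_left_comm, ← Real.exp_add]
    ring_nf
  · have h1 : ¬ (t : ℝ) < x + t := by linarith
    rw [indicator_of_notMem (show x + (t : ℝ) ∉ Ioi (t : ℝ) from h1),
      indicator_of_notMem (show x ∉ Ioi (0 : ℝ) from hx)]

lemma expLaw_Ioi [hl : Fact (0 < lam)] (t : ℝ≥0) :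
    expLaw lam (Ioi t) = ENNReal.ofReal (Real.exp (-(lam * t))) := by
  have := expLaw_memoryless (lam := lam) (g := fun _ => 1) measurable_const t
  simpa using this

lemma setIntegral_expLaw_Iic [hl : Fact (0 < lam)] {g : ℝ≥0 → ℂ} (hg : Measurable g) (t : ℝ≥0) :
    ∫ e in Iic t, g e ∂expLaw lam =
      ∫ x in (0 : ℝ)..t, ((lam * Real.exp (-(lam * x)) : ℝ) : ℂ) * g x.toNNReal := by
  rw [intervalIntegral.integral_of_le t.coe_nonneg, ← integral_indicator measurableSet_Iic, expLaw,
    integral_map measurable_real_toNNReal.aemeasurable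
      (hg.indicator measurableSet_Iic).aestronglyMeasurable]
  rw [integral_withDensity_eq_integral_toReal_smul measurable_expDensity
    (ae_of_all _ fun x => ENNReal.ofReal_lt_top), ← integral_indicator measurableSet_Ioi,
    ← integral_indicator measurableSet_Ioc]
  congr with x
  have hl' : 0 < lam := hl.out
  by_cases h0 : 0 < x
  · by_cases hx : x ≤ t
    · have h1 : x.toNNReal ≤ t := by rwa [Real.toNNReal_le_iff_le_coe]
      rw [indicator_of_mem (show x ∈ Ioi (0 : ℝ) from h0),
        indicator_of_mem (show x ∈ Ioc (0 : ℝ) t from ⟨h0, hx⟩),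
        indicator_of_mem (show x.toNNReal ∈ Iic t from h1),
        ENNReal.toReal_ofReal (by positivity), Complex.real_smul]
    · have h1 : ¬ x.toNNReal ≤ t := by rwa [Real.toNNReal_le_iff_le_coe]
      rw [indicator_of_notMem (show x ∉ Ioc (0 : ℝ) t from fun h => hx h.2),
        indicator_of_mem (show x ∈ Ioi (0 : ℝ) from h0),
        indicator_of_notMem (show x.toNNReal ∉ Iic t from h1), smul_zero]
  · rw [indicator_of_notMem (show x ∉ Ioc (0 : ℝ) t from fun h => h0 h.1),
      indicator_of_notMem (show x ∉ Ioi (0 : ℝ) from h0)]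

end expLaw

/-! ### The renewal equation -/

/-- After multiplication by `exp (lam * t)` the convolution becomes a primitive `W`, and the
equation becomes the linear differential equation W' = 1 + κ lam W. -/
lemma renewal_eq_exp {lam : ℝ} [hl : Fact (0 < lam)] (κ : ℂ) {u : ℝ≥0 → ℂ} (hu : Measurable u)
    {C : ℝ} (hb : ∀ t, ‖u t‖ ≤ C)
    (h : ∀ t, u t = (Real.exp (-(lam * t)) : ℂ) + κ * ∫ e in Iic t, u (t - e) ∂expLaw lam)
    (t : ℝ≥0) : u t = Complex.exp (-(lam * (1 - κ) * t)) := by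
  set v : ℝ → ℂ := fun y => (Real.exp (lam * y) : ℂ) * u y.toNNReal with hv
  have hvm : Measurable v := by fun_prop
  have hvi : ∀ a b, IntervalIntegrable v volume a b := by
    intro a b
    have hc : IntervalIntegrable (fun y => (Real.exp (lam * y) : ℂ)) volume a b :=
      Continuous.intervalIntegrable (by fun_prop) _ _
    have hm : AEStronglyMeasurable (fun y : ℝ => u y.toNNReal) volume :=
      (hu.comp measurable_real_toNNReal).aestronglyMeasurable
    exact ⟨hc.1.mul_bdd hm.restrict (ae_of_all _ fun y => hb _),
      hc.2.mul_bdd hm.restrict (ae_of_all _ fun y => hb _)⟩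
  set W : ℝ → ℂ := fun y => ∫ x in (0 : ℝ)..y, v x with hW
  have hWc : Continuous W := intervalIntegral.continuous_primitive hvi 0
  have hveq : ∀ y, 0 ≤ y → v y = 1 + κ * lam * W y := by
    intro y hy
    have h1 := h y.toNNReal
    rw [setIntegral_expLaw_Iic (by fun_prop), Real.coe_toNNReal y hy] at h1
    have h2 : ∫ x in (0 : ℝ)..y, ((lam * Real.exp (-(lam * x)) : ℝ) : ℂ) *
        u (y.toNNReal - x.toNNReal) = (lam * Real.exp (-(lam * y)) : ℝ) * W y := by
      rw [hW]
      dsimp only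
      rw [← intervalIntegral.integral_const_mul]
      have h3 := intervalIntegral.integral_comp_sub_left (a := 0) (b := y)
        (fun x => ((lam * Real.exp (-(lam * y)) : ℝ) : ℂ) * v x) y
      rw [sub_self, sub_zero] at h3
      rw [← h3]
      refine intervalIntegral.integral_congr fun x hx => ?_
      rw [uIcc_of_le hy] at hx
      have h4 : y.toNNReal - x.toNNReal = (y - x).toNNReal := by
        ext
        rw [NNReal.coe_sub (Real.toNNReal_le_toNNReal hx.2), Real.coe_toNNReal _ hy,
          Real.coe_toNNReal _ hx.1, Real.coe_toNNReal _ (by linarith [hx.2])]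
      simp only [hv]
      rw [h4, ← mul_assoc, ← Complex.ofReal_mul, mul_assoc lam, ← Real.exp_add]
      congr 4
      ring
    rw [h2] at h1
    simp only [hv]
    rw [h1, mul_add, ← Complex.ofReal_mul, ← Real.exp_add]
    have h5 : (Real.exp (lam * y) : ℂ) * (Real.exp (-(lam * y)) : ℂ) = 1 := by
      rw [← Complex.ofReal_mul, ← Real.exp_add]; simp
    rw [add_neg_cancel, Real.exp_zero, Complex.ofReal_one, Complex.ofReal_mul]
    linear_combination (κ * lam * W y) * h5
  -- `v` is only known to be measurable and bounded on compacts, but on `[0, ∞)` it agrees with a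
  -- continuous function of `W`, so `W` is differentiable there; at `0` only from the right.
  have hWd : ∀ y, 0 ≤ y → HasDerivWithinAt W (1 + κ * lam * W y) (Ici y) y := by
    intro y hy
    have h1 : HasDerivAt (fun z => ∫ x in (0 : ℝ)..z, (1 + κ * lam * W x)) (1 + κ * lam * W y) y :=
      intervalIntegral.integral_hasDerivAt_right
        (Continuous.intervalIntegrable (by fun_prop) _ _)
        (Continuous.stronglyMeasurableAtFilter (by fun_prop) _ _) (by fun_prop)
    refine h1.hasDerivWithinAt.congr ?_ ?_
    · intro z hz
      refine intervalIntegral.integral_congr fun x hx => ?_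
      rw [uIcc_of_le (hy.trans hz)] at hx
      exact hveq x hx.1
    · refine intervalIntegral.integral_congr fun x hx => ?_
      rw [uIcc_of_le hy] at hx
      exact hveq x hx.1
  -- The integrating factor: `Z` has zero right derivative and is therefore constant.
  set Z : ℝ → ℂ := fun y => (1 + κ * lam * W y) * Complex.exp (-(κ * lam * y)) with hZ
  have hZc : Continuous Z := by fun_prop
  have hZd : ∀ y ∈ Ico (0 : ℝ) t, HasDerivWithinAt Z 0 (Ici y) y := by
    intro y hy
    have h1 : HasDerivAt (fun y : ℝ => Complex.exp (-(κ * lam * y)))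
        (Complex.exp (-(κ * lam * y)) * (-(κ * lam))) y := by
      have h3 : HasDerivAt (fun y : ℝ => -(κ * lam * (y : ℂ))) (-(κ * lam * 1)) y :=
        ((Complex.ofRealCLM.hasDerivAt (x := y)).const_mul (κ * lam)).neg
      simpa using h3.cexp
    have h2 := (((hWd y hy.1).const_mul (κ * lam)).const_add 1).mul h1.hasDerivWithinAt
    convert! h2 using 1
    ring
  have hZ0 := constant_of_has_deriv_right_zero hZc.continuousOn hZd t ⟨t.coe_nonneg, le_rfl⟩
  have hZ1 : Z 0 = 1 := by simp [hZ, hW]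
  rw [hZ1, hZ] at hZ0
  dsimp only at hZ0
  rw [← hveq t t.coe_nonneg, hv] at hZ0
  simp only [Real.toNNReal_coe] at hZ0
  calc u t = (Real.exp (lam * t) * u t * Complex.exp (-(κ * lam * t))) *
        Complex.exp (-(lam * (1 - κ) * t)) := by
        rw [Complex.ofReal_exp, mul_right_comm _ (u t), ← Complex.exp_add, mul_right_comm,
          ← Complex.exp_add]
        push_cast
        ring_nf
        simp
    _ = _ := by
        have : ((t : ℝ≥0) : ℂ) = (((t : ℝ≥0) : ℝ) : ℂ) := rfl
        rw [hZ0, one_mul]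

lemma renewal_eq_exp_ennreal {lam : ℝ} [hl : Fact (0 < lam)] {κ : ℝ≥0∞} (hκ : κ ≤ 1)
    {u : ℝ≥0 → ℝ≥0∞} (hu : Measurable u) (hb : ∀ t, u t ≤ 1)
    (h : ∀ t, u t = ENNReal.ofReal (Real.exp (-(lam * t))) +
      κ * ∫⁻ e in Iic t, u (t - e) ∂expLaw lam)
    (t : ℝ≥0) : u t = ENNReal.ofReal (Real.exp (-(lam * (1 - κ.toReal) * t))) := by
  have hne : ∀ t, u t ≠ ⊤ := fun t => ne_top_of_le_ne_top ENNReal.one_ne_top (hb t)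
  have hκne : κ ≠ ⊤ := ne_top_of_le_ne_top ENNReal.one_ne_top hκ
  have key := renewal_eq_exp (lam := lam) (κ.toReal : ℂ) (u := fun t => ((u t).toReal : ℂ))
    (by fun_prop) (C := 1) (fun t => by
      rw [Complex.norm_real, Real.norm_of_nonneg ENNReal.toReal_nonneg]
      exact (ENNReal.toReal_mono ENNReal.one_ne_top (hb t)).trans_eq ENNReal.toReal_one)
    (fun t => by
      have h3 : ∫ e in Iic t, ((u (t - e)).toReal : ℂ) ∂expLaw lam =
        ((∫ e in Iic t, (u (t - e)).toReal ∂expLaw lam : ℝ) : ℂ) := integral_ofReal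
      rw [h3, integral_toReal (by fun_prop) (ae_of_all _ fun e => (hne _).lt_top),
        ← Complex.ofReal_mul, ← Complex.ofReal_add]
      congr 1
      have hfin : κ * ∫⁻ e in Iic t, u (t - e) ∂expLaw lam ≠ ⊤ := by
        intro htop
        exact hne t (by rw [h t, htop, add_top])
      have h1 := congrArg ENNReal.toReal (h t)
      rw [ENNReal.toReal_add ENNReal.ofReal_ne_top hfin, ENNReal.toReal_mul,
        ENNReal.toReal_ofReal (Real.exp_nonneg _)] at h1
      exact h1) t
  rw [← ENNReal.ofReal_toReal (hne t)]
  congr 1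
  have h2 : ((Real.exp (-(lam * (1 - κ.toReal) * t)) : ℝ) : ℂ) =
      Complex.exp (-(lam * (1 - (κ.toReal : ℂ)) * t)) := by push_cast; rfl
  rw [← h2] at key
  exact_mod_cast key

/-- A killed compound Poisson functional of the local time at `0` of a Markov chain on `ℕ` with
exponential holding times. -/
lemma iSup_excursion_eq_exp {lam : ℝ} [hl : Fact (0 < lam)] {p : ℕ → ℝ≥0∞} (hp : ∑' k, p k ≤ 1)
    {m : ℕ → ℕ → ℝ≥0∞} (hm : ∀ d k, m d k ≤ 1) {τ : ℕ → ℕ → ℕ} {w : ℕ → ℕ → ℝ≥0 → ℝ≥0∞}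
    (hmeas : ∀ N d, Measurable (w N d)) (hw : ∀ d t, w 0 d t = 0)
    (h0 : ∀ N t, w (N + 1) 0 t = ENNReal.ofReal (Real.exp (-(lam * t))) +
      ∫⁻ e in Iic t, ∑' k, p k * (m 0 k * w N (τ 0 k) (t - e)) ∂expLaw lam)
    (hs : ∀ N d, d ≠ 0 → ∀ t, w (N + 1) d t = ∑' k, p k * (m d k * w N (τ d k) t)) (t : ℝ≥0) :
    ⨆ N, w N 0 t =
      ENNReal.ofReal (Real.exp (-(lam * (1 - (returnWeight p m τ).toReal) * t))) := by
  have hmono1 : ∀ N d t, w N d t ≤ w (N + 1) d t := by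
    intro N
    induction N with
    | zero => intro d t; simp [hw]
    | succ N ih =>
      intro d t
      by_cases hd : d = 0
      · subst hd
        rw [h0, h0]
        gcongr
        exact ih _ _
      · rw [hs _ _ hd, hs _ _ hd]
        gcongr
        exact ih _ _
  have hmono : ∀ d t, Monotone fun N => w N d t := fun d t =>
    monotone_nat_of_le_succ fun N => hmono1 N d t
  have hle1 : ∀ N d t, w N d t ≤ 1 := by
    intro N
    induction N with
    | zero => intro d t; simp [hw]
    | succ N ih =>
      intro d t
      by_cases hd : d = 0
      · subst hd
        rw [h0, ← expLaw_Ioi]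
        calc _ ≤ expLaw lam (Ioi t) + ∫⁻ e in Iic t, 1 ∂expLaw lam := by
              gcongr
              exact tsum_mul_mul_le_one hp (hm 0) fun k => ih _ _
          _ = expLaw lam (Ioi t) + expLaw lam (Iic t) := by simp
          _ = 1 := by
            rw [add_comm, ← measure_union (by simp [disjoint_left]) measurableSet_Ioi,
              Iic_union_Ioi, measure_univ]
      · rw [hs _ _ hd]
        exact tsum_mul_mul_le_one hp (hm d) fun k => ih _ _
  set v : ℕ → ℝ≥0 → ℝ≥0∞ := fun d t => ⨆ N, w N d t with hv
  have hvm : ∀ d, Measurable (v d) := fun d => .iSup fun N => hmeas N d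
  have hv1 : ∀ d t, v d t ≤ 1 := fun d t => iSup_le fun N => hle1 N d t
  have hvs : ∀ d, d ≠ 0 → ∀ t, v d t = ∑' k, p k * (m d k * v (τ d k) t) := by
    intro d hd t
    have h1 : v d t = ⨆ N, w (N + 1) d t := ((hmono d t).iSup_nat_add 1).symm
    rw [h1]
    simp_rw [hs _ _ hd, hv, ENNReal.mul_iSup]
    rw [tsum_iSup_of_monotone]
    intro k a b hab
    dsimp only
    gcongr
    exact hmono _ _ hab
  -- Away from `0` the clock stands still, so the passage to `0` contributes a factor that does not
  -- depend on `t`.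
  have hvd : ∀ d t, v d t = hitLim p m τ d * v 0 t := by
    intro d t
    refine le_antisymm (iSup_le fun N => ?_) ?_
    · induction N generalizing d with
      | zero => simp [hw]
      | succ N ih =>
        by_cases hd : d = 0
        · subst hd
          rw [hitLim_zero, one_mul]
          exact le_iSup (fun N => w N 0 t) (N + 1)
        · rw [hs _ _ hd, hitLim_of_ne _ _ _ hd, ← ENNReal.tsum_mul_right]
          refine ENNReal.tsum_le_tsum fun k => ?_
          rw [mul_assoc, mul_assoc]
          gcongr
          exact ih _
    · rw [hitLim, ENNReal.iSup_mul]
      refine iSup_le fun N => ?_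
      induction N generalizing d with
      | zero =>
        by_cases hd : d = 0
        · simp [hd]
        · simp [hit, hd]
      | succ N ih =>
        by_cases hd : d = 0
        · simp [hd]
        · rw [hit_succ_of_ne _ _ _ hd, hvs d hd, ← ENNReal.tsum_mul_right]
          refine ENNReal.tsum_le_tsum fun k => ?_
          rw [mul_assoc, mul_assoc]
          gcongr
          exact ih _
  refine renewal_eq_exp_ennreal (returnWeight_le_one τ hp hm) (hvm 0) (hv1 0) (fun t => ?_) t
  have h1 : v 0 t = ⨆ N, w (N + 1) 0 t := ((hmono 0 t).iSup_nat_add 1).symm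
  rw [h1]
  simp_rw [h0]
  rw [← ENNReal.add_iSup, ← lintegral_iSup]
  · rw [← lintegral_const_mul _ (by fun_prop)]
    congr with e
    rw [← tsum_iSup_of_monotone]
    · simp_rw [← ENNReal.mul_iSup]
      rw [returnWeight, ← ENNReal.tsum_mul_right]
      congr with k
      have := hvd (τ 0 k) (t - e)
      rw [hv] at this
      dsimp only at this ⊢
      rw [this]
      ring
    · intro k a b hab
      dsimp only
      gcongr
      exact hmono _ _ hab
  · intro N
    have := hmeas N
    fun_prop
  · intro a b hab e
    dsimp only
    gcongr
    exact hmono _ _ hab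


/-! ### I.i.d. sequences of holding times and steps -/

/-- The law on `ℕ` with weights `p`. -/
noncomputable def stepLaw (p : ℕ → ℝ≥0∞) : Measure ℕ := Measure.sum fun k => p k • Measure.dirac k

lemma lintegral_stepLaw (p : ℕ → ℝ≥0∞) (g : ℕ → ℝ≥0∞) :
    ∫⁻ k, g k ∂stepLaw p = ∑' k, p k * g k := by
  simp [stepLaw, lintegral_sum_measure, lintegral_smul_measure]

instance isProbabilityMeasure_stepLaw {p : ℕ → ℝ≥0∞} [hp : Fact (∑' k, p k = 1)] :
    IsProbabilityMeasure (stepLaw p) := by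
  constructor
  rw [← lintegral_one, lintegral_stepLaw]
  simpa using hp.out

/-- Prepend an element to a sequence. -/
def consSeq {α : Type*} (a : α) (ω : ℕ → α) : ℕ → α
  | 0 => a
  | n + 1 => ω n

/-- Drop the first `n` elements of a sequence. -/
def dropSeq {α : Type*} (n : ℕ) (ω : ℕ → α) : ℕ → α := fun i => ω (n + i)

section seq

variable {α : Type*}

@[simp] lemma consSeq_zero (a : α) (ω : ℕ → α) : consSeq a ω 0 = a := rfl

@[simp] lemma consSeq_succ (a : α) (ω : ℕ → α) (n : ℕ) : consSeq a ω (n + 1) = ω n := rfl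

@[simp] lemma dropSeq_one_consSeq (a : α) (ω : ℕ → α) : dropSeq 1 (consSeq a ω) = ω := by
  ext n
  simp [dropSeq, add_comm 1 n]

lemma dropSeq_dropSeq (m n : ℕ) (ω : ℕ → α) : dropSeq m (dropSeq n ω) = dropSeq (n + m) ω := by
  ext i
  simp [dropSeq, add_assoc]

variable [MeasurableSpace α]

@[fun_prop] lemma measurable_consSeq : Measurable fun x : α × (ℕ → α) => consSeq x.1 x.2 := by
  refine measurable_pi_lambda _ fun n => ?_
  cases n with
  | zero => exact measurable_fst
  | succ n => exact (measurable_pi_apply n).comp measurable_snd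

@[fun_prop] lemma measurable_dropSeq (n : ℕ) : Measurable (dropSeq n : (ℕ → α) → ℕ → α) :=
  measurable_pi_lambda _ fun _ => measurable_pi_apply _

/-- Uniqueness of the infinite product measure, tested on finite cylinders; the case distinction is
whether the cylinder constrains coordinate `0`. -/
lemma map_consSeq_infinitePi (μ : Measure α) [IsProbabilityMeasure μ] :
    (μ.prod (Measure.infinitePi fun _ : ℕ => μ)).map (fun x => consSeq x.1 x.2) =
      Measure.infinitePi fun _ : ℕ => μ := by
  refine Measure.eq_infinitePi _ fun s t ht => ?_
  have hinj : InjOn Nat.succ (Nat.succ ⁻¹' (s : Set ℕ)) := Nat.succ_injective.injOn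
  rw [Measure.map_apply measurable_consSeq (MeasurableSet.pi s.countable_toSet fun i _ => ht i)]
  have hpre : (fun x : α × (ℕ → α) => consSeq x.1 x.2) ⁻¹' ((s : Set ℕ).pi t) =
      (if 0 ∈ s then t 0 else univ) ×ˢ
        ((s.preimage Nat.succ hinj : Finset ℕ) : Set ℕ).pi fun n => t (n + 1) := by
    ext ⟨a, ω⟩
    simp only [mem_preimage, Set.mem_pi, Finset.mem_coe, mem_prod, Finset.mem_preimage]
    constructor
    · intro h
      refine ⟨?_, fun n hn => h (n + 1) hn⟩
      split_ifs with h0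
      · exact h 0 h0
      · trivial
    · rintro ⟨h1, h2⟩ n hn
      cases n with
      | zero => rwa [if_pos hn] at h1
      | succ n => exact h2 n hn
  rw [hpre, Measure.prod_prod, Measure.infinitePi_pi _ (fun i _ => ht _)]
  have hprod := Finset.prod_preimage Nat.succ s hinj (fun i => if i = 0 then 1 else μ (t i))
    (fun x _ hx => by
      cases x with
      | zero => simp
      | succ n => exact absurd ⟨n, rfl⟩ hx)
  simp only [Nat.succ_eq_add_one, Nat.add_eq_zero_iff, one_ne_zero, and_false, if_false] at hprod
  rw [hprod]
  by_cases h0 : 0 ∈ s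
  · rw [← Finset.mul_prod_erase s _ h0, ← Finset.mul_prod_erase s _ h0]
    simp only [h0, if_true, one_mul]
    congr 1
    refine Finset.prod_congr rfl fun i hi => ?_
    simp [Finset.ne_of_mem_erase hi]
  · simp only [h0, if_false, measure_univ, one_mul]
    refine Finset.prod_congr rfl fun i hi => ?_
    have : i ≠ 0 := fun h => h0 (h ▸ hi)
    simp [this]

end seq

/-- The law of an i.i.d. sequence of exponential holding times and steps. -/
noncomputable def seqLaw (lam : ℝ) (p : ℕ → ℝ≥0∞) [Fact (0 < lam)] [Fact (∑' k, p k = 1)] :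
    Measure (ℕ → ℝ≥0 × ℕ) :=
  Measure.infinitePi fun _ => (expLaw lam).prod (stepLaw p)

section seqLaw

variable {lam : ℝ} {p : ℕ → ℝ≥0∞} [hl : Fact (0 < lam)] [hp : Fact (∑' k, p k = 1)]

instance : IsProbabilityMeasure (seqLaw lam p) := by
  unfold seqLaw
  infer_instance

lemma measurePreserving_consSeq :
    MeasurePreserving (fun x : (ℝ≥0 × ℕ) × (ℕ → ℝ≥0 × ℕ) => consSeq x.1 x.2)
      (((expLaw lam).prod (stepLaw p)).prod (seqLaw lam p)) (seqLaw lam p) :=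
  ⟨measurable_consSeq, map_consSeq_infinitePi _⟩

/-- The decomposition at the first holding time and step, from which the recursions for `runValue`
follow. -/
lemma lintegral_seqLaw {F : (ℕ → ℝ≥0 × ℕ) → ℝ≥0∞} (hF : Measurable F) :
    ∫⁻ ω, F ω ∂seqLaw lam p =
      ∫⁻ e, ∑' k, p k * ∫⁻ ω, F (consSeq (e, k) ω) ∂seqLaw lam p ∂expLaw lam := by
  rw [← measurePreserving_consSeq.lintegral_comp hF, lintegral_prod _ (by fun_prop),
    lintegral_prod _ (by fun_prop)]
  simp_rw [lintegral_stepLaw]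

end seqLaw

/-! ### A clocked Markov chain driven by an i.i.d. sequence -/

section run

variable {S : Type*} (clock : S → Bool) (τ : S → ℕ → S)

/-- The state after `n` steps. -/
def runState (σ : S) (ω : ℕ → ℝ≥0 × ℕ) : ℕ → S
  | 0 => σ
  | n + 1 => τ (runState σ ω n) (ω n).2

/-- The time shown by the clock after `n` steps; the clock is only running in some states. -/
noncomputable def clockTime (σ : S) (ω : ℕ → ℝ≥0 × ℕ) (n : ℕ) : ℝ≥0 :=
  ∑ i ∈ Finset.range n, if clock (runState τ σ ω i) then (ω i).1 else 0

/-- The functional `H` of the state and of the remaining sequence, at the time when the clock passes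
the level `t`, if that happens in less than `N` steps. -/
noncomputable def runValue (H : S → (ℕ → ℝ≥0 × ℕ) → ℝ≥0∞) : ℕ → S → ℝ≥0 → (ℕ → ℝ≥0 × ℕ) → ℝ≥0∞
  | 0, _, _, _ => 0
  | N + 1, σ, t, ω =>
    if clock σ then
      if t < (ω 0).1 then H σ (consSeq ((ω 0).1 - t, (ω 0).2) (dropSeq 1 ω))
      else runValue H N (τ σ (ω 0).2) (t - (ω 0).1) (dropSeq 1 ω)
    else runValue H N (τ σ (ω 0).2) t (dropSeq 1 ω)

variable {clock τ}

lemma runState_succ' (σ : S) (ω : ℕ → ℝ≥0 × ℕ) (n : ℕ) :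
    runState τ σ ω (n + 1) = runState τ (τ σ (ω 0).2) (dropSeq 1 ω) n := by
  induction n with
  | zero => rfl
  | succ n ih =>
    rw [runState, ih, runState]
    simp [dropSeq, add_comm 1 n]

lemma clockTime_zero (σ : S) (ω : ℕ → ℝ≥0 × ℕ) : clockTime clock τ σ ω 0 = 0 := rfl

lemma clockTime_succ (σ : S) (ω : ℕ → ℝ≥0 × ℕ) (n : ℕ) :
    clockTime clock τ σ ω (n + 1) = clockTime clock τ σ ω n +
      if clock (runState τ σ ω n) then (ω n).1 else 0 :=
  Finset.sum_range_succ _ _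

lemma clockTime_succ' (σ : S) (ω : ℕ → ℝ≥0 × ℕ) (n : ℕ) :
    clockTime clock τ σ ω (n + 1) = (if clock σ then (ω 0).1 else 0) +
      clockTime clock τ (τ σ (ω 0).2) (dropSeq 1 ω) n := by
  rw [clockTime, Finset.sum_range_succ', add_comm]
  congr 1
  refine Finset.sum_congr rfl fun i _ => ?_
  rw [runState_succ']
  simp [dropSeq, add_comm 1 i]

lemma clockTime_mono (σ : S) (ω : ℕ → ℝ≥0 × ℕ) : Monotone (clockTime clock τ σ ω) :=
  monotone_nat_of_le_succ fun n => by rw [clockTime_succ]; exact le_self_add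

variable {H : S → (ℕ → ℝ≥0 × ℕ) → ℝ≥0∞}

/-- Closed form of the recursion: the clock crosses `t` during step `n`, and the remaining sequence
begins with what is left of that holding time. -/
lemma runValue_eq_of_mem {n : ℕ} : ∀ {N : ℕ} {σ : S} {t : ℝ≥0} {ω : ℕ → ℝ≥0 × ℕ}, n < N →
    clockTime clock τ σ ω n ≤ t → t < clockTime clock τ σ ω (n + 1) →
    runValue clock τ H N σ t ω = H (runState τ σ ω n)
      (consSeq ((ω n).1 - (t - clockTime clock τ σ ω n), (ω n).2) (dropSeq (n + 1) ω)) := by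
  induction n with
  | zero =>
    intro N σ t ω hN h1 h2
    obtain ⟨N, rfl⟩ := Nat.exists_eq_succ_of_ne_zero (by omega : N ≠ 0)
    rw [clockTime_succ, clockTime_zero, zero_add] at h2
    by_cases hc : clock (runState τ σ ω 0)
    · have hc' : clock σ := hc
      rw [if_pos hc] at h2
      simp [runValue, hc', h2, runState, clockTime_zero]
    · simp [hc] at h2
  | succ n ih =>
    intro N σ t ω hN h1 h2
    obtain ⟨N, rfl⟩ := Nat.exists_eq_succ_of_ne_zero (by omega : N ≠ 0)
    have hrest : dropSeq (n + 1) (dropSeq 1 ω) = dropSeq (n + 1 + 1) ω := by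
      rw [dropSeq_dropSeq, add_comm 1]
    have hn : dropSeq 1 ω n = ω (n + 1) := by simp [dropSeq, add_comm 1 n]
    rw [clockTime_succ'] at h1 h2
    by_cases hc : clock σ
    · rw [if_pos hc] at h1 h2
      have h3 : (ω 0).1 ≤ t := le_self_add.trans h1
      have h4 : ¬ t < (ω 0).1 := not_lt.2 h3
      have h5 : t = (ω 0).1 + (t - (ω 0).1) := (add_tsub_cancel_of_le h3).symm
      rw [h5, add_le_add_iff_left] at h1
      rw [h5, add_lt_add_iff_left] at h2
      simp only [runValue, hc, if_true, h4, if_false]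
      rw [ih (by omega) h1 h2, runState_succ', hrest, hn, clockTime_succ', if_pos hc, tsub_tsub]
    · simp only [hc, Bool.false_eq_true, if_false, zero_add] at h1 h2
      simp only [runValue, hc, Bool.false_eq_true, if_false]
      rw [ih (by omega) h1 h2, runState_succ', hrest, hn, clockTime_succ', if_neg hc, zero_add]

lemma runValue_eq_zero : ∀ {N : ℕ} {σ : S} {t : ℝ≥0} {ω : ℕ → ℝ≥0 × ℕ},
    clockTime clock τ σ ω N ≤ t → runValue clock τ H N σ t ω = 0 := by
  intro N
  induction N with
  | zero => intros; rfl
  | succ N ih =>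
    intro σ t ω h
    rw [clockTime_succ'] at h
    by_cases hc : clock σ
    · rw [if_pos hc] at h
      have h3 : (ω 0).1 ≤ t := le_self_add.trans h
      have h4 : ¬ t < (ω 0).1 := not_lt.2 h3
      simp only [runValue, hc, if_true, h4, if_false]
      exact ih (le_tsub_of_add_le_left h)
    · simp only [hc, Bool.false_eq_true, if_false, zero_add] at h
      simp only [runValue, hc, Bool.false_eq_true, if_false]
      exact ih h

lemma exists_clockTime_mem {σ : S} {t : ℝ≥0} {ω : ℕ → ℝ≥0 × ℕ} {N : ℕ}
    (h : t < clockTime clock τ σ ω N) :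
    ∃ n < N, clockTime clock τ σ ω n ≤ t ∧ t < clockTime clock τ σ ω (n + 1) := by
  induction N with
  | zero => simp [clockTime_zero] at h
  | succ N ih =>
    by_cases h' : t < clockTime clock τ σ ω N
    · obtain ⟨n, hn, hn'⟩ := ih h'
      exact ⟨n, hn.trans (Nat.lt_succ_self N), hn'⟩
    · exact ⟨N, Nat.lt_succ_self N, not_lt.1 h', h⟩

lemma iSup_runValue_eq_of_mem {n : ℕ} {σ : S} {t : ℝ≥0} {ω : ℕ → ℝ≥0 × ℕ}
    (h1 : clockTime clock τ σ ω n ≤ t) (h2 : t < clockTime clock τ σ ω (n + 1)) :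
    ⨆ N, runValue clock τ H N σ t ω = H (runState τ σ ω n)
      (consSeq ((ω n).1 - (t - clockTime clock τ σ ω n), (ω n).2) (dropSeq (n + 1) ω)) := by
  refine le_antisymm (iSup_le fun N => ?_) ?_
  · rcases lt_or_ge n N with h | h
    · exact (runValue_eq_of_mem h h1 h2).le
    · rw [runValue_eq_zero ((clockTime_mono σ ω h).trans h1)]
      exact zero_le
  · rw [← runValue_eq_of_mem (H := H) (Nat.lt_succ_self n) h1 h2]
    exact le_iSup (fun N => runValue clock τ H N σ t ω) (n + 1)

lemma iSup_runValue_eq_zero {σ : S} {t : ℝ≥0} {ω : ℕ → ℝ≥0 × ℕ}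
    (h : ∀ n, clockTime clock τ σ ω n ≤ t) : ⨆ N, runValue clock τ H N σ t ω = 0 := by
  simp [runValue_eq_zero (h _)]

lemma runValue_mono (σ : S) (t : ℝ≥0) (ω : ℕ → ℝ≥0 × ℕ) :
    Monotone fun N => runValue clock τ H N σ t ω := by
  intro M N hMN
  dsimp only
  by_cases h : t < clockTime clock τ σ ω M
  · obtain ⟨n, hn, h1, h2⟩ := exists_clockTime_mem h
    rw [runValue_eq_of_mem hn h1 h2, runValue_eq_of_mem (hn.trans_le hMN) h1 h2]
  · rw [runValue_eq_zero (not_lt.1 h)]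
    exact zero_le

lemma measurable_runValue (hH : ∀ σ, Measurable (H σ)) (N : ℕ) :
    ∀ σ, Measurable fun x : ℝ≥0 × (ℕ → ℝ≥0 × ℕ) => runValue clock τ H N σ x.1 x.2 := by
  induction N with
  | zero => intro σ; exact measurable_const
  | succ N ih =>
    intro σ
    have hstep : Measurable fun y : ℕ × (ℝ≥0 × (ℕ → ℝ≥0 × ℕ)) =>
        runValue clock τ H N (τ σ y.1) y.2.1 y.2.2 :=
      measurable_from_prod_countable_right fun k => ih (τ σ k)
    simp only [runValue]
    refine Measurable.ite (by simp) (Measurable.ite ?_ ?_ ?_) ?_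
    · exact measurableSet_lt (by fun_prop) (by fun_prop)
    · refine (hH σ).comp ?_
      fun_prop
    · exact hstep.comp (f := fun x : ℝ≥0 × (ℕ → ℝ≥0 × ℕ) =>
        ((x.2 0).2, x.1 - (x.2 0).1, dropSeq 1 x.2)) (by fun_prop)
    · exact hstep.comp (f := fun x : ℝ≥0 × (ℕ → ℝ≥0 × ℕ) =>
        ((x.2 0).2, x.1, dropSeq 1 x.2)) (by fun_prop)

lemma measurable_runValue_right (hH : ∀ σ, Measurable (H σ)) (N : ℕ) (σ : S) (t : ℝ≥0) :
    Measurable (runValue clock τ H N σ t) :=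
  (measurable_runValue hH N σ).comp measurable_prodMk_left

variable {lam : ℝ} {p : ℕ → ℝ≥0∞} [hl : Fact (0 < lam)] [hp : Fact (∑' k, p k = 1)]

lemma measurable_lintegral_runValue (hH : ∀ σ, Measurable (H σ)) (N : ℕ) (σ : S) :
    Measurable fun t => ∫⁻ ω, runValue clock τ H N σ t ω ∂seqLaw lam p :=
  (measurable_runValue hH N σ).lintegral_prod_right'

lemma lintegral_runValue_of_not_clock (hH : ∀ σ, Measurable (H σ)) (N : ℕ) {σ : S}
    (hc : clock σ = false) (t : ℝ≥0) :
    ∫⁻ ω, runValue clock τ H (N + 1) σ t ω ∂seqLaw lam p =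
      ∑' k, p k * ∫⁻ ω, runValue clock τ H N (τ σ k) t ω ∂seqLaw lam p := by
  rw [lintegral_seqLaw (measurable_runValue_right hH _ _ _)]
  simp [runValue, hc]

/-- If the first holding time exceeds `t`, its residue is again exponential by lack of memory, so
`H` sees a sequence of the original law. Otherwise the recursion continues with the level lowered by
that holding time. -/
lemma lintegral_runValue_of_clock (hH : ∀ σ, Measurable (H σ)) (N : ℕ) {σ : S}
    (hc : clock σ = true) (t : ℝ≥0) :
    ∫⁻ ω, runValue clock τ H (N + 1) σ t ω ∂seqLaw lam p =
      ENNReal.ofReal (Real.exp (-(lam * t))) * ∫⁻ ω, H σ ω ∂seqLaw lam p +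
      ∫⁻ e in Iic t, ∑' k, p k * ∫⁻ ω, runValue clock τ H N (τ σ k) (t - e) ω ∂seqLaw lam p
        ∂expLaw lam := by
  have hg : Measurable fun e : ℝ≥0 => ∑' k, p k * ∫⁻ ω, H σ (consSeq (e, k) ω) ∂seqLaw lam p := by
    refine .tsum fun k => Measurable.const_mul ?_ _
    refine Measurable.lintegral_prod_right'
      (f := fun x : ℝ≥0 × (ℕ → ℝ≥0 × ℕ) => H σ (consSeq (x.1, k) x.2)) ?_
    exact (hH σ).comp (by fun_prop)
  rw [lintegral_seqLaw (measurable_runValue_right hH _ _ _), lintegral_seqLaw (hH σ),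
    ← expLaw_memoryless hg, ← lintegral_add_compl _ (measurableSet_Ioi (a := t)), compl_Ioi]
  congr 1
  · refine setLIntegral_congr_fun measurableSet_Ioi fun e he => ?_
    have he' : t < e := he
    simp [runValue, hc, he']
  · refine setLIntegral_congr_fun measurableSet_Iic fun e he => ?_
    have he' : ¬ t < e := not_lt.2 he
    simp [runValue, hc, he']

/-- At the passage of the clock over a level, the remaining sequence is a fresh copy independent of
the state. -/
lemma lintegral_runValue_eq_mean (hH : ∀ σ, Measurable (H σ)) (N : ℕ) : ∀ (σ : S) (t : ℝ≥0),
    ∫⁻ ω, runValue clock τ H N σ t ω ∂seqLaw lam p =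
      ∫⁻ ω, runValue clock τ (fun σ _ => ∫⁻ ω, H σ ω ∂seqLaw lam p) N σ t ω ∂seqLaw lam p := by
  have hH' : ∀ σ : S, Measurable fun _ : ℕ → ℝ≥0 × ℕ => ∫⁻ ω, H σ ω ∂seqLaw lam p :=
    fun σ => measurable_const
  induction N with
  | zero => intro σ t; rfl
  | succ N ih =>
    intro σ t
    cases hc : clock σ with
    | false =>
      rw [lintegral_runValue_of_not_clock hH N hc, lintegral_runValue_of_not_clock hH' N hc]
      simp_rw [ih]
    | true =>
      rw [lintegral_runValue_of_clock hH N hc, lintegral_runValue_of_clock hH' N hc]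
      simp_rw [ih]
      simp

lemma lintegral_iSup_runValue (hH : ∀ σ, Measurable (H σ)) (σ : S) (t : ℝ≥0) :
    ∫⁻ ω, ⨆ N, runValue clock τ H N σ t ω ∂seqLaw lam p =
      ⨆ N, ∫⁻ ω, runValue clock τ H N σ t ω ∂seqLaw lam p :=
  lintegral_iSup (fun N => measurable_runValue_right hH N σ t)
    fun _ _ hMN ω => runValue_mono σ t ω hMN

end run

/-! ### Step paths -/

/-- The time of the `n`-th jump. -/
noncomputable def arrival (ω : ℕ → ℝ≥0 × ℕ) (n : ℕ) : ℝ≥0 := ∑ i ∈ Finset.range n, (ω i).1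

/-- The value of the walk with steps `1 - k` after `n` steps. -/
def walk (ω : ℕ → ℝ≥0 × ℕ) (n : ℕ) : ℤ := runState (fun (y : ℤ) (k : ℕ) => y + 1 - k) 0 ω n

/-- The holding times are positive and do not accumulate, and there are no void steps. -/
structure IsGood (ω : ℕ → ℝ≥0 × ℕ) : Prop where
  pos : ∀ n, 0 < (ω n).1
  ne_one : ∀ n, (ω n).2 ≠ 1
  unbounded : ∀ t, ∃ n, t < arrival ω n

section arrival

variable {ω : ℕ → ℝ≥0 × ℕ}

@[simp] lemma arrival_zero : arrival ω 0 = 0 := rfl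

lemma arrival_succ (n : ℕ) : arrival ω (n + 1) = arrival ω n + (ω n).1 :=
  Finset.sum_range_succ _ _

lemma walk_succ (n : ℕ) : walk ω (n + 1) = walk ω n + 1 - (ω n).2 := rfl

lemma IsGood.strictMono (h : IsGood ω) : StrictMono (arrival ω) :=
  strictMono_nat_of_lt_succ fun n => by
    rw [arrival_succ]
    exact lt_add_of_pos_right _ (h.pos n)

lemma IsGood.exists_mem (h : IsGood ω) (t : ℝ≥0) :
    ∃ n, arrival ω n ≤ t ∧ t < arrival ω (n + 1) := by
  obtain ⟨N, hN⟩ := h.unbounded t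
  induction N with
  | zero => simp at hN
  | succ N ih =>
    by_cases h' : t < arrival ω N
    · exact ih h'
    · exact ⟨N, not_lt.1 h', hN⟩

lemma IsGood.eq_of_mem (h : IsGood ω) {t : ℝ≥0} {m n : ℕ} (h1 : arrival ω m ≤ t)
    (h2 : t < arrival ω (m + 1)) (h3 : arrival ω n ≤ t) (h4 : t < arrival ω (n + 1)) : m = n := by
  have h5 := h.strictMono.lt_iff_lt.1 (h1.trans_lt h4)
  have h6 := h.strictMono.lt_iff_lt.1 (h3.trans_lt h2)
  omega

end arrival

/-- The path with jump times `arrival ω` and values `h * walk ω`. -/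
def IsWalkPath (h : ℝ) (ω : ℕ → ℝ≥0 × ℕ) (f : ℝ≥0 → ℝ) : Prop :=
  ∀ n t, arrival ω n ≤ t → t < arrival ω (n + 1) → f t = h * walk ω n

/-- The amount of time up to `t` spent in the set `G`. -/
noncomputable def occupation (G : Set ℝ≥0) (t : ℝ≥0) : ℝ≥0∞ :=
  volume ((fun s : ℝ≥0 => (s : ℝ)) '' {s | s ≤ t ∧ s ∈ G})

/-! ### Occupation times of step paths and their right-continuous inverses. -/

section occupation

variable {G : Set ℝ≥0}

lemma occupation_mono : Monotone (occupation G) := fun _ _ hab =>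
  measure_mono (image_mono fun _ hs => ⟨hs.1.trans hab, hs.2⟩)

lemma occupation_eq_add {a t : ℝ≥0} (hat : a ≤ t) :
    occupation G t = occupation G a +
      volume ((fun s : ℝ≥0 => (s : ℝ)) '' {s | a < s ∧ s ≤ t ∧ s ∈ G}) := by
  -- `G` is arbitrary; only the half-line that cuts the set has to be measurable.
  rw [occupation, ← measure_inter_add_sdiff _ (measurableSet_Iic (a := (a : ℝ)))]
  congr 2
  · ext x
    constructor
    · rintro ⟨⟨s, hs, rfl⟩, hx⟩
      exact ⟨s, ⟨NNReal.coe_le_coe.1 hx, hs.2⟩, rfl⟩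
    · rintro ⟨s, hs, rfl⟩
      exact ⟨⟨s, ⟨hs.1.trans hat, hs.2⟩, rfl⟩, NNReal.coe_le_coe.2 hs.1⟩
  · ext x
    constructor
    · rintro ⟨⟨s, hs, rfl⟩, hx⟩
      exact ⟨s, ⟨NNReal.coe_lt_coe.1 (not_le.1 hx), hs⟩, rfl⟩
    · rintro ⟨s, hs, rfl⟩
      exact ⟨⟨s, hs.2, rfl⟩, not_le.2 (NNReal.coe_lt_coe.2 hs.1)⟩

lemma occupation_zero : occupation G 0 = 0 := by
  refine measure_mono_null (t := {0}) ?_ (by simp)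
  rintro _ ⟨s, hs, rfl⟩
  simpa using hs.1

lemma occupation_eq_add_of_mem {a t : ℝ≥0} (hat : a ≤ t) (hG : ∀ s, a ≤ s → s < t → s ∈ G) :
    occupation G t = occupation G a + (t - a : ℝ≥0) := by
  rw [occupation_eq_add hat]
  congr 1
  have hsub : (((t - a : ℝ≥0) : ℝ≥0∞)) = ENNReal.ofReal (t - a) := by
    rw [← NNReal.coe_sub hat, ENNReal.ofReal_coe_nnreal]
  refine le_antisymm ?_ ?_
  · calc _ ≤ volume (Ioc (a : ℝ) t) := by
          refine measure_mono ?_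
          rintro _ ⟨s, hs, rfl⟩
          exact ⟨NNReal.coe_lt_coe.2 hs.1, NNReal.coe_le_coe.2 hs.2.1⟩
      _ = _ := by rw [Real.volume_Ioc, hsub]
  · calc _ = volume (Ioo (a : ℝ) t) := by rw [Real.volume_Ioo, hsub]
      _ ≤ _ := by
          refine measure_mono fun x hx => ?_
          have hx0 : 0 ≤ x := a.coe_nonneg.trans hx.1.le
          lift x to ℝ≥0 using hx0
          have h1 : a < x := NNReal.coe_lt_coe.1 hx.1
          have h2 : x < t := NNReal.coe_lt_coe.1 hx.2
          exact ⟨x, ⟨h1, h2.le, hG x h1.le h2⟩, rfl⟩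

lemma occupation_eq_of_notMem {a t : ℝ≥0} (hat : a ≤ t) (hG : ∀ s, a ≤ s → s < t → s ∉ G) :
    occupation G t = occupation G a := by
  rw [occupation_eq_add hat]
  convert add_zero _
  refine measure_mono_null (t := {(t : ℝ)}) ?_ (by simp)
  rintro _ ⟨s, hs, rfl⟩
  rcases hs.2.1.lt_or_eq with h | h
  · exact absurd hs.2.2 (hG s hs.1.le h)
  · simp [h]

variable {S : Type*} {clock : S → Bool} {τ : S → ℕ → S} {σ : S} {ω : ℕ → ℝ≥0 × ℕ}

/-- On each holding interval `G` is everything or nothing, so its occupation time grows at unit rate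
or stays constant, as the clock does. -/
lemma occupation_eq_clockTime_add (hω : IsGood ω)
    (hG : ∀ n s, arrival ω n ≤ s → s < arrival ω (n + 1) →
      (s ∈ G ↔ clock (runState τ σ ω n) = true)) (n : ℕ) :
    ∀ t, arrival ω n ≤ t → t ≤ arrival ω (n + 1) → occupation G t =
      (clockTime clock τ σ ω n + if clock (runState τ σ ω n) then t - arrival ω n else 0 : ℝ≥0) := by
  have key : ∀ n t, arrival ω n ≤ t → t ≤ arrival ω (n + 1) → occupation G t =
      occupation G (arrival ω n) +
        (if clock (runState τ σ ω n) then t - arrival ω n else 0 : ℝ≥0) := by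
    intro n t h1 h2
    split_ifs with hc
    · exact occupation_eq_add_of_mem h1 fun s hs hs' => (hG n s hs (hs'.trans_le h2)).2 hc
    · rw [ENNReal.coe_zero, add_zero]
      exact occupation_eq_of_notMem h1 fun s hs hs' => fun hsG => hc ((hG n s hs (hs'.trans_le h2)).1 hsG)
  have harr : ∀ n, occupation G (arrival ω n) = clockTime clock τ σ ω n := by
    intro n
    induction n with
    | zero => simp [occupation_zero, clockTime_zero]
    | succ n ih =>
      rw [key n _ (hω.strictMono.monotone (Nat.le_succ n)) le_rfl, ih, clockTime_succ,
        arrival_succ, add_tsub_cancel_left, ENNReal.coe_add]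
  intro t h1 h2
  rw [key n t h1 h2, harr, ENNReal.coe_add]

/-- The crossing of level `t` falls in a holding interval on which the clock is running. There the
occupation time has slope one and can be inverted explicitly. -/
lemma rightInverse_occupation_of_mem (hω : IsGood ω)
    (hG : ∀ n s, arrival ω n ≤ s → s < arrival ω (n + 1) →
      (s ∈ G ↔ clock (runState τ σ ω n) = true)) {n : ℕ} {t : ℝ≥0}
    (h1 : clockTime clock τ σ ω n ≤ t) (h2 : t < clockTime clock τ σ ω (n + 1)) :
    clock (runState τ σ ω n) = true ∧
    rightInverse (occupation G) t = (arrival ω n + (t - clockTime clock τ σ ω n) : ℝ≥0) ∧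
      arrival ω n + (t - clockTime clock τ σ ω n) < arrival ω (n + 1) := by
  have hocc := occupation_eq_clockTime_add hω hG n
  have hc : clock (runState τ σ ω n) = true := by
    by_contra hc
    rw [clockTime_succ, if_neg hc, add_zero] at h2
    exact absurd h1 (not_le.2 h2)
  simp only [hc, if_true] at hocc
  rw [clockTime_succ, if_pos hc] at h2
  set A := clockTime clock τ σ ω n
  set a := arrival ω n with ha
  have h3 : t - A < (ω n).1 := (tsub_lt_iff_left h1).2 h2
  have h4 : a + (t - A) < arrival ω (n + 1) := by
    rw [arrival_succ, ← ha]
    gcongr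
  refine ⟨hc, le_antisymm ?_ ?_, h4⟩
  · refine le_of_forall_gt fun b hb => ?_
    rw [rightInverse, iInf_lt_iff]
    -- choose a time strictly between
    obtain ⟨c, hc1, hc2⟩ := exists_between (lt_min (ENNReal.coe_lt_coe.2 h4) hb)
    have hctop : c ≠ ⊤ := (hc2.trans_le (min_le_left _ _)).ne_top
    lift c to ℝ≥0 using hctop
    have hc1' : a + (t - A) < c := ENNReal.coe_lt_coe.1 hc1
    have hc2' : c < arrival ω (n + 1) := ENNReal.coe_lt_coe.1 (hc2.trans_le (min_le_left _ _))
    have hac : a ≤ c := le_self_add.trans hc1'.le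
    refine ⟨c, iInf_lt_iff.2 ⟨?_, hc2.trans_le (min_le_right _ _)⟩⟩
    rw [hocc c hac hc2'.le]
    refine ENNReal.coe_lt_coe.2 ?_
    have h5 : t - A < c - a := by
      rw [lt_tsub_iff_left]
      exact hc1'
    calc t = A + (t - A) := (add_tsub_cancel_of_le h1).symm
      _ < A + (c - a) := by gcongr
  · refine le_iInf₂ fun s hs => ?_
    rw [ENNReal.coe_le_coe]
    by_contra hlt
    have hlt' : s ≤ a + (t - A) := (not_le.1 hlt).le
    have := occupation_mono (G := G) hlt'
    rw [hocc _ le_self_add h4.le, add_tsub_cancel_left, add_tsub_cancel_of_le h1] at this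
    exact absurd hs (not_lt.2 this)

lemma rightInverse_occupation_of_not (hω : IsGood ω)
    (hG : ∀ n s, arrival ω n ≤ s → s < arrival ω (n + 1) →
      (s ∈ G ↔ clock (runState τ σ ω n) = true)) {t : ℝ≥0}
    (h : ∀ n, clockTime clock τ σ ω n ≤ t) : rightInverse (occupation G) t = ⊤ := by
  rw [rightInverse, iInf_eq_top]
  refine fun s => iInf_eq_top.2 fun hs => ?_
  obtain ⟨n, hn1, hn2⟩ := hω.exists_mem s
  have h1 := occupation_mono (G := G) hn2.le
  have h0 := occupation_eq_clockTime_add hω hG (n + 1) _ le_rfl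
    (hω.strictMono.monotone (Nat.le_succ _))
  rw [h0, tsub_self, ite_self, add_zero] at h1
  exact absurd (hs.trans_le h1) (not_lt.2 (ENNReal.coe_le_coe.2 (h _)))

end occupation

/-- A normalization of local time by `x` amounts to running the inverse at `t / x`. With `x = r⁻¹`
this is the origin of the factor `r` in the descending exponent. -/
lemma rightInverse_const_mul {x : ℝ} (hx : 0 < x) (L : ℝ≥0 → ℝ≥0∞) (t : ℝ≥0) :
    rightInverse (fun s => ENNReal.ofReal x * L s) t = rightInverse L (t * x⁻¹.toNNReal) := by
  have hx0 : ENNReal.ofReal x ≠ 0 := by simpa using hx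
  have h1 : ((t * x⁻¹.toNNReal : ℝ≥0) : ℝ≥0∞) = t / ENNReal.ofReal x := by
    rw [ENNReal.coe_mul, ENNReal.div_eq_inv_mul, ← ENNReal.ofReal_inv_of_pos hx, mul_comm]
    rfl
  simp only [rightInverse, h1, ENNReal.div_lt_iff (Or.inl hx0) (Or.inl ENNReal.ofReal_ne_top),
    mul_comm (ENNReal.ofReal x)]

/-! ### Ladder processes of a step path as clocked Markov chains. -/

section ladder

variable {h : ℝ} {ω : ℕ → ℝ≥0 × ℕ} {f : ℝ≥0 → ℝ}

/-- Distance to the next strict record of the walk. -/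
abbrev recordStep (d k : ℕ) : ℕ := d - 1 + k

/-- Height above the running minimum, and depth of the running minimum. -/
abbrev reflectStep (x : ℕ × ℕ) (k : ℕ) : ℕ × ℕ := (x.1 + 1 - k, x.2 + (k - (x.1 + 1)))

/-- The invariant is a level `B` above all earlier values, with the walk at distance `D` below it.
For `D = 0` the walk sits at `B` and sets a record; for `D ≠ 0` the level `B - 1` was reached
earlier, so no record is possible. After a record `B` rises by one. -/
lemma record_iff (ω : ℕ → ℝ≥0 × ℕ) (n : ℕ) :
    (∀ j < n, walk ω j < walk ω n) ↔ runState recordStep 0 ω n = 0 := by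
  have key : ∀ n, ∃ B : ℤ, walk ω n = B - runState recordStep 0 ω n ∧ (∀ j < n, walk ω j < B) ∧
      (runState recordStep 0 ω n ≠ 0 → ∃ j < n, walk ω j = B - 1) := by
    intro n
    induction n with
    | zero => exact ⟨0, by simp [walk, runState], by simp, by simp [runState]⟩
    | succ n ih =>
      obtain ⟨B, h1, h2, h3⟩ := ih
      have hD : runState recordStep 0 ω (n + 1) = runState recordStep 0 ω n - 1 + (ω n).2 := rfl
      set D := runState recordStep 0 ω n
      by_cases hD0 : D = 0
      · refine ⟨B + 1, ?_, ?_, fun _ => ⟨n, Nat.lt_succ_self n, ?_⟩⟩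
        · rw [walk_succ, hD, h1, hD0]; push_cast; ring
        · intro j hj
          rcases Nat.lt_succ_iff_lt_or_eq.1 hj with hj | rfl
          · exact (h2 j hj).trans (lt_add_one B)
          · rw [h1, hD0]; simp
        · rw [h1, hD0]; simp
      · refine ⟨B, ?_, ?_, fun _ => ?_⟩
        · rw [walk_succ, hD, h1]; push_cast [Nat.one_le_iff_ne_zero.2 hD0]; ring
        · intro j hj
          rcases Nat.lt_succ_iff_lt_or_eq.1 hj with hj | rfl
          · exact h2 j hj
          · rw [h1]; omega
        · obtain ⟨j, hj, hj'⟩ := h3 hD0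
          exact ⟨j, hj.trans (Nat.lt_succ_self n), hj'⟩
  obtain ⟨B, h1, h2, h3⟩ := key n
  constructor
  · intro hall
    by_contra hne
    obtain ⟨j, hj, hj'⟩ := h3 hne
    have := hall j hj
    omega
  · intro h0 j hj
    rw [h1, h0]
    simpa using h2 j hj

lemma walk_eq_reflect (ω : ℕ → ℝ≥0 × ℕ) (n : ℕ) :
    walk ω n = (runState reflectStep (0, 0) ω n).1 - (runState reflectStep (0, 0) ω n).2 := by
  induction n with
  | zero => simp [walk, runState]
  | succ n ih =>
    rw [walk_succ, ih]
    simp only [runState, reflectStep]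
    omega

/-- The second coordinate is the depth of the running minimum: it never decreases, and minus its
value is attained by the walk at some time up to `n`. -/
lemma minimum_iff (ω : ℕ → ℝ≥0 × ℕ) (n : ℕ) :
    (∀ j ≤ n, walk ω n ≤ walk ω j) ↔ (runState reflectStep (0, 0) ω n).1 = 0 := by
  have hmono : Monotone fun n => (runState reflectStep (0, 0) ω n).2 :=
    monotone_nat_of_le_succ fun n => by simp only [runState, reflectStep]; omega
  have key : ∀ n, ∃ j ≤ n, walk ω j = -(runState reflectStep (0, 0) ω n).2 := by
    intro n
    induction n with
    | zero => exact ⟨0, le_rfl, by simp [walk, runState]⟩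
    | succ n ih =>
      obtain ⟨j, hj, hj'⟩ := ih
      by_cases hk : (runState reflectStep (0, 0) ω n).1 + 1 ≤ (ω n).2
      · refine ⟨n + 1, le_rfl, ?_⟩
        rw [walk_eq_reflect]
        simp only [runState, reflectStep]
        omega
      · refine ⟨j, hj.trans (Nat.le_succ n), ?_⟩
        rw [hj']
        simp only [runState, reflectStep]
        omega
  constructor
  · intro hall
    obtain ⟨j, hj, hj'⟩ := key n
    have h1 := hall j hj
    have h2 := walk_eq_reflect ω n
    omega
  · intro h0 j hj
    have h1 := walk_eq_reflect ω n
    have h2 := walk_eq_reflect ω j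
    have h3 := hmono hj
    simp only at h3
    omega

lemma IsGood.walk_ne_succ (hω : IsGood ω) (n : ℕ) : walk ω (n + 1) ≠ walk ω n := by
  have := hω.ne_one n
  rw [walk_succ]
  omega

/-- Because no step is void, the path changes at each jump. The time `a` at which the maximum was
reached thus lies in the same holding interval as `s`. -/
lemma atNewMax_iff (hh : 0 < h) (hω : IsGood ω) (hf : IsWalkPath h ω f) {n : ℕ} {s : ℝ≥0}
    (h1 : arrival ω n ≤ s) (h2 : s < arrival ω (n + 1)) :
    AtNewMax f s ↔ ∀ j < n, walk ω j < walk ω n := by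
  have hlt : ∀ a b : ℤ, h * a < h * b ↔ a < b := fun a b => by
    rw [mul_lt_mul_iff_right₀ hh, Int.cast_lt]
  have harr : ∀ m, f (arrival ω m) = h * walk ω m := fun m =>
    hf m _ le_rfl (hω.strictMono (Nat.lt_succ_self m))
  constructor
  · rintro ⟨a, has, hbefore, hconst⟩ j hj
    obtain ⟨m, hm1, hm2⟩ := hω.exists_mem a
    have hmn : m ≤ n := by
      have := hω.strictMono.lt_iff_lt.1 (hm1.trans_lt (has.trans_lt h2))
      omega
    rcases hmn.lt_or_eq with hmn | rfl
    · have h3 := hconst (arrival ω (m + 1)) hm2.le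
        ((hω.strictMono.monotone hmn).trans h1)
      rw [harr, hf m a hm1 hm2] at h3
      have h4 := mul_left_cancel₀ hh.ne' h3
      exact absurd (by exact_mod_cast h4) (hω.walk_ne_succ m)
    · have h3 := hbefore (arrival ω j) ((hω.strictMono hj).trans_le hm1)
      rwa [harr, hf m a hm1 hm2, hlt] at h3
  · intro hall
    refine ⟨arrival ω n, h1, fun r hr => ?_, fun r hr1 hr2 => ?_⟩
    · obtain ⟨m, hm1, hm2⟩ := hω.exists_mem r
      rw [harr, hf m r hm1 hm2, hlt]
      exact hall m (hω.strictMono.lt_iff_lt.1 (hm1.trans_lt hr))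
    · rw [harr, hf n r hr1 (hr2.trans_lt h2)]

lemma atMin_iff (hh : 0 < h) (hω : IsGood ω) (hf : IsWalkPath h ω f) {n : ℕ} {s : ℝ≥0}
    (h1 : arrival ω n ≤ s) (h2 : s < arrival ω (n + 1)) :
    (∀ r ≤ s, f s ≤ f r) ↔ ∀ j ≤ n, walk ω n ≤ walk ω j := by
  have hle : ∀ a b : ℤ, h * a ≤ h * b ↔ a ≤ b := fun a b => by
    rw [mul_le_mul_iff_right₀ hh, Int.cast_le]
  rw [hf n s h1 h2]
  constructor
  · intro hall j hj
    have := hall (arrival ω j) ((hω.strictMono.monotone hj).trans h1)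
    rwa [hf j _ le_rfl (hω.strictMono (Nat.lt_succ_self j)), hle] at this
  · intro hall r hr
    obtain ⟨m, hm1, hm2⟩ := hω.exists_mem r
    rw [hf m r hm1 hm2, hle]
    refine hall m ?_
    have := hω.strictMono.lt_iff_lt.1 (hm1.trans_lt (hr.trans_lt h2))
    omega

lemma newMaxTime_eq (f : ℝ≥0 → ℝ) : newMaxTime f = occupation {s | AtNewMax f s} := rfl

lemma minTime_eq (f : ℝ≥0 → ℝ) : minTime f = occupation {s | ∀ r ≤ s, f s ≤ f r} := rfl

lemma evalAt_top (f : ℝ≥0 → ℝ) : evalAt f ⊤ = ⊤ := by simp [evalAt]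

lemma evalAt_coe (f : ℝ≥0 → ℝ) (t : ℝ≥0) : evalAt f t = (f t : ℝ) := by simp [evalAt]

/-- The constant functional `1` only detects whether the clock ever passes `t`, that is, whether the
ladder process is still alive. -/
lemma iSup_runValue_record (hh : 0 < h) (hω : IsGood ω) (hf : IsWalkPath h ω f) (t : ℝ≥0) :
    ⨆ N, runValue (fun d : ℕ => d == 0) recordStep (fun _ _ => 1) N 0 t ω =
      if evalAt f (rightInverse (newMaxTime f) t) ≠ ⊤ then 1 else 0 := by
  have hG : ∀ n s, arrival ω n ≤ s → s < arrival ω (n + 1) → (s ∈ {s | AtNewMax f s} ↔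
      (fun d : ℕ => d == 0) (runState recordStep 0 ω n) = true) := by
    intro n s h1 h2
    rw [mem_ofPred_eq, atNewMax_iff hh hω hf h1 h2, record_iff, beq_iff_eq]
  rw [newMaxTime_eq]
  by_cases hn : ∀ n, clockTime (fun d : ℕ => d == 0) recordStep 0 ω n ≤ t
  · rw [iSup_runValue_eq_zero hn, rightInverse_occupation_of_not hω hG hn, evalAt_top]
    simp
  · push Not at hn
    obtain ⟨N, hN⟩ := hn
    obtain ⟨n, -, h1, h2⟩ := exists_clockTime_mem hN
    obtain ⟨-, h4, -⟩ := rightInverse_occupation_of_mem hω hG h1 h2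
    rw [iSup_runValue_eq_of_mem h1 h2, h4, evalAt_coe, if_pos (EReal.coe_ne_top _)]

/-- At the inverse of the time spent at the minimum the height is `0`, so minus the path is `h`
times the depth. -/
lemma iSup_runValue_reflect (hh : 0 < h) (hω : IsGood ω) (hf : IsWalkPath h ω f) (β : ℝ)
    (t : ℝ≥0) :
    ⨆ N, runValue (fun x : ℕ × ℕ => x.1 == 0) reflectStep
        (fun x _ => ENNReal.ofReal (Real.exp (-(β * h))) ^ x.2) N (0, 0) t ω =
      ENNReal.ofReal (if evalAt (fun s => -f s) (rightInverse (minTime f) t) = ⊤ then 0 else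
        Real.exp (-(β * (evalAt (fun s => -f s) (rightInverse (minTime f) t)).toReal))) := by
  have hG : ∀ n s, arrival ω n ≤ s → s < arrival ω (n + 1) → (s ∈ {s | ∀ r ≤ s, f s ≤ f r} ↔
      (fun x : ℕ × ℕ => x.1 == 0) (runState reflectStep (0, 0) ω n) = true) := by
    intro n s h1 h2
    rw [mem_ofPred_eq, atMin_iff hh hω hf h1 h2, minimum_iff, beq_iff_eq]
  rw [minTime_eq]
  by_cases hn : ∀ n, clockTime (fun x : ℕ × ℕ => x.1 == 0) reflectStep (0, 0) ω n ≤ t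
  · rw [iSup_runValue_eq_zero hn, rightInverse_occupation_of_not hω hG hn, evalAt_top]
    simp
  · push Not at hn
    obtain ⟨N, hN⟩ := hn
    obtain ⟨n, -, h1, h2⟩ := exists_clockTime_mem hN
    obtain ⟨h3, h4, h5⟩ := rightInverse_occupation_of_mem hω hG h1 h2
    rw [iSup_runValue_eq_of_mem h1 h2, h4, evalAt_coe, if_neg (EReal.coe_ne_top _),
      EReal.toReal_coe, hf n _ le_self_add h5, walk_eq_reflect,
      show (runState reflectStep (0, 0) ω n).1 = 0 from beq_iff_eq.1 h3,
      ← ENNReal.ofReal_pow (Real.exp_nonneg _), ← Real.exp_nat_mul]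
    congr 2
    push_cast
    ring

end ladder

/-! ### The path of a sequence of holding times and steps -/

/-- The number of jumps up to time `t`. -/
noncomputable def jumpCount (t : ℝ≥0) (ω : ℕ → ℝ≥0 × ℕ) : ℕ :=
  sInf {n | t < arrival ω (n + 1)}

open Classical in
/-- The path with jump times `arrival ω` and values `h * walk ω`. -/
noncomputable def walkPath (h : ℝ) (t : ℝ≥0) (ω : ℕ → ℝ≥0 × ℕ) : ℝ :=
  if IsGood ω then h * walk ω (jumpCount t ω) else 0

section walkPath

variable {ω : ℕ → ℝ≥0 × ℕ} {h : ℝ}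

lemma IsGood.jumpCount_eq (hω : IsGood ω) {t : ℝ≥0} {n : ℕ} (h1 : arrival ω n ≤ t)
    (h2 : t < arrival ω (n + 1)) : jumpCount t ω = n := by
  refine le_antisymm (Nat.sInf_le h2) ?_
  by_contra hlt
  have hmem : jumpCount t ω ∈ {n | t < arrival ω (n + 1)} := Nat.sInf_mem ⟨n, h2⟩
  have h3 : arrival ω (jumpCount t ω + 1) ≤ arrival ω n := hω.strictMono.monotone (by omega)
  exact absurd (h3.trans h1) (not_le.2 hmem)

lemma IsGood.arrival_jumpCount_le (hω : IsGood ω) (t : ℝ≥0) : arrival ω (jumpCount t ω) ≤ t := by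
  obtain ⟨n, h1, h2⟩ := hω.exists_mem t
  rwa [hω.jumpCount_eq h1 h2]

lemma IsGood.lt_arrival_jumpCount (hω : IsGood ω) (t : ℝ≥0) :
    t < arrival ω (jumpCount t ω + 1) := by
  obtain ⟨n, h1, h2⟩ := hω.exists_mem t
  rwa [hω.jumpCount_eq h1 h2]

lemma IsGood.walkPath_eq (hω : IsGood ω) (t : ℝ≥0) :
    walkPath h t ω = h * walk ω (jumpCount t ω) := if_pos hω

lemma IsGood.isWalkPath (hω : IsGood ω) : IsWalkPath h ω (fun t => walkPath h t ω) :=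
  fun n t h1 h2 => (hω.walkPath_eq t).trans (by rw [hω.jumpCount_eq h1 h2])

lemma walkPath_mem_lattice (t : ℝ≥0) (ω : ℕ → ℝ≥0 × ℕ) : walkPath h t ω ∈ lattice h := by
  unfold walkPath
  split_ifs
  · exact ⟨_, rfl⟩
  · exact ⟨0, by simp⟩

lemma walkPath_zero (ω : ℕ → ℝ≥0 × ℕ) : walkPath h 0 ω = 0 := by
  by_cases hω : IsGood ω
  · refine (hω.isWalkPath (h := h) 0 0 le_rfl ?_).trans (by simp [walk, runState])
    rw [arrival_succ, arrival_zero, zero_add]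
    exact hω.pos 0
  · exact if_neg hω

lemma isCadlag_walkPath (h : ℝ) (ω : ℕ → ℝ≥0 × ℕ) : IsCadlag fun t => walkPath h t ω := by
  by_cases hω : IsGood ω
  swap
  · simp only [walkPath, hω, if_false]
    exact fun t => ⟨continuousWithinAt_const, 0, tendsto_const_nhds⟩
  intro t
  obtain ⟨n, h1, h2⟩ := hω.exists_mem t
  constructor
  · have hev : (fun t => walkPath h t ω) =ᶠ[𝓝[≥] t] fun _ => h * walk ω n := by
      filter_upwards [Ico_mem_nhdsGE h2] with s hs
      exact hω.isWalkPath n s (h1.trans hs.1) hs.2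
    exact continuousWithinAt_const.congr_of_eventuallyEq hev (hω.isWalkPath n t h1 h2)
  · rcases eq_or_ne t 0 with rfl | ht
    · refine ⟨0, ?_⟩
      have : (𝓝[<] (0 : ℝ≥0)) = ⊥ := by
        have : Iio (0 : ℝ≥0) = ∅ := by ext x; simp
        rw [this, nhdsWithin_empty]
      rw [this]
      exact tendsto_bot
    · obtain ⟨m, hm1, hm2⟩ : ∃ m, arrival ω m < t ∧ t ≤ arrival ω (m + 1) := by
        rcases h1.lt_or_eq with h1 | h1
        · exact ⟨n, h1, h2.le⟩
        · cases n with
          | zero => exact absurd h1.symm ht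
          | succ n => exact ⟨n, h1 ▸ hω.strictMono (Nat.lt_succ_self n), h1.ge⟩
      refine ⟨h * walk ω m, tendsto_const_nhds.congr' ?_⟩
      filter_upwards [Ioo_mem_nhdsLT hm1] with s hs
      exact (hω.isWalkPath m s hs.1.le (hs.2.trans_le hm2)).symm

@[fun_prop] lemma measurable_arrival (n : ℕ) : Measurable fun ω => arrival ω n := by
  unfold arrival
  fun_prop

lemma measurable_walk (n : ℕ) : Measurable fun ω => walk ω n := by
  induction n with
  | zero => exact measurable_const
  | succ n ih =>
    simp only [walk_succ]
    have : Measurable fun ω : ℕ → ℝ≥0 × ℕ => (((ω n).2 : ℕ) : ℤ) :=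
      (measurable_of_countable fun k : ℕ => (k : ℤ)).comp (by fun_prop)
    exact (ih.add measurable_const).sub this

lemma isGood_iff : IsGood ω ↔ (∀ n, 0 < (ω n).1) ∧ (∀ n, (ω n).2 ≠ 1) ∧
    ∀ m : ℕ, ∃ n, (m : ℝ≥0) < arrival ω n := by
  refine ⟨fun h => ⟨h.pos, h.ne_one, fun m => h.unbounded m⟩, fun ⟨h1, h2, h3⟩ => ⟨h1, h2, ?_⟩⟩
  intro t
  obtain ⟨m, hm⟩ := exists_nat_gt t
  obtain ⟨n, hn⟩ := h3 m
  exact ⟨n, hm.trans hn⟩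

lemma measurableSet_isGood : MeasurableSet {ω : ℕ → ℝ≥0 × ℕ | IsGood ω} := by
  simp_rw [isGood_iff, ofPred_and, ofPred_forall, ofPred_exists]
  refine .inter (.iInter fun n => ?_) (.inter (.iInter fun n => ?_) (.iInter fun m => .iUnion fun n => ?_))
  · exact measurableSet_lt measurable_const (by fun_prop)
  · exact (measurableSet_singleton 1).compl.preimage (by fun_prop)
  · exact measurableSet_lt measurable_const (by fun_prop)

lemma measurable_jumpCount :
    Measurable fun x : ℝ≥0 × (ℕ → ℝ≥0 × ℕ) => jumpCount x.1 x.2 := by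
  refine measurable_to_countable' fun n => ?_
  have hm : ∀ n, MeasurableSet {x : ℝ≥0 × (ℕ → ℝ≥0 × ℕ) | x.1 < arrival x.2 (n + 1)} := fun n =>
    measurableSet_lt (by fun_prop) (by fun_prop)
  -- The second alternative accounts for `sInf ∅ = 0` on exploding sequences.
  have : (fun x : ℝ≥0 × (ℕ → ℝ≥0 × ℕ) => jumpCount x.1 x.2) ⁻¹' {n} =
      {x | (x.1 < arrival x.2 (n + 1) ∧ ∀ m, m < n → ¬ x.1 < arrival x.2 (m + 1)) ∨
        (n = 0 ∧ ∀ m, ¬ x.1 < arrival x.2 (m + 1))} := by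
    ext ⟨t, ω⟩
    simp only [mem_preimage, mem_singleton_iff, mem_ofPred_eq]
    by_cases hne : ∃ m, t < arrival ω (m + 1)
    · have hmem : jumpCount t ω ∈ {n | t < arrival ω (n + 1)} := Nat.sInf_mem hne
      constructor
      · rintro rfl
        exact Or.inl ⟨hmem, fun m hm => Nat.notMem_of_lt_sInf hm⟩
      · rintro (⟨h1, h2⟩ | ⟨-, h2⟩)
        · refine le_antisymm (Nat.sInf_le h1) (not_lt.1 fun hlt => h2 _ hlt hmem)
        · exact absurd hne (by push Not; simpa using h2)
    · push Not at hne
      have hempty : {n | t < arrival ω (n + 1)} = ∅ := by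
        ext m
        simpa using hne m
      have h0 : jumpCount t ω = 0 := by rw [jumpCount, hempty, Nat.sInf_empty]
      rw [h0]
      constructor
      · rintro rfl
        exact Or.inr ⟨rfl, fun m => not_lt.2 (hne m)⟩
      · rintro (⟨h1, -⟩ | ⟨h1, -⟩)
        · exact absurd h1 (not_lt.2 (hne n))
        · exact h1.symm
  rw [this]
  simp_rw [ofPred_or, ofPred_and, ofPred_forall]
  refine .union (.inter (hm n) (.iInter fun m => .iInter fun _ => (hm m).compl))
    (.inter (.const _) (.iInter fun m => (hm m).compl))

lemma measurable_walkPath_prod :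
    Measurable fun x : ℝ≥0 × (ℕ → ℝ≥0 × ℕ) => walkPath h x.1 x.2 := by
  unfold walkPath
  refine Measurable.ite (measurableSet_isGood.preimage measurable_snd) ?_ measurable_const
  have h1 : Measurable fun y : ℕ × (ℕ → ℝ≥0 × ℕ) => h * (walk y.2 y.1 : ℝ) := by
    refine measurable_from_prod_countable_right fun n => ?_
    exact ((measurable_of_countable fun k : ℤ => (k : ℝ)).comp (measurable_walk n)).const_mul h
  exact h1.comp (measurable_jumpCount.prodMk measurable_snd)

lemma measurable_walkPath (t : ℝ≥0) : Measurable (walkPath h t) :=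
  measurable_walkPath_prod.comp measurable_prodMk_left

end walkPath

/-! ### Almost sure regularity of the random sequence. -/

section ae

variable {lam : ℝ} {p : ℕ → ℝ≥0∞} [hl : Fact (0 < lam)] [hp : Fact (∑' k, p k = 1)]

lemma measurePreserving_apply (n : ℕ) : MeasurePreserving (fun ω : ℕ → ℝ≥0 × ℕ => ω n)
    (seqLaw lam p) ((expLaw lam).prod (stepLaw p)) :=
  measurePreserving_eval_infinitePi (fun _ : ℕ => (expLaw lam).prod (stepLaw p)) n

lemma ae_pos (n : ℕ) : ∀ᵐ ω ∂seqLaw lam p, 0 < (ω n).1 := by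
  have h1 : (expLaw lam).prod (stepLaw p) ({0} ×ˢ univ) = 0 := by
    rw [Measure.prod_prod, expLaw_zero, zero_mul]
  have h2 := (measurePreserving_apply (lam := lam) (p := p) n).measure_preimage
    ((measurableSet_singleton 0).prod MeasurableSet.univ).nullMeasurableSet
  rw [h1] at h2
  rw [ae_iff]
  refine measure_mono_null (fun ω hω => ?_) h2
  simpa using hω

lemma ae_ne_one (hp1 : p 1 = 0) (n : ℕ) : ∀ᵐ ω ∂seqLaw lam p, (ω n).2 ≠ 1 := by
  have h0 : stepLaw p {1} = 0 := by
    rw [← lintegral_indicator_one (measurableSet_singleton 1), lintegral_stepLaw,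
      ENNReal.tsum_eq_zero]
    intro k
    by_cases hk : k = 1
    · simp [hk, hp1]
    · simp [hk]
  have h1 : (expLaw lam).prod (stepLaw p) (univ ×ˢ {1}) = 0 := by
    rw [Measure.prod_prod, h0, mul_zero]
  have h2 := (measurePreserving_apply (lam := lam) (p := p) n).measure_preimage
    (MeasurableSet.univ.prod (measurableSet_singleton 1)).nullMeasurableSet
  rw [h1] at h2
  rw [ae_iff]
  refine measure_mono_null (fun ω hω => ?_) h2
  simpa using hω

lemma arrival_consSeq (a : ℝ≥0 × ℕ) (ω : ℕ → ℝ≥0 × ℕ) (n : ℕ) :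
    arrival (consSeq a ω) (n + 1) = a.1 + arrival ω n := by
  rw [arrival, Finset.sum_range_succ', add_comm]
  rfl

/-- The Laplace transform at `1` of the `n`-th jump time; its geometric decay in `n` excludes an
accumulation of jumps. -/
lemma lintegral_exp_neg_arrival (n : ℕ) :
    ∫⁻ ω, ENNReal.ofReal (Real.exp (-(arrival ω n : ℝ))) ∂seqLaw lam p =
      ENNReal.ofReal (lam / (lam + 1)) ^ n := by
  have hl0 : 0 < lam := hl.out
  induction n with
  | zero => simp
  | succ n ih =>
    rw [lintegral_seqLaw (by fun_prop)]
    have h1 : ∀ (e : ℝ≥0) (k : ℕ), ∫⁻ ω, ENNReal.ofReal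
        (Real.exp (-(arrival (consSeq (e, k) ω) (n + 1) : ℝ))) ∂seqLaw lam p =
        ENNReal.ofReal (Real.exp (-(e : ℝ))) * ENNReal.ofReal (lam / (lam + 1)) ^ n := by
      intro e k
      rw [← ih, ← lintegral_const_mul _ (by fun_prop)]
      congr with ω
      rw [arrival_consSeq, ← ENNReal.ofReal_mul (Real.exp_nonneg _), ← Real.exp_add]
      push_cast
      ring_nf
    simp_rw [h1, ENNReal.tsum_mul_right, hp.out, one_mul]
    rw [lintegral_mul_const _ (by fun_prop), pow_succ']
    congr 1
    rw [lintegral_expLaw (by fun_prop)]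
    have h2 : ∀ x ∈ Ioi (0 : ℝ), ENNReal.ofReal (lam * Real.exp (-(lam * x))) *
        ENNReal.ofReal (Real.exp (-(x.toNNReal : ℝ))) = ENNReal.ofReal (lam / (lam + 1)) *
          ENNReal.ofReal ((lam + 1) * Real.exp (-((lam + 1) * x))) := by
      intro x hx
      rw [Real.coe_toNNReal x (le_of_lt hx), ← ENNReal.ofReal_mul (by positivity),
        ← ENNReal.ofReal_mul (by positivity), mul_assoc, ← Real.exp_add]
      congr 1
      rw [← mul_assoc, div_mul_cancel₀ _ (by positivity)]
      ring_nf
    rw [setLIntegral_congr_fun measurableSet_Ioi h2, lintegral_const_mul _ (by fun_prop),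
      lintegral_expDensity_Ioi (by positivity)]
    simp

lemma ae_exists_lt_arrival (m : ℕ) : ∀ᵐ ω ∂seqLaw lam p, ∃ n, (m : ℝ≥0) < arrival ω n := by
  have hl0 : 0 < lam := hl.out
  rw [ae_iff]
  set A := {ω : ℕ → ℝ≥0 × ℕ | ¬ ∃ n, (m : ℝ≥0) < arrival ω n} with hA
  have hAm : MeasurableSet A := by
    rw [hA, ← compl_ofPred, ofPred_exists]
    exact (MeasurableSet.iUnion fun n => measurableSet_lt measurable_const (measurable_arrival n)).compl
  have h1 : ∀ n, ENNReal.ofReal (Real.exp (-(m : ℝ))) * seqLaw lam p A ≤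
      ENNReal.ofReal (lam / (lam + 1)) ^ n := by
    intro n
    rw [← lintegral_exp_neg_arrival (lam := lam) (p := p) n, ← setLIntegral_const]
    refine le_trans ?_ (setLIntegral_le_lintegral A _)
    refine setLIntegral_mono' hAm fun ω hω => ?_
    rw [hA, mem_ofPred_eq] at hω
    push Not at hω
    gcongr
    exact_mod_cast hω n
  have h2 : Tendsto (fun n : ℕ => ENNReal.ofReal (lam / (lam + 1)) ^ n) atTop (𝓝 0) := by
    refine ENNReal.tendsto_pow_atTop_nhds_zero_of_lt_one ?_
    rw [ENNReal.ofReal_lt_one, div_lt_one (by positivity)]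
    linarith
  have h3 : ENNReal.ofReal (Real.exp (-(m : ℝ))) * seqLaw lam p A = 0 :=
    le_antisymm (ge_of_tendsto' h2 h1) zero_le
  rcases mul_eq_zero.1 h3 with h4 | h4
  · exact absurd h4 (by simp [Real.exp_pos])
  · exact h4

lemma ae_isGood (hp1 : p 1 = 0) : ∀ᵐ ω ∂seqLaw lam p, IsGood ω := by
  filter_upwards [ae_all_iff.2 (ae_pos (lam := lam) (p := p)), ae_all_iff.2 (ae_ne_one hp1),
    ae_all_iff.2 (ae_exists_lt_arrival (lam := lam) (p := p))] with ω h1 h2 h3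
  exact isGood_iff.2 ⟨h1, h2, h3⟩

/-! ### Ladder processes of the walk path -/

lemma iSup_lintegral_record (t : ℝ≥0) :
    ⨆ N, ∫⁻ ω, runValue (fun d : ℕ => d == 0) recordStep (fun _ _ => 1) N 0 t ω ∂seqLaw lam p =
      ENNReal.ofReal (Real.exp (-(lam *
        (1 - (returnWeight p (fun _ _ => 1) fun d k => d - 1 + k).toReal) * t))) := by
  have hH : ∀ σ : ℕ, Measurable ((fun _ _ => 1 : ℕ → (ℕ → ℝ≥0 × ℕ) → ℝ≥0∞) σ) :=
    fun _ => measurable_const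
  refine iSup_excursion_eq_exp hp.out.le (fun _ _ => le_rfl)
    (w := fun N d t => ∫⁻ ω, runValue (fun d : ℕ => d == 0) recordStep (fun _ _ => 1) N d t ω
      ∂seqLaw lam p) (fun N d => measurable_lintegral_runValue hH N d) ?_ ?_ ?_ t
  · intro d t; simp [runValue]
  · intro N t
    rw [lintegral_runValue_of_clock hH N (by simp)]
    simp [recordStep]
  · intro N d hd t
    rw [lintegral_runValue_of_not_clock hH N (by simpa using hd)]
    simp

/-- The initial depth never influences the motion and enters the value only as a factor. The
two-coordinate chain thereby reduces to the height chain with weights `downWeight`. -/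
lemma runValue_reflect_scale (c : ℝ≥0∞) (N : ℕ) : ∀ (d i : ℕ) (t : ℝ≥0) (ω : ℕ → ℝ≥0 × ℕ),
    runValue (fun x : ℕ × ℕ => x.1 == 0) reflectStep (fun x _ => c ^ x.2) N (d, i) t ω =
      c ^ i * runValue (fun x : ℕ × ℕ => x.1 == 0) reflectStep (fun x _ => c ^ x.2) N (d, 0) t ω := by
  induction N with
  | zero => intros; simp [runValue]
  | succ N ih =>
    intro d i t ω
    simp only [runValue, reflectStep]
    rw [ih (d + 1 - (ω 0).2) (i + _), ih (d + 1 - (ω 0).2) (i + _) t,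
      ih (d + 1 - (ω 0).2) (0 + _), ih (d + 1 - (ω 0).2) (0 + _) t]
    simp only [zero_add, pow_add, pow_zero]
    split_ifs <;> ring

lemma iSup_lintegral_reflect {s : ℝ} (hs1 : s ≤ 1) (t : ℝ≥0) :
    ⨆ N, ∫⁻ ω, runValue (fun x : ℕ × ℕ => x.1 == 0) reflectStep
        (fun x _ => ENNReal.ofReal s ^ x.2) N (0, 0) t ω ∂seqLaw lam p =
      ENNReal.ofReal (Real.exp (-(lam *
        (1 - (returnWeight p (downWeight s) fun d k => d + 1 - k).toReal) * t))) := by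
  set c := ENNReal.ofReal s
  have hH : ∀ σ : ℕ × ℕ, Measurable
      ((fun x _ => c ^ x.2 : ℕ × ℕ → (ℕ → ℝ≥0 × ℕ) → ℝ≥0∞) σ) := fun _ => measurable_const
  have hscale : ∀ N d k t, ∫⁻ ω, runValue (fun x : ℕ × ℕ => x.1 == 0) reflectStep
      (fun x _ => c ^ x.2) N (reflectStep (d, 0) k) t ω ∂seqLaw lam p = downWeight s d k *
      ∫⁻ ω, runValue (fun x : ℕ × ℕ => x.1 == 0) reflectStep
        (fun x _ => c ^ x.2) N (d + 1 - k, 0) t ω ∂seqLaw lam p := by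
    intro N d k t
    rw [← lintegral_const_mul _ (measurable_runValue_right hH N _ t)]
    congr with ω
    rw [reflectStep, runValue_reflect_scale, zero_add, downWeight]
  refine iSup_excursion_eq_exp hp.out.le (downWeight_le_one hs1)
    (w := fun N d t => ∫⁻ ω, runValue (fun x : ℕ × ℕ => x.1 == 0) reflectStep
        (fun x _ => c ^ x.2) N (d, 0) t ω ∂seqLaw lam p)
    (fun N d => measurable_lintegral_runValue hH N _) ?_ ?_ ?_ t
  · intro d t; simp [runValue]
  · intro N t
    rw [lintegral_runValue_of_clock hH N (by simp)]
    simp_rw [hscale]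
    simp
  · intro N d hd t
    rw [lintegral_runValue_of_not_clock hH N (by simpa using hd)]
    simp_rw [hscale]

lemma lintegral_strictAsc_walkPath {h : ℝ} (hh : 0 < h) (hp1 : p 1 = 0) (t : ℝ≥0) :
    ∫⁻ ω, (if strictAscLadderHeight (walkPath h) t ω ≠ ⊤ then 1 else 0) ∂seqLaw lam p =
      ENNReal.ofReal (Real.exp (-(lam *
        (1 - (returnWeight p (fun _ _ => 1) fun d k => d - 1 + k).toReal) * t))) := by
  rw [← iSup_lintegral_record, ← lintegral_iSup_runValue (fun _ => measurable_const)]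
  refine lintegral_congr_ae ?_
  filter_upwards [ae_isGood hp1] with ω hω
  rw [iSup_runValue_record hh hω (hω.isWalkPath (h := h)) t]
  rfl

lemma lintegral_desc_walkPath {h x : ℝ} (hh : 0 < h) (hx : 0 < x) (hp1 : p 1 = 0) {β : ℝ}
    (hβ : 0 ≤ β) (t : ℝ≥0) :
    ∫⁻ ω, ENNReal.ofReal (if evalAt (fun s => -walkPath h s ω) (rightInverse
          (fun s => ENNReal.ofReal x * minTime (fun s => walkPath h s ω) s) t) = ⊤ then 0 else
        Real.exp (-(β * (evalAt (fun s => -walkPath h s ω) (rightInverse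
          (fun s => ENNReal.ofReal x * minTime (fun s => walkPath h s ω) s) t)).toReal)))
        ∂seqLaw lam p =
      ENNReal.ofReal (Real.exp (-(lam * (1 - (returnWeight p
        (downWeight (Real.exp (-(β * h)))) fun d k => d + 1 - k).toReal) * (t * x⁻¹)))) := by
  have hs1 : Real.exp (-(β * h)) ≤ 1 := by
    rw [Real.exp_le_one_iff]
    have := mul_nonneg hβ hh.le
    linarith
  have h1 : ((t * x⁻¹.toNNReal : ℝ≥0) : ℝ) = t * x⁻¹ := by
    rw [NNReal.coe_mul, Real.coe_toNNReal _ (by positivity)]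
  rw [← h1, ← iSup_lintegral_reflect hs1, ← lintegral_iSup_runValue (fun _ => measurable_const)]
  refine lintegral_congr_ae ?_
  filter_upwards [ae_isGood hp1] with ω hω
  rw [iSup_runValue_reflect hh hω (hω.isWalkPath (h := h)) β]
  simp_rw [rightInverse_const_mul hx]

end ae

/-! ### The Markov property and the Lévy property of the walk path -/

/-- The sequence of holding times and steps seen from time `t`. -/
noncomputable def shiftPast (t : ℝ≥0) (ω : ℕ → ℝ≥0 × ℕ) : ℕ → ℝ≥0 × ℕ :=
  consSeq ((ω (jumpCount t ω)).1 - (t - arrival ω (jumpCount t ω)), (ω (jumpCount t ω)).2)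
    (dropSeq (jumpCount t ω + 1) ω)

section markov

variable {ω : ℕ → ℝ≥0 × ℕ} {h : ℝ}

lemma arrival_dropSeq (ω : ℕ → ℝ≥0 × ℕ) (n m : ℕ) :
    arrival ω (n + m) = arrival ω n + arrival (dropSeq n ω) m :=
  Finset.sum_range_add _ _ _

lemma IsGood.arrival_shiftPast (hω : IsGood ω) (t : ℝ≥0) (m : ℕ) :
    t + arrival (shiftPast t ω) (m + 1) = arrival ω (jumpCount t ω + 1 + m) := by
  have h1 := hω.arrival_jumpCount_le t
  have h2 := hω.lt_arrival_jumpCount t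
  rw [arrival_succ] at h2
  rw [shiftPast, arrival_consSeq, arrival_dropSeq, arrival_succ, ← add_assoc]
  congr 1
  have h3 : t - arrival ω (jumpCount t ω) ≤ (ω (jumpCount t ω)).1 :=
    (tsub_lt_iff_left h1).2 h2 |>.le
  ext
  push_cast [h1, h3]
  ring

lemma walk_shiftPast (t : ℝ≥0) (ω : ℕ → ℝ≥0 × ℕ) (m : ℕ) :
    walk ω (jumpCount t ω + m) = walk ω (jumpCount t ω) + walk (shiftPast t ω) m := by
  induction m with
  | zero => simp [walk, runState]
  | succ m ih =>
    rw [← add_assoc, walk_succ, walk_succ, ih]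
    have : (shiftPast t ω m).2 = (ω (jumpCount t ω + m)).2 := by
      cases m with
      | zero => rfl
      | succ m => simp [shiftPast, dropSeq, add_assoc, add_comm 1 m]
    rw [this]
    ring

lemma IsGood.shiftPast (hω : IsGood ω) (t : ℝ≥0) : IsGood (shiftPast t ω) := by
  have h1 := hω.arrival_jumpCount_le t
  have h2 := hω.lt_arrival_jumpCount t
  rw [arrival_succ] at h2
  refine ⟨fun n => ?_, fun n => ?_, fun s => ?_⟩
  · cases n with
    | zero => exact tsub_pos_of_lt ((tsub_lt_iff_left h1).2 h2)
    | succ n => exact hω.pos _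
  · cases n with
    | zero => exact hω.ne_one _
    | succ n => exact hω.ne_one _
  · obtain ⟨N, hN⟩ := hω.unbounded (t + s)
    refine ⟨N + 1, ?_⟩
    have h3 := hω.arrival_shiftPast t N
    have h4 : arrival ω N ≤ arrival ω (jumpCount t ω + 1 + N) :=
      hω.strictMono.monotone (by omega)
    rw [← h3] at h4
    exact lt_of_add_lt_add_left (hN.trans_le h4)

lemma IsGood.walkPath_add (hω : IsGood ω) (t s : ℝ≥0) :
    walkPath h (t + s) ω = walkPath h t ω + walkPath h s (SkipFree.shiftPast t ω) := by
  have hω' := hω.shiftPast t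
  rw [hω.walkPath_eq, hω.walkPath_eq, hω'.walkPath_eq]
  set m := jumpCount s (SkipFree.shiftPast t ω)
  have h1 : jumpCount (t + s) ω = jumpCount t ω + m := by
    refine hω.jumpCount_eq ?_ ?_
    · have h3 := hω'.arrival_jumpCount_le s
      rcases Nat.eq_zero_or_eq_succ_pred m with hm | hm
      · rw [hm, add_zero]
        exact (hω.arrival_jumpCount_le t).trans le_self_add
      · have h4 := hω.arrival_shiftPast t m.pred
        rw [← Nat.succ_eq_add_one, ← hm] at h4
        rw [show jumpCount t ω + m = jumpCount t ω + 1 + m.pred by omega, ← h4]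
        gcongr
    · have h3 := hω'.lt_arrival_jumpCount s
      rw [show jumpCount t ω + m + 1 = jumpCount t ω + 1 + m by omega, ← hω.arrival_shiftPast t m]
      gcongr
  rw [h1, walk_shiftPast]
  push_cast
  ring

variable {lam : ℝ} {p : ℕ → ℝ≥0∞} [hl : Fact (0 < lam)] [hp : Fact (∑' k, p k = 1)]

lemma clockTime_true (ω : ℕ → ℝ≥0 × ℕ) (n : ℕ) :
    clockTime (fun _ : ℤ => true) (fun (y : ℤ) (k : ℕ) => y + 1 - k) 0 ω n = arrival ω n := by
  simp [clockTime, arrival]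

lemma IsGood.iSup_runValue_walk (hω : IsGood ω) (H : ℤ → (ℕ → ℝ≥0 × ℕ) → ℝ≥0∞) (t : ℝ≥0) :
    ⨆ N, runValue (fun _ : ℤ => true) (fun (y : ℤ) (k : ℕ) => y + 1 - k) H N 0 t ω =
      H (walk ω (jumpCount t ω)) (SkipFree.shiftPast t ω) := by
  have h1 := hω.arrival_jumpCount_le t
  have h2 := hω.lt_arrival_jumpCount t
  rw [← clockTime_true] at h1 h2
  rw [iSup_runValue_eq_of_mem h1 h2, clockTime_true]
  rfl

/-- The simple Markov property. -/
lemma lintegral_mul_shiftPast (hp1 : p 1 = 0) {g : ℝ → ℝ≥0∞} {F : (ℕ → ℝ≥0 × ℕ) → ℝ≥0∞}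
    (hF : Measurable F) (t : ℝ≥0) :
    ∫⁻ ω, g (walkPath h t ω) * F (shiftPast t ω) ∂seqLaw lam p =
      (∫⁻ ω, g (walkPath h t ω) ∂seqLaw lam p) * ∫⁻ ω, F ω ∂seqLaw lam p := by
  set H : ℤ → (ℕ → ℝ≥0 × ℕ) → ℝ≥0∞ := fun y ω => g (h * y) * F ω with hH
  have hHm : ∀ y, Measurable (H y) := fun y => hF.const_mul _
  have e1 : ∫⁻ ω, g (walkPath h t ω) * F (shiftPast t ω) ∂seqLaw lam p =
      ∫⁻ ω, ⨆ N, runValue (fun _ : ℤ => true) (fun (y : ℤ) (k : ℕ) => y + 1 - k) H N 0 t ω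
        ∂seqLaw lam p := by
    refine lintegral_congr_ae ?_
    filter_upwards [ae_isGood hp1] with ω hω
    rw [hω.iSup_runValue_walk, hω.walkPath_eq]
  have hmean : ∀ y : ℤ, ∫⁻ ω, H y ω ∂seqLaw lam p = g (h * y) * ∫⁻ ω, F ω ∂seqLaw lam p :=
    fun y => lintegral_const_mul _ hF
  have hgm : ∀ y : ℤ, Measurable fun _ : ℕ → ℝ≥0 × ℕ => ∫⁻ ω, H y ω ∂seqLaw lam p :=
    fun y => measurable_const
  rw [e1, lintegral_iSup_runValue hHm]
  simp_rw [lintegral_runValue_eq_mean hHm]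
  rw [← lintegral_iSup_runValue hgm]
  have e2 : ∫⁻ ω, ⨆ N, runValue (fun _ : ℤ => true) (fun (y : ℤ) (k : ℕ) => y + 1 - k)
      (fun y _ => ∫⁻ ω, H y ω ∂seqLaw lam p) N 0 t ω ∂seqLaw lam p =
      ∫⁻ ω, g (walkPath h t ω) * ∫⁻ ω, F ω ∂seqLaw lam p ∂seqLaw lam p := by
    refine lintegral_congr_ae ?_
    filter_upwards [ae_isGood hp1] with ω hω
    rw [hω.iSup_runValue_walk, hω.walkPath_eq, hmean]
  -- `g` need not be measurable: the walk is integer-valued, so the composition agrees almost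
  -- everywhere with a measurable functional.
  have hgw : Measurable fun ω => ⨆ N, runValue (fun _ : ℤ => true)
      (fun (y : ℤ) (k : ℕ) => y + 1 - k) (fun y _ => g (h * y)) N 0 t ω :=
    .iSup fun N => measurable_runValue_right (fun _ => measurable_const) N 0 t
  have hga : AEMeasurable (fun ω => g (walkPath h t ω)) (seqLaw lam p) := by
    refine ⟨_, hgw, ?_⟩
    filter_upwards [ae_isGood hp1] with ω hω
    rw [hω.iSup_runValue_walk, hω.walkPath_eq]
  rw [e2, lintegral_mul_const'' _ hga]

lemma lintegral_comp_increment (hp1 : p 1 = 0) {g : ℝ → ℝ≥0∞} (hg : Measurable g) (s t : ℝ≥0) :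
    ∫⁻ ω, g (walkPath h (s + t) ω - walkPath h s ω) ∂seqLaw lam p =
      ∫⁻ ω, g (walkPath h t ω) ∂seqLaw lam p := by
  have h1 := lintegral_mul_shiftPast (lam := lam) hp1 (h := h) (g := fun _ => 1)
    (F := fun ω => g (walkPath h t ω)) (hg.comp (measurable_walkPath t)) s
  simp only [one_mul, lintegral_one, measure_univ] at h1
  rw [← h1]
  refine lintegral_congr_ae ?_
  filter_upwards [ae_isGood hp1] with ω hω
  rw [hω.walkPath_add, add_sub_cancel_left]

/-- Induction on the number of increments by two restarts: after the one at `t 0` the first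
increment is the position at `t 1 - t 0`, and after the one at that time the others depend on a
fresh sequence only. -/
lemma lintegral_prod_increments (hp1 : p 1 = 0) (n : ℕ) : ∀ {t : ℕ → ℝ≥0} (_ : Monotone t)
    {g : ℕ → ℝ → ℝ≥0∞} (_ : ∀ i, Measurable (g i)),
    ∫⁻ ω, ∏ i ∈ Finset.range n, g i (walkPath h (t (i + 1)) ω - walkPath h (t i) ω) ∂seqLaw lam p =
      ∏ i ∈ Finset.range n, ∫⁻ ω, g i (walkPath h (t (i + 1) - t i) ω) ∂seqLaw lam p := by
  induction n with
  | zero => intro t _ g _; simp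
  | succ n ih =>
    intro t ht g hg
    have hmeas : ∀ (a b : ℕ → ℝ≥0) (f : ℕ → ℝ → ℝ≥0∞) (_ : ∀ i, Measurable (f i)) (m : ℕ),
        Measurable fun ω =>
          ∏ i ∈ Finset.range m, f i (walkPath h (a i) ω - walkPath h (b i) ω) := by
      intro a b f hf m
      refine Finset.measurable_prod _ fun i _ => (hf i).comp ?_
      exact (measurable_walkPath _).sub (measurable_walkPath _)
    have hsub : ∀ {a b c : ℝ≥0}, a ≤ b → b ≤ c → c - a - (b - a) = c - b := by
      intro a b c hab hbc
      ext
      rw [NNReal.coe_sub (tsub_le_tsub_right hbc a), NNReal.coe_sub (hab.trans hbc),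
        NNReal.coe_sub hab, NNReal.coe_sub hbc]
      ring
    have h0 : ∀ i, t 0 ≤ t i := fun i => ht (Nat.zero_le i)
    -- restart at time `t 0`
    have e1 : ∫⁻ ω, ∏ i ∈ Finset.range (n + 1),
          g i (walkPath h (t (i + 1)) ω - walkPath h (t i) ω) ∂seqLaw lam p =
        ∫⁻ ω, ∏ i ∈ Finset.range (n + 1),
          g i (walkPath h (t (i + 1) - t 0) ω - walkPath h (t i - t 0) ω) ∂seqLaw lam p := by
      have h1 := lintegral_mul_shiftPast (lam := lam) hp1 (h := h) (g := fun _ => 1)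
        (hmeas (fun i => t (i + 1) - t 0) (fun i => t i - t 0) g hg (n + 1)) (t 0)
      simp only [one_mul, lintegral_one, measure_univ] at h1
      rw [← h1]
      refine lintegral_congr_ae ?_
      filter_upwards [ae_isGood hp1] with ω hω
      refine Finset.prod_congr rfl fun i _ => ?_
      rw [← add_tsub_cancel_of_le (h0 (i + 1)), ← add_tsub_cancel_of_le (h0 i), hω.walkPath_add,
        hω.walkPath_add, add_sub_add_left_eq_sub, add_tsub_cancel_left, add_tsub_cancel_left]
    -- split off the first increment
    have e2 := lintegral_mul_shiftPast (lam := lam) hp1 (h := h) (g := g 0)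
      (hmeas (fun i => t (i + 2) - t 1) (fun i => t (i + 1) - t 1) (fun i => g (i + 1))
        (fun i => hg (i + 1)) n) (t 1 - t 0)
    have h1 : ∀ i, t 1 ≤ t (i + 1) := fun i => ht (by omega)
    have e3 := ih (t := fun i => t (i + 1) - t 1)
      (fun a b hab => tsub_le_tsub_right (ht (by omega)) _) (g := fun i => g (i + 1))
      (fun i => hg (i + 1))
    rw [e1, Finset.prod_range_succ']
    have e4 : ∏ i ∈ Finset.range n,
        ∫⁻ ω, g (i + 1) (walkPath h (t (i + 1 + 1) - t 1 - (t (i + 1) - t 1)) ω) ∂seqLaw lam p =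
        ∏ i ∈ Finset.range n,
        ∫⁻ ω, g (i + 1) (walkPath h (t (i + 1 + 1) - t (i + 1)) ω) ∂seqLaw lam p :=
      Finset.prod_congr rfl fun i _ => by rw [hsub (h1 i) (ht (Nat.le_succ _))]
    rw [← e4, ← e3, mul_comm, ← e2]
    refine lintegral_congr_ae ?_
    filter_upwards [ae_isGood hp1] with ω hω
    rw [Finset.prod_range_succ', mul_comm, tsub_self, walkPath_zero, sub_zero, zero_add]
    congr 1
    refine Finset.prod_congr rfl fun i _ => ?_
    have h2 : ∀ j, t (j + 1) - t 0 = (t 1 - t 0) + (t (j + 1) - t 1) := fun j =>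
      (tsub_add_tsub_cancel (h1 j) (h0 1)).symm.trans (add_comm _ _)
    rw [h2 (i + 1), h2 i, hω.walkPath_add, hω.walkPath_add, add_sub_add_left_eq_sub]

lemma hasIndepIncrements_walkPath (hp1 : p 1 = 0) :
    HasIndepIncrements (walkPath h) (seqLaw lam p) := by
  refine .of_nat fun t ht _ => ?_
  rw [iIndepFun_iff_measure_inter_preimage_eq_mul]
  intro s A hA
  obtain ⟨n, hn⟩ := s.exists_nat_subset_range
  classical
  -- Trivial factors outside `s` extend the product to a full range of consecutive increments.
  set g : ℕ → ℝ → ℝ≥0∞ := fun i => if i ∈ s then (A i).indicator 1 else 1 with hg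
  have hgm : ∀ i, Measurable (g i) := by
    intro i
    by_cases hi : i ∈ s
    · simp only [hg, hi, if_true]
      exact measurable_one.indicator (hA i hi)
    · simp only [hg, hi, if_false]
      exact measurable_one
  have hdm : ∀ i, Measurable fun ω => walkPath h (t (i + 1)) ω - walkPath h (t i) ω := fun i =>
    (measurable_walkPath _).sub (measurable_walkPath _)
  have key := lintegral_prod_increments (lam := lam) (h := h) hp1 n ht hgm
  have hR : ∀ i ∈ s, seqLaw lam p
      ((fun ω => walkPath h (t (i + 1)) ω - walkPath h (t i) ω) ⁻¹' A i) =
      ∫⁻ ω, g i (walkPath h (t (i + 1) - t i) ω) ∂seqLaw lam p := by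
    intro i hi
    rw [← lintegral_comp_increment hp1 (hgm i) (t i), add_tsub_cancel_of_le (ht (Nat.le_succ i)),
      ← lintegral_indicator_one (hdm i (hA i hi))]
    simp only [hg, hi, if_true]
    rfl
  rw [Finset.prod_congr rfl hR]
  have hsub : ∏ i ∈ s, ∫⁻ ω, g i (walkPath h (t (i + 1) - t i) ω) ∂seqLaw lam p =
      ∏ i ∈ Finset.range n, ∫⁻ ω, g i (walkPath h (t (i + 1) - t i) ω) ∂seqLaw lam p := by
    refine Finset.prod_subset hn fun i _ hi => ?_
    simp [hg, hi]
  rw [hsub, ← key, ← lintegral_indicator_one (Finset.measurableSet_biInter s fun i hi =>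
    hdm i (hA i hi))]
  congr with ω
  rw [← Finset.prod_subset hn (fun i _ hi => by simp [hg, hi])]
  by_cases hω : ω ∈ ⋂ i ∈ s, (fun ω => walkPath h (t (i + 1)) ω - walkPath h (t i) ω) ⁻¹' A i
  · rw [indicator_of_mem hω]
    refine (Finset.prod_eq_one fun i hi => ?_).symm
    simp only [hg, hi, if_true]
    have hmem : walkPath h (t (i + 1)) ω - walkPath h (t i) ω ∈ A i := mem_iInter₂.1 hω i hi
    rw [indicator_of_mem hmem, Pi.one_apply]
  · rw [indicator_of_notMem hω]
    simp only [mem_iInter, not_forall] at hω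
    obtain ⟨i, hi, hi'⟩ := hω
    refine (Finset.prod_eq_zero hi ?_).symm
    simp only [hg, hi, if_true]
    have hmem : walkPath h (t (i + 1)) ω - walkPath h (t i) ω ∉ A i := hi'
    rw [indicator_of_notMem hmem]

lemma identDistrib_increment_walkPath (hp1 : p 1 = 0) (s t : ℝ≥0) :
    IdentDistrib (fun ω => walkPath h (s + t) ω - walkPath h s ω) (walkPath h t)
      (seqLaw lam p) (seqLaw lam p) := by
  have hm : Measurable fun ω => walkPath h (s + t) ω - walkPath h s ω :=
    (measurable_walkPath _).sub (measurable_walkPath _)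
  refine ⟨hm.aemeasurable, (measurable_walkPath t).aemeasurable, ?_⟩
  refine Measure.ext_of_lintegral _ fun g hg => ?_
  rw [lintegral_map hg hm, lintegral_map hg (measurable_walkPath t), lintegral_comp_increment hp1 hg]

lemma isGood_consSeq_iff {e : ℝ≥0} {k : ℕ} :
    IsGood (consSeq (e, k) ω) ↔ 0 < e ∧ k ≠ 1 ∧ IsGood ω := by
  constructor
  · intro hg
    refine ⟨hg.pos 0, hg.ne_one 0, fun n => hg.pos (n + 1), fun n => hg.ne_one (n + 1), fun t => ?_⟩
    obtain ⟨n, hn⟩ := hg.unbounded (e + t)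
    refine ⟨n, ?_⟩
    have h1 : arrival (consSeq (e, k) ω) n ≤ e + arrival ω n := by
      rw [← arrival_consSeq (e, k) ω n]
      exact hg.strictMono.monotone (Nat.le_succ n)
    exact lt_of_add_lt_add_left (hn.trans_le h1)
  · rintro ⟨h1, h2, h3⟩
    refine ⟨fun n => ?_, fun n => ?_, fun t => ?_⟩
    · cases n with
      | zero => exact h1
      | succ n => exact h3.pos n
    · cases n with
      | zero => exact h2
      | succ n => exact h3.ne_one n
    · obtain ⟨n, hn⟩ := h3.unbounded t
      exact ⟨n + 1, by rw [arrival_consSeq]; exact hn.trans_le le_add_self⟩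

lemma walk_consSeq (e : ℝ≥0) (k n : ℕ) (ω : ℕ → ℝ≥0 × ℕ) :
    walk (consSeq (e, k) ω) (n + 1) = 1 - k + walk ω n := by
  induction n with
  | zero => simp [walk, runState]
  | succ n ih =>
    rw [walk_succ, ih, walk_succ, consSeq_succ]
    ring

lemma walkPath_consSeq_of_lt {e : ℝ≥0} {k : ℕ} (hg : IsGood (consSeq (e, k) ω)) {t : ℝ≥0}
    (ht : t < e) : walkPath h t (consSeq (e, k) ω) = 0 := by
  refine (hg.isWalkPath (h := h) 0 t zero_le ?_).trans (by simp [walk, runState])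
  rwa [arrival_consSeq, arrival_zero, add_zero]

lemma walkPath_consSeq_of_le {e : ℝ≥0} {k : ℕ} (hg : IsGood (consSeq (e, k) ω)) {t : ℝ≥0}
    (ht : e ≤ t) : walkPath h t (consSeq (e, k) ω) = h * (1 - k) + walkPath h (t - e) ω := by
  have hω := (isGood_consSeq_iff.1 hg).2.2
  obtain ⟨n, h1, h2⟩ := hω.exists_mem (t - e)
  have e1 := hg.isWalkPath (h := h) (n + 1) t
    (by rw [arrival_consSeq]; exact (le_tsub_iff_left ht).1 h1)
    (by rw [arrival_consSeq]; exact (tsub_lt_iff_left ht).1 h2)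
  have e2 := hω.isWalkPath (h := h) n (t - e) h1 h2
  simp only at e1 e2
  rw [e1, e2, walk_consSeq]
  push_cast
  ring

/-- The Lévy measure of the walk path. -/
noncomputable def walkMeasure (h lam : ℝ) (p : ℕ → ℝ≥0∞) : Measure ℝ :=
  ENNReal.ofReal lam • (stepLaw p).map fun k : ℕ => h * (1 - (k : ℝ))

instance : IsFiniteMeasure (walkMeasure h lam p) := by
  unfold walkMeasure
  have := Measure.isProbabilityMeasure_map (μ := stepLaw p)
    (f := fun k : ℕ => h * (1 - (k : ℝ))) (measurable_of_countable _).aemeasurable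
  exact Measure.smul_finite _ ENNReal.ofReal_ne_top

/-- Conditioning on the first jump shows that the characteristic function solves the renewal
equation, with κ equal to the characteristic function `M` of one step. -/
lemma charFun_walkPath (hp1 : p 1 = 0) (t : ℝ≥0) (q : ℝ) :
    charFun ((seqLaw lam p).map (walkPath h t)) q = Complex.exp ((t : ℂ) *
      ∫ x : ℝ, (Complex.exp (Complex.I * q * x) - 1) ∂walkMeasure h lam p) := by
  have hl0 : 0 < lam := hl.out
  set E : ℝ → ℂ := fun x => Complex.exp (Complex.I * q * x) with hE
  have hEc : Continuous E := by fun_prop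
  have hE1 : ∀ x, ‖E x‖ = 1 := fun x => by
    rw [show E x = Complex.exp (Complex.I * q * x) from rfl,
      show Complex.I * q * x = ((q * x : ℝ) : ℂ) * Complex.I by push_cast; ring]
    exact Complex.norm_exp_ofReal_mul_I _
  have hEadd : ∀ x y, E (x + y) = E x * E y := fun x y => by
    simp only [hE]
    rw [← Complex.exp_add]
    push_cast
    ring_nf
  have hEi : ∀ {α : Type} [MeasurableSpace α] (μ : Measure α) [IsFiniteMeasure μ] (f : α → ℝ),
      Measurable f → Integrable (fun a => E (f a)) μ := fun μ _ f hf =>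
    Integrable.of_bound (hEc.measurable.comp hf).aestronglyMeasurable 1
      (ae_of_all _ fun a => (hE1 _).le)
  set u : ℝ≥0 → ℂ := fun t => ∫ ω, E (walkPath h t ω) ∂seqLaw lam p with hu
  set M : ℂ := ∫ k, E (h * (1 - (k : ℝ))) ∂stepLaw p with hM
  have hum : Measurable u := by
    have : StronglyMeasurable fun x : ℝ≥0 × (ℕ → ℝ≥0 × ℕ) => E (walkPath h x.1 x.2) :=
      (hEc.measurable.comp measurable_walkPath_prod).stronglyMeasurable
    exact this.integral_prod_right.measurable
  have hub : ∀ t, ‖u t‖ ≤ 1 := fun t => by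
    refine (norm_integral_le_of_norm_le_const (C := 1) (ae_of_all _ fun ω => (hE1 _).le)).trans ?_
    simp
  have hstep : ∀ᵐ e ∂expLaw lam, 0 < e := by
    rw [ae_iff]
    simpa using expLaw_zero (lam := lam)
  have hk1 : ∀ᵐ k ∂stepLaw p, k ≠ 1 := by
    rw [ae_iff]
    have : {k : ℕ | ¬ k ≠ 1} = {1} := by ext; simp
    rw [this, ← lintegral_indicator_one (measurableSet_singleton 1), lintegral_stepLaw,
      ENNReal.tsum_eq_zero]
    intro k
    by_cases hk : k = 1
    · simp [hk, hp1]
    · simp [hk]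
  have hren : ∀ t, u t = (Real.exp (-(lam * t)) : ℂ) + M * ∫ e in Iic t, u (t - e) ∂expLaw lam := by
    intro t
    have hF : Measurable fun ω => E (walkPath h t ω) := hEc.measurable.comp (measurable_walkPath t)
    have i1 : u t = ∫ e, ∫ k, ∫ ω, E (walkPath h t (consSeq (e, k) ω)) ∂seqLaw lam p ∂stepLaw p
        ∂expLaw lam := by
      have hFc : Measurable fun x : (ℝ≥0 × ℕ) × (ℕ → ℝ≥0 × ℕ) =>
        walkPath h t (consSeq x.1 x.2) := (measurable_walkPath t).comp measurable_consSeq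
      have hi := hEi (((expLaw lam).prod (stepLaw p)).prod (seqLaw lam p)) _ hFc
      have hc : u t = ∫ x, E (walkPath h t (consSeq x.1 x.2))
          ∂(((expLaw lam).prod (stepLaw p)).prod (seqLaw lam p)) := by
        rw [← integral_map (φ := fun x : (ℝ≥0 × ℕ) × (ℕ → ℝ≥0 × ℕ) => consSeq x.1 x.2)
          (f := fun ω => E (walkPath h t ω)) measurable_consSeq.aemeasurable
          hF.aestronglyMeasurable, measurePreserving_consSeq.map_eq]
      rw [hc, integral_prod _ hi, integral_prod _ hi.integral_prod_left]
    have i2 : ∀ᵐ e ∂expLaw lam, ∫ k, ∫ ω, E (walkPath h t (consSeq (e, k) ω)) ∂seqLaw lam p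
        ∂stepLaw p = (Ioi t).indicator 1 e + (Iic t).indicator (fun e => M * u (t - e)) e := by
      filter_upwards [hstep] with e he
      by_cases het : t < e
      · rw [indicator_of_mem (show e ∈ Ioi t from het),
          indicator_of_notMem (show e ∉ Iic t from not_le.2 het), add_zero, Pi.one_apply]
        have : ∀ᵐ k ∂stepLaw p, ∫ ω, E (walkPath h t (consSeq (e, k) ω)) ∂seqLaw lam p = 1 := by
          filter_upwards [hk1] with k hk
          have : ∀ᵐ ω ∂seqLaw lam p, E (walkPath h t (consSeq (e, k) ω)) = 1 := by
            filter_upwards [ae_isGood hp1] with ω hω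
            rw [walkPath_consSeq_of_lt (isGood_consSeq_iff.2 ⟨he, hk, hω⟩) het]
            simp [hE]
          rw [integral_congr_ae this]
          simp
        rw [integral_congr_ae this]
        simp
      · rw [indicator_of_notMem (show e ∉ Ioi t from het),
          indicator_of_mem (show e ∈ Iic t from not_lt.1 het), zero_add]
        have : ∀ᵐ k ∂stepLaw p, ∫ ω, E (walkPath h t (consSeq (e, k) ω)) ∂seqLaw lam p =
            E (h * (1 - (k : ℝ))) * u (t - e) := by
          filter_upwards [hk1] with k hk
          rw [hu]
          dsimp only
          rw [← integral_const_mul]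
          refine integral_congr_ae ?_
          filter_upwards [ae_isGood hp1] with ω hω
          rw [walkPath_consSeq_of_le (isGood_consSeq_iff.2 ⟨he, hk, hω⟩) (not_lt.1 het), hEadd]
        rw [integral_congr_ae this, integral_mul_const]
    have hi1 : Integrable ((Ioi t).indicator (1 : ℝ≥0 → ℂ)) (expLaw lam) :=
      (integrable_const (1 : ℂ)).indicator measurableSet_Ioi
    have hi2 : Integrable ((Iic t).indicator (fun e => M * u (t - e))) (expLaw lam) := by
      refine Integrable.indicator ?_ measurableSet_Iic
      refine Integrable.const_mul ?_ _
      exact Integrable.of_bound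
        (hum.comp (measurable_const.sub measurable_id)).aestronglyMeasurable 1 (ae_of_all _ fun e => hub _)
    have hi3 : ∫ e, (Ioi t).indicator (1 : ℝ≥0 → ℂ) e ∂expLaw lam =
        (Real.exp (-(lam * t)) : ℂ) := by
      rw [integral_indicator measurableSet_Ioi]
      simp only [Pi.one_apply]
      rw [setIntegral_const, measureReal_def, expLaw_Ioi,
        ENNReal.toReal_ofReal (Real.exp_nonneg _), Complex.real_smul, mul_one]
    rw [i1, integral_congr_ae i2, integral_add hi1 hi2, hi3, integral_indicator measurableSet_Iic,
      integral_const_mul]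
  have hsol := renewal_eq_exp (lam := lam) M hum hub hren t
  have hmeasf : Measurable fun k : ℕ => h * (1 - (k : ℝ)) := measurable_of_countable _
  have hint : ∫ x : ℝ, (E x - 1) ∂walkMeasure h lam p = lam * (M - 1) := by
    rw [walkMeasure, integral_smul_measure, integral_map
      (f := fun x => E x - 1) hmeasf.aemeasurable
      (hEc.sub continuous_const).aestronglyMeasurable, integral_sub (hEi _ _ hmeasf)
      (integrable_const _), ENNReal.toReal_ofReal hl0.le, Complex.real_smul]
    simp [hM]
  rw [charFun_apply_real, integral_map (measurable_walkPath t).aemeasurable (by fun_prop), hint,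
    show (t : ℂ) * (lam * (M - 1)) = -(lam * (1 - M) * t) by ring]
  have : u t = ∫ ω, Complex.exp (q * (walkPath h t ω) * Complex.I) ∂seqLaw lam p := by
    simp only [hu, hE]
    congr with ω
    ring_nf
  rw [← this]
  exact hsol

end markov

/-! ### Measurability of the ladder processes -/

section measurability

variable {Ω : Type*} [MeasurableSpace Ω] {X : ℝ≥0 → Ω → ℝ} {h : ℝ}

/-- Time is replaced by the next point of a grid of mesh `1 / (n + 1)`; this approaches it from the
right, and right-continuity gives the limit. -/
lemma measurable_uncurry_of_rightContinuous (hm : ∀ t, Measurable (X t))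
    (hc : ∀ ω t, ContinuousWithinAt (fun t => X t ω) (Ici t) t) :
    Measurable fun x : ℝ≥0 × Ω => X x.1 x.2 := by
  set a : ℕ → ℝ≥0 → ℝ≥0 := fun n s => ((⌊s * (n + 1)⌋₊ : ℝ≥0) + 1) / (n + 1) with ha
  have h1 : ∀ n, Measurable fun x : ℝ≥0 × Ω => X (a n x.1) x.2 := by
    intro n
    have : Measurable fun y : ℕ × Ω => X (((y.1 : ℝ≥0) + 1) / (n + 1)) y.2 :=
      measurable_from_prod_countable_right fun k => hm (((k : ℝ≥0) + 1) / (n + 1))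
    exact this.comp (f := fun x : ℝ≥0 × Ω => (⌊x.1 * (n + 1)⌋₊, x.2))
      ((Nat.measurable_floor.comp (by fun_prop)).prodMk measurable_snd)
  refine measurable_of_tendsto_metrizable h1 (tendsto_pi_nhds.2 fun x => ?_)
  refine (hc x.2 x.1).tendsto.comp (tendsto_nhdsWithin_iff.2 ⟨?_, Eventually.of_forall fun n => ?_⟩)
  · have hlow : ∀ n, x.1 ≤ a n x.1 := fun n => by
      rw [ha, le_div_iff₀ (by positivity)]
      exact (Nat.lt_floor_add_one _).le
    have hup : ∀ n, a n x.1 ≤ x.1 + 1 / ((n : ℝ≥0) + 1) := fun n => by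
      change ((⌊x.1 * (n + 1)⌋₊ : ℝ≥0) + 1) / (n + 1) ≤ _
      rw [add_div]
      gcongr
      rw [div_le_iff₀ (by positivity)]
      exact Nat.floor_le zero_le
    have hlim : Tendsto (fun n : ℕ => x.1 + 1 / ((n : ℝ≥0) + 1)) atTop (𝓝 x.1) := by
      have := (tendsto_one_div_add_atTop_nhds_zero_nat (𝕜 := ℝ≥0)).const_add x.1
      rwa [add_zero] at this
    exact tendsto_of_tendsto_of_tendsto_of_le_of_le tendsto_const_nhds hlim hlow hup
  · rw [mem_Ici, ha, le_div_iff₀ (by positivity)]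
    exact (Nat.lt_floor_add_one _).le

lemma measurable_occupation {M : Set (ℝ≥0 × Ω)} (hM : MeasurableSet M) (t : ℝ≥0) :
    Measurable fun ω => occupation {s | (s, ω) ∈ M} t := by
  set S : Set (Ω × ℝ) := {x | (0 ≤ x.2 ∧ x.2 ≤ t) ∧ (x.2.toNNReal, x.1) ∈ M} with hS
  have hSm : MeasurableSet S := by
    refine .inter (.inter (measurableSet_le measurable_const measurable_snd)
      (measurableSet_le measurable_snd measurable_const)) ?_
    exact hM.preimage (by fun_prop)
  convert measurable_measure_prodMk_left (ν := (volume : Measure ℝ)) hSm using 2 with ω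
  unfold occupation
  congr 1
  ext x
  constructor
  · rintro ⟨s, ⟨h1, h2⟩, rfl⟩
    refine ⟨⟨s.coe_nonneg, NNReal.coe_le_coe.2 h1⟩, ?_⟩
    simpa using h2
  · rintro ⟨⟨h1, h2⟩, h3⟩
    exact ⟨x.toNNReal, ⟨by rwa [Real.toNNReal_le_iff_le_coe], h3⟩, Real.coe_toNNReal x h1⟩

/-- Right-continuous paths in the lattice are locally constant to the right. -/
lemma eventually_eq_of_lattice (hh : 0 < h) {f : ℝ≥0 → ℝ} (hl : ∀ t, f t ∈ lattice h) {t : ℝ≥0}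
    (hc : ContinuousWithinAt f (Ici t) t) : ∀ᶠ s in 𝓝[≥] t, f s = f t := by
  have h1 : ∀ᶠ s in 𝓝[≥] t, dist (f s) (f t) < h := Metric.tendsto_nhds.1 hc h hh
  filter_upwards [h1] with s hs
  obtain ⟨a, ha⟩ := hl s
  obtain ⟨b, hb⟩ := hl t
  rw [← ha, ← hb] at hs ⊢
  simp only [Real.dist_eq, ← mul_sub, abs_mul, abs_of_pos hh] at hs ⊢
  have h2 : |(a : ℝ) - b| < 1 := by
    by_contra hge
    exact absurd hs (not_lt.2 (le_mul_of_one_le_right hh.le (not_lt.1 hge)))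
  have h3 : |a - b| < 1 := by exact_mod_cast h2
  rw [Int.abs_lt_one_iff, sub_eq_zero] at h3
  rw [h3]

/-- A lattice path keeps its value for a short while, so each of its values is also taken at a
slightly later time of a countable dense set. -/
lemma exists_denseSeq_eq (hh : 0 < h) {f : ℝ≥0 → ℝ} (hl : ∀ t, f t ∈ lattice h)
    (hc : ∀ t, ContinuousWithinAt f (Ici t) t) {a b : ℝ≥0} (hab : a < b) :
    ∃ i, a < TopologicalSpace.denseSeq ℝ≥0 i ∧ TopologicalSpace.denseSeq ℝ≥0 i < b ∧
      f (TopologicalSpace.denseSeq ℝ≥0 i) = f a := by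
  obtain ⟨c, hc1, hc2⟩ := (mem_nhdsGE_iff_exists_Ico_subset).1
    (eventually_eq_of_lattice hh hl (hc a))
  obtain ⟨q, ⟨i, rfl⟩, h1, h2⟩ := (TopologicalSpace.denseRange_denseSeq ℝ≥0).exists_between
    (lt_min hab hc1)
  exact ⟨i, h1, h2.trans_le (min_le_left _ _), hc2 ⟨h1.le, h2.trans_le (min_le_right _ _)⟩⟩

lemma atMin_iff_denseSeq (hh : 0 < h) {f : ℝ≥0 → ℝ} (hl : ∀ t, f t ∈ lattice h)
    (hc : ∀ t, ContinuousWithinAt f (Ici t) t) (s : ℝ≥0) :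
    (∀ r ≤ s, f s ≤ f r) ↔ ∀ i, TopologicalSpace.denseSeq ℝ≥0 i < s →
      f s ≤ f (TopologicalSpace.denseSeq ℝ≥0 i) := by
  refine ⟨fun H i hi => H _ hi.le, fun H r hr => ?_⟩
  rcases hr.lt_or_eq with hr | rfl
  · obtain ⟨i, -, h2, h3⟩ := exists_denseSeq_eq hh hl hc hr
    exact h3 ▸ H i h2
  · exact le_rfl

/-- The right side says that the path stays below its value at `s`, and that once at this level it
remains there until `s`. Only countably many times occur in it, which makes the event measurable. -/
lemma atNewMax_iff_denseSeq (hh : 0 < h) {f : ℝ≥0 → ℝ} (hl : ∀ t, f t ∈ lattice h)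
    (hc : ∀ t, ContinuousWithinAt f (Ici t) t) (s : ℝ≥0) :
    AtNewMax f s ↔ (∀ i, TopologicalSpace.denseSeq ℝ≥0 i < s →
        f (TopologicalSpace.denseSeq ℝ≥0 i) ≤ f s) ∧
      ∀ i j, TopologicalSpace.denseSeq ℝ≥0 i < TopologicalSpace.denseSeq ℝ≥0 j →
        TopologicalSpace.denseSeq ℝ≥0 j < s → f (TopologicalSpace.denseSeq ℝ≥0 i) = f s →
        f (TopologicalSpace.denseSeq ℝ≥0 j) = f s := by
  constructor
  · rintro ⟨a, has, hbefore, hconst⟩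
    have hs := hconst s has le_rfl
    refine ⟨fun i hi => ?_, fun i j hij hj hi => ?_⟩
    · rcases lt_or_ge (TopologicalSpace.denseSeq ℝ≥0 i) a with h1 | h1
      · exact hs ▸ (hbefore _ h1).le
      · rw [hconst _ h1 hi.le, hs]
    · have h1 : a ≤ TopologicalSpace.denseSeq ℝ≥0 i := by
        by_contra hlt
        have := hbefore _ (not_le.1 hlt)
        rw [hi, hs] at this
        exact lt_irrefl _ this
      rw [hconst _ (h1.trans hij.le) hj.le, hs]
  · rintro ⟨H1, H2⟩
    have H1' : ∀ r ≤ s, f r ≤ f s := by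
      intro r hr
      rcases hr.lt_or_eq with hr | rfl
      · obtain ⟨i, -, h2, h3⟩ := exists_denseSeq_eq hh hl hc hr
        exact h3 ▸ H1 i h2
      · exact le_rfl
    have H2' : ∀ r r', r < r' → r' < s → f r = f s → f r' = f s := by
      intro r r' hrr' hr's hr
      obtain ⟨i, -, hi2, hi3⟩ := exists_denseSeq_eq hh hl hc hrr'
      obtain ⟨j, hj1, hj2, hj3⟩ := exists_denseSeq_eq hh hl hc hr's
      rw [← hj3]
      exact H2 i j (hi2.trans hj1) hj2 (hi3.trans hr)
    -- Its infimum is the time at which the maximum was reached; the infimum is attained because the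
    -- path is locally constant to the right.
    set A : Set ℝ≥0 := {r | r ≤ s ∧ f r = f s} with hA
    have hAne : A.Nonempty := ⟨s, le_rfl, rfl⟩
    have hinf : sInf A ≤ s := csInf_le (OrderBot.bddBelow A) ⟨le_rfl, rfl⟩
    have hmem : f (sInf A) = f s := by
      obtain ⟨c, hc1, hc2⟩ := (mem_nhdsGE_iff_exists_Ico_subset).1
        (eventually_eq_of_lattice hh hl (hc (sInf A)))
      obtain ⟨r, hr, hrc⟩ := exists_lt_of_csInf_lt hAne hc1
      exact (hc2 ⟨csInf_le (OrderBot.bddBelow A) hr, hrc⟩).symm.trans hr.2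
    refine ⟨sInf A, hinf, fun r hr => ?_, fun r hr1 hr2 => ?_⟩
    · rw [hmem]
      have hrs := hr.le.trans hinf
      refine lt_of_le_of_ne (H1' r hrs) fun heq => ?_
      exact absurd (csInf_le (OrderBot.bddBelow A) ⟨hrs, heq⟩) (not_le.2 hr)
    · rw [hmem]
      rcases hr1.lt_or_eq with hr1 | rfl
      · rcases hr2.lt_or_eq with hr2 | rfl
        · exact H2' _ _ hr1 hr2 hmem
        · rfl
      · exact hmem

/-- The process `X` has right-continuous paths in the lattice of span `h`. -/
structure IsLatticeProcess (h : ℝ) (X : ℝ≥0 → Ω → ℝ) : Prop where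
  measurable : ∀ t, Measurable (X t)
  mem_lattice : ∀ t ω, X t ω ∈ lattice h
  rightContinuous : ∀ ω t, ContinuousWithinAt (fun t => X t ω) (Ici t) t

namespace IsLatticeProcess

lemma measurable_newMaxTime (hX : IsLatticeProcess h X) (hh : 0 < h) (t : ℝ≥0) :
    Measurable fun ω => newMaxTime (fun s => X s ω) t := by
  have hj := measurable_uncurry_of_rightContinuous hX.measurable hX.rightContinuous
  have hM : MeasurableSet {x : ℝ≥0 × Ω | AtNewMax (fun s => X s x.2) x.1} := by
    simp_rw [atNewMax_iff_denseSeq hh (fun t => hX.mem_lattice t _) (hX.rightContinuous _)]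
    have hq : ∀ i, Measurable fun x : ℝ≥0 × Ω => X (TopologicalSpace.denseSeq ℝ≥0 i) x.2 :=
      fun i => (hX.measurable _).comp measurable_snd
    simp_rw [ofPred_and, ofPred_forall]
    refine .inter (.iInter fun i => .imp ?_ ?_) (.iInter fun i => .iInter fun j => .iInter fun _ =>
      .imp ?_ (.imp ?_ ?_))
    · exact measurableSet_lt measurable_const measurable_fst
    · exact measurableSet_le (hq i) hj
    · exact measurableSet_lt measurable_const measurable_fst
    · exact measurableSet_eq_fun (hq i) hj
    · exact measurableSet_eq_fun (hq j) hj
  exact measurable_occupation hM t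

lemma measurable_minTime (hX : IsLatticeProcess h X) (hh : 0 < h) (t : ℝ≥0) :
    Measurable fun ω => minTime (fun s => X s ω) t := by
  have hj := measurable_uncurry_of_rightContinuous hX.measurable hX.rightContinuous
  have hM : MeasurableSet {x : ℝ≥0 × Ω | ∀ r ≤ x.1, X x.1 x.2 ≤ X r x.2} := by
    simp_rw [atMin_iff_denseSeq hh (fun t => hX.mem_lattice t _) (hX.rightContinuous _)]
    simp_rw [ofPred_forall]
    refine .iInter fun i => .imp ?_ ?_
    · exact measurableSet_lt measurable_const measurable_fst
    · exact measurableSet_le hj ((hX.measurable _).comp measurable_snd)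
  exact measurable_occupation hM t

lemma strictAscLadderHeight_ne_top_iff {Ω : Type*} (X : ℝ≥0 → Ω → ℝ) (t : ℝ≥0) (ω : Ω) :
    strictAscLadderHeight X t ω ≠ ⊤ ↔ ∃ n : ℕ, (t : ℝ≥0∞) < newMaxTime (fun s => X s ω) n := by
  have h1 : strictAscLadderHeight X t ω ≠ ⊤ ↔
      rightInverse (newMaxTime fun s => X s ω) t ≠ ⊤ := by
    unfold strictAscLadderHeight evalAt
    split_ifs with hτ <;> simp [hτ]
  rw [h1, rightInverse, Ne, iInf_eq_top]
  constructor
  · intro H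
    push Not at H
    obtain ⟨s, hs⟩ := H
    have hlt : (t : ℝ≥0∞) < newMaxTime (fun s => X s ω) s := by
      by_contra hlt
      exact hs (by simp [hlt])
    obtain ⟨n, hn⟩ := exists_nat_ge s
    exact ⟨n, hlt.trans_le (occupation_mono hn)⟩
  · rintro ⟨n, hn⟩ H
    have := H n
    simp [hn] at this

lemma measurableSet_strictAsc (hX : IsLatticeProcess h X) (hh : 0 < h) (t : ℝ≥0) :
    MeasurableSet {ω | strictAscLadderHeight X t ω ≠ ⊤} := by
  simp_rw [strictAscLadderHeight_ne_top_iff, ofPred_exists]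
  exact .iUnion fun n => measurableSet_lt measurable_const (hX.measurable_newMaxTime hh n)

/-- By monotonicity, a level exceeded at some time before `c` is exceeded at a dense time before
`c`. -/
lemma measurable_rightInverse {L : Ω → ℝ≥0 → ℝ≥0∞} (hL : ∀ t, Measurable fun ω => L ω t)
    (hmono : ∀ ω, Monotone (L ω)) (t : ℝ≥0) : Measurable fun ω => rightInverse (L ω) t := by
  refine measurable_of_Iio fun c => ?_
  have : (fun ω => rightInverse (L ω) t) ⁻¹' Iio c =
      ⋃ i, {ω | ((TopologicalSpace.denseSeq ℝ≥0 i : ℝ≥0) : ℝ≥0∞) < c ∧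
        (t : ℝ≥0∞) < L ω (TopologicalSpace.denseSeq ℝ≥0 i)} := by
    ext ω
    simp only [mem_preimage, mem_Iio, rightInverse, iInf_lt_iff, mem_iUnion, mem_ofPred_eq]
    constructor
    · rintro ⟨s, hs, hsc⟩
      obtain ⟨b, hb1, hb2⟩ := ENNReal.lt_iff_exists_nnreal_btwn.1 hsc
      obtain ⟨q, ⟨i, rfl⟩, h1, h2⟩ := (TopologicalSpace.denseRange_denseSeq ℝ≥0).exists_between
        (ENNReal.coe_lt_coe.1 hb1)
      exact ⟨i, (ENNReal.coe_lt_coe.2 h2).trans hb2, hs.trans_le (hmono ω h1.le)⟩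
    · rintro ⟨i, h1, h2⟩
      exact ⟨_, h2, h1⟩
  rw [this]
  refine .iUnion fun i => ?_
  rw [ofPred_and]
  exact .inter (.const _) (measurableSet_lt measurable_const (hL _))

lemma measurable_descLadder (hX : IsLatticeProcess h X) (hh : 0 < h) (ν : Measure ℝ) (t : ℝ≥0)
    (β : ℝ) : Measurable fun ω => if descLadderHeight h ν X t ω = ⊤ then 0 else
      Real.exp (-(β * (descLadderHeight h ν X t ω).toReal)) := by
  set τ : Ω → ℝ≥0∞ := fun ω => rightInverse (localTimeMin h ν fun s => X s ω) t with hτ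
  have hτm : Measurable τ := by
    refine measurable_rightInverse (L := fun ω => localTimeMin h ν fun s => X s ω)
      (fun t => ?_) (fun ω => ?_) t
    · exact (hX.measurable_minTime hh t).const_mul _
    · intro a b hab
      exact mul_le_mul_right (occupation_mono hab) _
  have heq : (fun ω => if descLadderHeight h ν X t ω = ⊤ then 0 else
      Real.exp (-(β * (descLadderHeight h ν X t ω).toReal))) =
      fun ω => if τ ω = ⊤ then 0 else Real.exp (-(β * -X (τ ω).toNNReal ω)) := by
    ext ω
    change (if evalAt (fun s => -X s ω) (τ ω) = ⊤ then 0 else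
      Real.exp (-(β * (evalAt (fun s => -X s ω) (τ ω)).toReal))) = _
    by_cases h1 : τ ω = ⊤
    · simp [h1, evalAt]
    · have h2 : evalAt (fun s => -X s ω) (τ ω) = ((-X (τ ω).toNNReal ω : ℝ) : EReal) := by
        simp [evalAt, h1]
      rw [h2, if_neg (EReal.coe_ne_top _), if_neg h1, EReal.toReal_coe]
  rw [heq]
  refine Measurable.ite (hτm (measurableSet_singleton ⊤)) measurable_const ?_
  have hj := measurable_uncurry_of_rightContinuous hX.measurable hX.rightContinuous
  have : Measurable fun ω => X (τ ω).toNNReal ω := hj.comp (hτm.ennreal_toNNReal.prodMk measurable_id)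
  fun_prop

end IsLatticeProcess

end measurability

/-! ### The law of a Lévy process -/

section law

variable {Ω Ω' : Type*} [MeasurableSpace Ω] [MeasurableSpace Ω'] {P : Measure Ω} {P' : Measure Ω'}
  {X : ℝ≥0 → Ω → ℝ} {X' : ℝ≥0 → Ω' → ℝ}

/-- The times `0, t₁, …, tₙ` for a finite set of times `t₁ < ⋯ < tₙ`. -/
noncomputable def timesFrom (I : Finset ℝ≥0) : Fin (I.card + 1) → ℝ≥0 :=
  Fin.cons 0 (I.orderEmbOfFin rfl)

lemma monotone_timesFrom (I : Finset ℝ≥0) : Monotone (timesFrom I) := by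
  intro i j hij
  cases i using Fin.cases with
  | zero => simp [timesFrom]
  | succ i =>
    cases j using Fin.cases with
    | zero => exact absurd hij (by simp)
    | succ j => simpa [timesFrom] using hij

/-- The values of a path at the times in `I`, from its increments. -/
noncomputable def sumIncrements (I : Finset ℝ≥0) (x : Fin I.card → ℝ) (i : I) : ℝ :=
  ∑ j ≤ (I.orderIsoOfFin rfl).symm i, x j

lemma measurable_sumIncrements (I : Finset ℝ≥0) : Measurable (sumIncrements I) := by
  unfold sumIncrements
  fun_prop

/-- Finite-dimensional laws are images of products of one-dimensional ones: positions are partial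
sums of independent increments, whose laws depend only on the time differences. -/
lemma IsLevyProcess.map_restrict [IsProbabilityMeasure P] (hX : IsLevyProcess X P)
    (I : Finset ℝ≥0) : P.map (fun ω => I.restrict fun t => X t ω) =
      (Measure.pi fun i : Fin I.card =>
        P.map (X (timesFrom I i.succ - timesFrom I i.castSucc))).map (sumIncrements I) := by
  have hinc : ∀ i : Fin I.card, Measurable fun ω =>
      X (timesFrom I i.succ) ω - X (timesFrom I i.castSucc) ω := fun i =>
    (hX.measurable _).sub (hX.measurable _)
  have hlaw := (iIndepFun_iff_map_fun_eq_pi_map fun i => (hinc i).aemeasurable).1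
    (hX.indep I.card (timesFrom I) (monotone_timesFrom I))
  have hmarg : ∀ i : Fin I.card,
      P.map (fun ω => X (timesFrom I i.succ) ω - X (timesFrom I i.castSucc) ω) =
        P.map (X (timesFrom I i.succ - timesFrom I i.castSucc)) := by
    intro i
    have := (hX.stationary (timesFrom I i.castSucc)
      (timesFrom I i.succ - timesFrom I i.castSucc)).map_eq
    rwa [add_tsub_cancel_of_le (monotone_timesFrom I (Fin.castSucc_le_succ i))] at this
  simp_rw [← hmarg]
  rw [← hlaw, Measure.map_map (measurable_sumIncrements I) (measurable_pi_lambda _ hinc)]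
  refine Measure.map_congr ?_
  filter_upwards [hX.zero] with ω hω
  ext t
  simp only [Function.comp_apply, sumIncrements, Finset.restrict]
  rw [Fin.sum_Iic_sub _ (fun j => X (timesFrom I j) ω)]
  simp [timesFrom, hω, Finset.orderEmbOfFin]

lemma IsLevyProcess.map_eq_map [IsProbabilityMeasure P] [IsProbabilityMeasure P']
    (hX : IsLevyProcess X P) (hX' : IsLevyProcess X' P') (h : ∀ t, P.map (X t) = P'.map (X' t)) :
    P.map (fun ω t => X t ω) = P'.map (fun ω t => X' t ω) := by
  have h1 := isProjectiveLimit_map (measurable_pi_lambda _ hX.measurable).aemeasurable (P := P)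
    (X := X)
  have h2 := isProjectiveLimit_map (measurable_pi_lambda _ hX'.measurable).aemeasurable (P := P')
    (X := X')
  have h3 : ∀ I : Finset ℝ≥0, P'.map (fun ω => I.restrict fun t => X' t ω) =
      P.map (fun ω => I.restrict fun t => X t ω) := fun I => by
    rw [hX.map_restrict, hX'.map_restrict]
    simp_rw [h]
  simp_rw [h3] at h2
  exact h1.unique h2

lemma IsCompoundPoisson.map_eq_map [IsProbabilityMeasure P] [IsProbabilityMeasure P']
    {ν : Measure ℝ} (hX : IsCompoundPoisson X P ν) (hX' : IsCompoundPoisson X' P' ν) :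
    P.map (fun ω t => X t ω) = P'.map (fun ω t => X' t ω) := by
  refine hX.toIsLevyProcess.map_eq_map hX'.toIsLevyProcess fun t => ?_
  have := Measure.isProbabilityMeasure_map (μ := P) (hX.measurable t).aemeasurable
  have := Measure.isProbabilityMeasure_map (μ := P') (hX'.measurable t).aemeasurable
  refine Measure.ext_of_charFun ?_
  ext p
  rw [hX.charFun_eq, hX'.charFun_eq]

/-- The space of right-continuous paths in the lattice. -/
abbrev LatticePath (h : ℝ) : Type :=
  {f : ℝ≥0 → ℝ // (∀ t, f t ∈ lattice h) ∧ ∀ t, ContinuousWithinAt f (Ici t) t}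

lemma isLatticeProcess_eval (h : ℝ) :
    IsLatticeProcess h (fun (t : ℝ≥0) (f : LatticePath h) => f.1 t) where
  measurable t := (measurable_pi_apply t).comp measurable_subtype_coe
  mem_lattice t f := f.2.1 t
  rightContinuous f t := f.2.2 t

/-- The path of a lattice process. -/
def IsLatticeProcess.toPath {h : ℝ} (hX : IsLatticeProcess h X) (ω : Ω) : LatticePath h :=
  ⟨fun t => X t ω, fun t => hX.mem_lattice t ω, hX.rightContinuous ω⟩

lemma IsLatticeProcess.measurable_toPath {h : ℝ} (hX : IsLatticeProcess h X) :
    Measurable hX.toPath :=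
  (measurable_pi_lambda _ hX.measurable).subtype_mk

/-- Measurability of the ladder functionals rests on path regularity, so laws must be compared on
the subtype of regular paths; its measurable sets are traces of measurable sets of the product
space. -/
lemma IsLatticeProcess.map_toPath_eq {h : ℝ} (hX : IsLatticeProcess h X)
    (hX' : IsLatticeProcess h X') (hlaw : P.map (fun ω t => X t ω) = P'.map (fun ω t => X' t ω)) :
    P.map hX.toPath = P'.map hX'.toPath := by
  ext B hB
  obtain ⟨A, hA, rfl⟩ := hB
  have h1 := congrArg (fun μ => μ A) hlaw
  rw [Measure.map_apply (measurable_pi_lambda _ hX.measurable) hA,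
    Measure.map_apply (measurable_pi_lambda _ hX'.measurable) hA] at h1
  rw [Measure.map_apply hX.measurable_toPath (measurable_subtype_coe hA),
    Measure.map_apply hX'.measurable_toPath (measurable_subtype_coe hA)]
  exact h1

lemma IsLatticeProcess.measure_strictAsc_congr {h : ℝ} (hh : 0 < h) (hX : IsLatticeProcess h X)
    (hX' : IsLatticeProcess h X') (hlaw : P.map (fun ω t => X t ω) = P'.map (fun ω t => X' t ω))
    (t : ℝ≥0) : P {ω | strictAscLadderHeight X t ω ≠ ⊤} =
      P' {ω | strictAscLadderHeight X' t ω ≠ ⊤} := by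
  have h1 := congrArg (fun μ => μ {f | strictAscLadderHeight
    (fun (t : ℝ≥0) (f : LatticePath h) => f.1 t) t f ≠ ⊤}) (hX.map_toPath_eq hX' hlaw)
  rwa [Measure.map_apply hX.measurable_toPath ((isLatticeProcess_eval h).measurableSet_strictAsc hh t),
    Measure.map_apply hX'.measurable_toPath
      ((isLatticeProcess_eval h).measurableSet_strictAsc hh t)] at h1

lemma IsLatticeProcess.integral_desc_congr {h : ℝ} (hh : 0 < h) (hX : IsLatticeProcess h X)
    (hX' : IsLatticeProcess h X') (hlaw : P.map (fun ω t => X t ω) = P'.map (fun ω t => X' t ω))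
    (ν : Measure ℝ) (t : ℝ≥0) (β : ℝ) :
    ∫ ω, (if descLadderHeight h ν X t ω = ⊤ then 0 else
      Real.exp (-(β * (descLadderHeight h ν X t ω).toReal))) ∂P =
    ∫ ω, (if descLadderHeight h ν X' t ω = ⊤ then 0 else
      Real.exp (-(β * (descLadderHeight h ν X' t ω).toReal))) ∂P' := by
  have hm := ((isLatticeProcess_eval h).measurable_descLadder hh ν t β)
  have h1 := integral_map (μ := P) hX.measurable_toPath.aemeasurable hm.aestronglyMeasurable
  have h2 := integral_map (μ := P') hX'.measurable_toPath.aemeasurable hm.aestronglyMeasurable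
  rw [hX.map_toPath_eq hX' hlaw, h2] at h1
  exact h1.symm

end law

/-! ### Lévy measures of upwards skip-free chains -/

section levyMeasure

variable {h lam : ℝ} {p : ℕ → ℝ≥0∞}

/-- The step of the walk with drop code `k`. -/
def stepValue (h : ℝ) (k : ℕ) : ℝ := h * (1 - (k : ℝ))

lemma stepValue_injective (hh : h ≠ 0) : Function.Injective (stepValue h) := fun i j hij => by
  simpa [stepValue, hh] using hij

lemma measurableEmbedding_stepValue (hh : h ≠ 0) : MeasurableEmbedding (stepValue h) where
  injective := stepValue_injective hh
  measurable := measurable_of_countable _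
  measurableSet_image' s _ := ((Set.to_countable s).image _).measurableSet

lemma stepLaw_singleton (p : ℕ → ℝ≥0∞) (k : ℕ) : stepLaw p {k} = p k := by
  rw [← lintegral_indicator_one (measurableSet_singleton k), lintegral_stepLaw,
    tsum_eq_single k fun j hj => by simp [hj]]
  simp

lemma stepLaw_eq (μ : Measure ℕ) : stepLaw (fun k => μ {k}) = μ :=
  Measure.sum_smul_dirac μ

lemma walkMeasure_apply {A : Set ℝ} (hA : MeasurableSet A) :
    walkMeasure h lam p A =
      ENNReal.ofReal lam * ∑' k, p k * A.indicator 1 (stepValue h k) := by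
  rw [walkMeasure, Measure.smul_apply, smul_eq_mul,
    Measure.map_apply (measurable_of_countable _) hA,
    ← lintegral_indicator_one (measurable_of_countable _ hA), lintegral_stepLaw]
  rfl

lemma walkMeasure_eq_zero {A : Set ℝ} (hA : MeasurableSet A)
    (h0 : ∀ k, stepValue h k ∈ A → p k = 0) : walkMeasure h lam p A = 0 := by
  rw [walkMeasure_apply hA, ENNReal.tsum_eq_zero.2 fun k => ?_, mul_zero]
  by_cases hk : stepValue h k ∈ A
  · simp [h0 k hk]
  · simp [hk]

lemma walkMeasure_singleton (hh : h ≠ 0) (k : ℕ) :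
    walkMeasure h lam p {stepValue h k} = ENNReal.ofReal lam * p k := by
  rw [walkMeasure_apply (measurableSet_singleton _), tsum_eq_single k fun j hj => by
    simp [(stepValue_injective hh).ne hj]]
  simp

lemma isClosed_lattice (h : ℝ) : IsClosed (lattice h) := by
  rcases eq_or_ne h 0 with rfl | hh
  · have : lattice 0 = {0} := by
      ext x
      simp [lattice]
    exact this ▸ isClosed_singleton
  · have : lattice h = (Homeomorph.mulLeft₀ h hh) '' range ((↑) : ℤ → ℝ) := by
      ext x
      simp [lattice]
    rw [this, Homeomorph.isClosed_image]
    exact Int.isClosedEmbedding_coe_real.isClosed_range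

lemma walkMeasure_support_subset : (walkMeasure h lam p).support ⊆ lattice h := by
  refine Measure.support_subset_of_isClosed (isClosed_lattice h) ?_
  rw [mem_ae_iff]
  refine walkMeasure_eq_zero (isClosed_lattice h).measurableSet.compl fun k hk => ?_
  exact absurd ⟨1 - (k : ℤ), by simp [stepValue]⟩ hk

lemma walkMeasure_support_restrict (hh : 0 < h) (hl : 0 < lam) (hp0 : p 0 ≠ 0) :
    ((walkMeasure h lam p).restrict (Ioi 0)).support = {h} := by
  have hzero : stepValue h 0 = h := by simp [stepValue]
  ext x
  rw [Measure.mem_support_iff_forall, mem_singleton_iff]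
  refine ⟨fun hx => ?_, ?_⟩
  · by_contra hne
    have := hx {h}ᶜ (isOpen_compl_singleton.mem_nhds hne)
    rw [Measure.restrict_apply (measurableSet_singleton h).compl, walkMeasure_eq_zero
      ((measurableSet_singleton h).compl.inter measurableSet_Ioi)] at this
    · exact lt_irrefl _ this
    · rintro (_ | k) ⟨hk, hk0⟩
      · exact absurd hzero hk
      · have : stepValue h (k + 1) ≤ 0 := by
          simp only [stepValue]
          push_cast
          nlinarith [mul_nonneg hh.le (Nat.cast_nonneg (α := ℝ) k)]
        exact absurd hk0 (not_lt.2 this)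
  · rintro rfl U hU
    have h1 : 0 < (walkMeasure x lam p).restrict (Ioi 0) {x} := by
      rw [Measure.restrict_apply (measurableSet_singleton x),
        inter_eq_left.2 (singleton_subset_iff.2 (mem_Ioi.2 hh))]
      have := walkMeasure_singleton (lam := lam) (p := p) hh.ne' 0
      rw [hzero] at this
      rw [this]
      exact ENNReal.mul_pos (by simpa using hl) hp0
    exact h1.trans_le (measure_mono (singleton_subset_iff.2 (mem_of_mem_nhds hU)))

lemma isUpwardsSkipFreeLevyChain_walkPath [hl : Fact (0 < lam)] [hp : Fact (∑' k, p k = 1)]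
    (hh : 0 < h) (hp0 : p 0 ≠ 0) (hp1 : p 1 = 0) :
    IsUpwardsSkipFreeLevyChain h (walkPath h) (seqLaw lam p) (walkMeasure h lam p) where
  measurable := measurable_walkPath
  cadlag := isCadlag_walkPath h
  zero := ae_of_all _ walkPath_zero
  indep := hasIndepIncrements_walkPath hp1
  stationary := identDistrib_increment_walkPath hp1
  finite := inferInstance
  ne_zero h0 := by
    have := walkMeasure_singleton (lam := lam) (p := p) hh.ne' 0
    rw [h0] at this
    simp [hp0] at this
    exact absurd hl.out (not_lt.2 this)
  no_atom_zero := by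
    have := walkMeasure_singleton (lam := lam) (p := p) hh.ne' 1
    simpa [stepValue, hp1] using this
  charFun_eq := charFun_walkPath hp1
  supp_lattice := walkMeasure_support_subset
  supp_pos := walkMeasure_support_restrict hh hl.out hp0

/-- The support conditions confine `ν` to `h` and the nonpositive multiples of `h`, which is the
range of `stepValue h`. Normalized and pulled back along this injection, `ν` becomes `p`. The atom
at `0` has code `1`, the atom at `h` has code `0`. -/
lemma IsUpwardsSkipFreeLevyChain.exists_eq_walkMeasure {Ω : Type*} [MeasurableSpace Ω]
    {X : ℝ≥0 → Ω → ℝ} {P : Measure Ω} {ν : Measure ℝ} (hh : 0 < h)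
    (hX : IsUpwardsSkipFreeLevyChain h X P ν) :
    ∃ (lam : ℝ) (p : ℕ → ℝ≥0∞), 0 < lam ∧ ∑' k, p k = 1 ∧ p 0 ≠ 0 ∧ p 1 = 0 ∧
      ν = walkMeasure h lam p := by
  have := hX.finite
  have hemb := measurableEmbedding_stepValue hh.ne'
  have hν0 : ν univ ≠ 0 := by simpa using hX.ne_zero
  have hνt : ν univ ≠ ⊤ := measure_ne_top _ _
  have hpos : ν (Ioi 0 \ {h}) = 0 := by
    have := Measure.measure_compl_support (μ := ν.restrict (Ioi 0))
    rwa [hX.supp_pos, Measure.restrict_apply (measurableSet_singleton h).compl, inter_comm,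
      ← sdiff_eq] at this
  have hlat : ν (lattice h)ᶜ = 0 :=
    measure_mono_null (compl_subset_compl.2 hX.supp_lattice) Measure.measure_compl_support
  have hrange : ν (range (stepValue h))ᶜ = 0 := by
    refine measure_mono_null (fun x hx => ?_) (measure_union_null hpos hlat)
    by_contra hcon
    rw [mem_union, not_or, mem_compl_iff, not_not] at hcon
    obtain ⟨h1, m, rfl⟩ := hcon
    refine hx ?_
    rcases le_or_gt m 1 with hm | hm
    · refine ⟨(1 - m).toNat, ?_⟩
      have : (((1 - m).toNat : ℤ) : ℝ) = ((1 - m : ℤ) : ℝ) := by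
        rw [Int.toNat_of_nonneg (by lia)]
      rw [Int.cast_natCast] at this
      simp [stepValue, this]
    · refine absurd ⟨?_, ?_⟩ h1
      · have : (1 : ℝ) < m := by exact_mod_cast hm
        exact mul_pos hh (by linarith)
      · simp only [mem_singleton_iff]
        intro h2
        have : (m : ℝ) = 1 := by
          field_simp at h2
          exact h2
        have : m = 1 := by exact_mod_cast this
        lia
  have hres : ν.restrict (range (stepValue h)) = ν := Measure.restrict_eq_self_of_ae_mem hrange
  set μ : Measure ℕ := (ν univ)⁻¹ • ν.comap (stepValue h) with hμ
  have hsing : ∀ k, μ {k} = (ν univ)⁻¹ * ν {stepValue h k} := fun k => by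
    rw [hμ, Measure.smul_apply, hemb.comap_apply, image_singleton, smul_eq_mul]
  refine ⟨ν.real univ, fun k => μ {k}, ?_, ?_, ?_, ?_, ?_⟩
  · exact ENNReal.toReal_pos hν0 hνt
  · have := lintegral_stepLaw (fun k => μ {k}) 1
    simp only [Pi.one_apply, mul_one, lintegral_one, stepLaw_eq] at this
    rw [← this, hμ, Measure.smul_apply, hemb.comap_apply, image_univ, smul_eq_mul,
      ← Measure.restrict_apply_univ (range _), hres, ENNReal.inv_mul_cancel hν0 hνt]
  · beta_reduce
    rw [hsing]
    refine mul_ne_zero (by simp [hνt]) fun h0 => ?_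
    have hres0 : ν.restrict (Ioi 0) = 0 := by
      rw [Measure.restrict_eq_zero]
      refine measure_mono_null (fun x hx => ?_) (measure_union_null hpos h0)
      by_cases hxh : x = h
      · exact .inr (by simp [stepValue, hxh])
      · exact .inl ⟨hx, hxh⟩
    have := hX.supp_pos
    rw [hres0, Measure.support_zero] at this
    exact singleton_ne_empty h this.symm
  · beta_reduce
    rw [hsing]
    simp [stepValue, hX.no_atom_zero]
  · rw [walkMeasure, stepLaw_eq, hμ, Measure.map_smul, smul_smul, Measure.real,
      ENNReal.ofReal_toReal hνt, ENNReal.mul_inv_cancel hν0 hνt, one_smul]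
    exact ((hemb.map_comap ν).trans hres).symm

end levyMeasure

/-! ### The Laplace exponent and its largest root -/

section root

variable {h lam : ℝ} {p : ℕ → ℝ≥0∞}

/-- The probability generating function of the drop codes. -/
noncomputable def pgf (p : ℕ → ℝ≥0∞) (y : ℝ) : ℝ := ∑' k, (p k).toReal * y ^ k

lemma integral_stepLaw (p : ℕ → ℝ≥0∞) {f : ℕ → ℝ} (hf : Integrable f (stepLaw p)) :
    ∫ k, f k ∂stepLaw p = ∑' k, (p k).toReal * f k := by
  rw [integral_countable hf]
  simp [Measure.real, stepLaw_singleton]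

lemma summable_pgf (hp : ∑' k, p k = 1) {y : ℝ} (hy : 0 ≤ y) (hy1 : y ≤ 1) :
    Summable fun k => (p k).toReal * y ^ k :=
  (summable_toReal_of_tsum_le_one hp.le).of_nonneg_of_le (fun k => by positivity) fun k =>
    mul_le_of_le_one_right ENNReal.toReal_nonneg (pow_le_one₀ hy hy1)

lemma continuousOn_pgf (hp : ∑' k, p k = 1) : ContinuousOn (pgf p) (Icc 0 1) := by
  refine continuousOn_tsum (fun k => by fun_prop) (summable_toReal_of_tsum_le_one hp.le) ?_
  intro k y hy
  rw [Real.norm_of_nonneg (mul_nonneg ENNReal.toReal_nonneg (pow_nonneg hy.1 k))]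
  exact mul_le_of_le_one_right ENNReal.toReal_nonneg (pow_le_one₀ hy.1 hy.2)

lemma pgf_zero (p : ℕ → ℝ≥0∞) : pgf p 0 = (p 0).toReal := by
  rw [pgf, tsum_eq_single 0 fun k hk => by simp [hk]]
  simp

lemma pgf_one (hp : ∑' k, p k = 1) : pgf p 1 = 1 := by
  simp only [pgf, one_pow, mul_one]
  rw [← ENNReal.tsum_toReal_eq (ne_top_of_tsum_le_one hp.le), hp, ENNReal.toReal_one]

/-- `r` is the smallest fixed point of the probability generating function in `[0, 1]`. -/
structure IsMinFixedPoint (p : ℕ → ℝ≥0∞) (r : ℝ) : Prop where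
  pos : 0 < r
  le_one : r ≤ 1
  eq : pgf p r = r
  lt : ∀ z, 0 < z → z < r → z < pgf p z

/-- Fixed points form a nonempty compact set, which contains `1`. The generating function starts at
`p 0 > 0`, so by the intermediate value theorem it stays above the diagonal before the least of
them. -/
lemma exists_isMinFixedPoint (hp : ∑' k, p k = 1) (hp0 : p 0 ≠ 0) : ∃ r, IsMinFixedPoint p r := by
  have hc := continuousOn_pgf hp
  have hp0' : 0 < pgf p 0 := by
    rw [pgf_zero]
    exact ENNReal.toReal_pos hp0 (ne_top_of_tsum_le_one hp.le 0)
  set S := Icc (0 : ℝ) 1 ∩ (fun y => pgf p y - y) ⁻¹' {0} with hS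
  have hScl : IsClosed S :=
    (hc.sub continuousOn_id).preimage_isClosed_of_isClosed isClosed_Icc isClosed_singleton
  have hScomp : IsCompact S := isCompact_Icc.of_isClosed_subset hScl inter_subset_left
  obtain ⟨r, hr, hmin⟩ := hScomp.exists_isLeast
    ⟨1, ⟨zero_le_one, le_rfl⟩, by simp [pgf_one hp]⟩
  have hfix : pgf p r = r := by
    have := hr.2
    simp only [mem_preimage, mem_singleton_iff] at this
    linarith
  have hr0 : 0 < r := hr.1.1.lt_of_ne fun h0 => by
    rw [← h0] at hfix
    exact hp0'.ne' hfix
  refine ⟨r, hr0, hr.1.2, hfix, fun z hz hzr => ?_⟩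
  by_contra! hle
  have hsub : Icc 0 z ⊆ Icc (0 : ℝ) 1 := Icc_subset_Icc_right (hzr.le.trans hr.1.2)
  obtain ⟨y, hy, hy0⟩ := intermediate_value_Icc' hz.le ((hc.sub continuousOn_id).mono hsub)
    (show (0 : ℝ) ∈ Icc (pgf p z - z) (pgf p 0 - 0) from ⟨by linarith, by linarith⟩)
  exact absurd (hmin ⟨hsub hy, hy0⟩) (not_le.2 (hy.2.trans_lt hzr))

lemma psi_walkMeasure (hl : 0 < lam) (hp : ∑' k, p k = 1) (hh : 0 < h) {β : ℝ} (hβ : 0 ≤ β) :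
    psi (walkMeasure h lam p) β =
      lam * (Real.exp (β * h) * pgf p (Real.exp (-(β * h))) - 1) := by
  have : Fact (∑' k, p k = 1) := ⟨hp⟩
  have hval : ∀ k : ℕ, Real.exp (β * (h * (1 - (k : ℝ)))) =
      Real.exp (β * h) * Real.exp (-(β * h)) ^ k := fun k => by
    rw [← Real.exp_nat_mul, ← Real.exp_add]
    ring_nf
  have hint : Integrable (fun k : ℕ => Real.exp (β * (h * (1 - (k : ℝ))))) (stepLaw p) := by
    refine Integrable.of_bound (measurable_of_countable _).aestronglyMeasurable
      (Real.exp (β * h)) (ae_of_all _ fun k => ?_)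
    rw [Real.norm_of_nonneg (Real.exp_pos _).le, Real.exp_le_exp]
    nlinarith [mul_nonneg (mul_nonneg hβ hh.le) (Nat.cast_nonneg (α := ℝ) k)]
  rw [psi, walkMeasure, integral_smul_measure,
    integral_map (measurable_of_countable _).aemeasurable (by fun_prop),
    integral_sub hint (integrable_const _), integral_stepLaw p hint,
    ENNReal.toReal_ofReal hl.le, smul_eq_mul]
  simp only [hval, pgf, ← tsum_mul_left]
  simp [mul_left_comm]

/-- The decreasing substitution `y = exp (-(β * h))` maps zeros of `psi` on `[0, ∞)` to fixed points
in `(0, 1]`, so the largest zero corresponds to the smallest fixed point. -/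
lemma Phi0_walkMeasure (hl : 0 < lam) (hp : ∑' k, p k = 1) (hh : 0 < h) {r : ℝ}
    (hr : IsMinFixedPoint p r) : Real.exp (Phi0 (walkMeasure h lam p) * h) = r⁻¹ := by
  have hroot : ∀ β, 0 ≤ β → (psi (walkMeasure h lam p) β = 0 ↔
      pgf p (Real.exp (-(β * h))) = Real.exp (-(β * h))) := fun β hβ => by
    rw [psi_walkMeasure hl hp hh hβ, mul_eq_zero, or_iff_right hl.ne', sub_eq_zero, Real.exp_neg,
      mul_comm, ← eq_div_iff (Real.exp_ne_zero _), one_div]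
  have hlog : Real.log r ≤ 0 := Real.log_nonpos hr.pos.le hr.le_one
  have hexp : -(-Real.log r / h * h) = Real.log r := by field_simp
  have hG : IsGreatest {β : ℝ | 0 ≤ β ∧ psi (walkMeasure h lam p) β = 0} (-Real.log r / h) := by
    have h0 : 0 ≤ -Real.log r / h := div_nonneg (by linarith) hh.le
    refine ⟨⟨h0, (hroot _ h0).2 ?_⟩, fun β hβ => ?_⟩
    · rw [hexp, Real.exp_log hr.pos, hr.eq]
    · by_contra! hlt
      have h1 := (hroot β hβ.1).1 hβ.2
      refine (hr.lt _ (Real.exp_pos _) ?_).ne' h1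
      rw [← Real.lt_log_iff_exp_lt hr.pos]
      rw [div_lt_iff₀ hh] at hlt
      linarith
  rw [Phi0, hG.csSup_eq, div_mul_cancel₀ _ hh.ne', Real.exp_neg, Real.exp_log hr.pos]

end root

/-! ### The laws of the ladder processes -/

section ladder

variable {Ω : Type*} [MeasurableSpace Ω] {X : ℝ≥0 → Ω → ℝ} {P : Measure Ω} {h lam r : ℝ}
  {p : ℕ → ℝ≥0∞}

lemma tsum_mul_ofReal_pow (hp : ∑' k, p k = 1) {y : ℝ} (hy : 0 ≤ y) (hy1 : y ≤ 1) :
    ∑' k, p k * ENNReal.ofReal y ^ k = ENNReal.ofReal (pgf p y) := by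
  rw [pgf, ENNReal.ofReal_tsum_of_nonneg (fun k => by positivity) (summable_pgf hp hy hy1)]
  refine tsum_congr fun k => ?_
  rw [ENNReal.ofReal_mul ENNReal.toReal_nonneg, ENNReal.ofReal_pow hy,
    ENNReal.ofReal_toReal (ne_top_of_tsum_le_one hp.le k)]

lemma IsMinFixedPoint.returnWeight_eq (hr : IsMinFixedPoint p r) (hp : ∑' k, p k = 1)
    (hp0 : p 0 ≠ 0) :
    (returnWeight p (fun _ _ => 1) fun d k => d - 1 + k).toReal = r := by
  rw [returnWeight_up (r := ENNReal.ofReal r) ?_ (fun y hy hy0 hfix => ?_) hp0,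
    ENNReal.toReal_ofReal hr.pos.le]
  · rw [tsum_mul_ofReal_pow hp hr.pos.le hr.le_one, hr.eq]
  · have hyt : y ≠ ⊤ := ne_top_of_le_ne_top ENNReal.ofReal_ne_top hy
    have hyr : y.toReal ≤ r := ENNReal.toReal_le_of_le_ofReal hr.pos.le hy
    have hypos : 0 < y.toReal := ENNReal.toReal_pos hy0 hyt
    rw [← ENNReal.ofReal_toReal hyt] at hfix ⊢
    rw [tsum_mul_ofReal_pow hp hypos.le (hyr.trans hr.le_one)] at hfix
    rcases hyr.lt_or_eq with hlt | heq
    · have h1 := hr.lt _ hypos hlt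
      exact absurd hfix ((ENNReal.ofReal_lt_ofReal_iff (hypos.trans h1)).2 h1).ne'
    · rw [heq]

lemma IsUpwardsSkipFreeLevyChain.isLatticeProcess {ν : Measure ℝ}
    (hX : IsUpwardsSkipFreeLevyChain h X P ν) (hlat : ∀ t ω, X t ω ∈ lattice h) :
    IsLatticeProcess h X where
  measurable := hX.measurable
  mem_lattice := hlat
  rightContinuous ω t := (hX.cadlag ω t).1

variable [IsProbabilityMeasure P]

/-- `X` has the law of the model with the same Lévy measure, where the record chain has return
probability `r`. -/
lemma IsUpwardsSkipFreeLevyChain.measure_strictAsc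
    (hX : IsUpwardsSkipFreeLevyChain h X P (walkMeasure h lam p))
    (hlat : ∀ t ω, X t ω ∈ lattice h) (hh : 0 < h) (hl : 0 < lam) (hp : ∑' k, p k = 1)
    (hp0 : p 0 ≠ 0) (hp1 : p 1 = 0) (hr : IsMinFixedPoint p r) (t : ℝ≥0) :
    P {ω | strictAscLadderHeight X t ω ≠ ⊤} =
      ENNReal.ofReal (Real.exp (-(lam * (1 - r) * t))) := by
  have := Fact.mk hl
  have := Fact.mk hp
  have hW := isUpwardsSkipFreeLevyChain_walkPath hh hp0 hp1 (lam := lam)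
  have hW' := hW.isLatticeProcess walkPath_mem_lattice
  rw [(hX.isLatticeProcess hlat).measure_strictAsc_congr hh hW'
    (hX.toIsCompoundPoisson.map_eq_map hW.toIsCompoundPoisson)]
  have h1 := lintegral_strictAsc_walkPath (lam := lam) hh hp1 t
  rw [hr.returnWeight_eq hp hp0] at h1
  rw [← h1, ← lintegral_indicator_one (hW'.measurableSet_strictAsc hh t)]
  refine lintegral_congr fun ω => ?_
  simp [indicator]

/-- The same transfer to the model. The last factor `r` comes from the normalization of the local
time by `exp (Φ(0) h) = r⁻¹`. -/
lemma IsUpwardsSkipFreeLevyChain.integral_desc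
    (hX : IsUpwardsSkipFreeLevyChain h X P (walkMeasure h lam p))
    (hlat : ∀ t ω, X t ω ∈ lattice h) (hh : 0 < h) (hl : 0 < lam) (hp : ∑' k, p k = 1)
    (hp0 : p 0 ≠ 0) (hp1 : p 1 = 0) (hr : IsMinFixedPoint p r) {β : ℝ} (hβ : 0 ≤ β) :
    ∫ ω, (if descLadderHeight h (walkMeasure h lam p) X 1 ω = ⊤ then 0 else
      Real.exp (-(β * (descLadderHeight h (walkMeasure h lam p) X 1 ω).toReal))) ∂P =
      Real.exp (-(lam * (1 - (returnWeight p (downWeight (Real.exp (-(β * h))))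
        fun d k => d + 1 - k).toReal) * r)) := by
  have := Fact.mk hl
  have := Fact.mk hp
  have hW := isUpwardsSkipFreeLevyChain_walkPath hh hp0 hp1 (lam := lam)
  have hW' := hW.isLatticeProcess walkPath_mem_lattice
  rw [(hX.isLatticeProcess hlat).integral_desc_congr hh hW'
      (hX.toIsCompoundPoisson.map_eq_map hW.toIsCompoundPoisson),
    integral_eq_lintegral_of_nonneg_ae (ae_of_all _ fun ω => ?_)
      (hW'.measurable_descLadder hh _ 1 β).aestronglyMeasurable]
  · have h1 := lintegral_desc_walkPath (lam := lam) hh (inv_pos.2 hr.pos) hp1 hβ 1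
    rw [inv_inv, NNReal.coe_one, one_mul] at h1
    unfold descLadderHeight localTimeMin
    rw [Phi0_walkMeasure hl hp hh hr, h1, ENNReal.toReal_ofReal (Real.exp_pos _).le]
  · dsimp only [Pi.zero_apply]
    split_ifs
    · exact le_rfl
    · exact (Real.exp_pos _).le

end ladder

/-! ### The Wiener–Hopf factorization in terms of generating functions -/

section factorization

variable {lam r : ℝ} {p : ℕ → ℝ≥0∞}

lemma IsMinFixedPoint.tendsto_returnWeight (hr : IsMinFixedPoint p r) (hp : ∑' k, p k = 1) {s : ℝ}
    (hs : 0 < s) (hs1 : s ≤ 1) :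
    Tendsto (fun z => (pgf p s - pgf p z) / (s - z)) (𝓝[<] r)
      (𝓝 (returnWeight p (downWeight s) fun d k => d + 1 - k).toReal) :=
  tendsto_returnWeight_down hp hs hs1 hr.pos hr.le_one hr.eq hr.lt

lemma IsMinFixedPoint.Ioo_mem (hr : IsMinFixedPoint p r) : Ioo 0 r ∈ 𝓝[<] r :=
  Ioo_mem_nhdsLT hr.pos

lemma IsMinFixedPoint.le_nhdsWithin (hr : IsMinFixedPoint p r) : 𝓝[<] r ≤ 𝓝[Icc 0 1] r := by
  refine le_inf (nhdsWithin_le_nhds) (le_principal_iff.2 (mem_of_superset hr.Ioo_mem ?_))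
  exact fun z hz => ⟨hz.1.le, hz.2.le.trans hr.le_one⟩

lemma IsMinFixedPoint.returnWeight_down_eq (hr : IsMinFixedPoint p r) (hp : ∑' k, p k = 1) {s : ℝ}
    (hs : 0 < s) (hs1 : s ≤ 1) (hsr : s ≠ r) :
    (returnWeight p (downWeight s) fun d k => d + 1 - k).toReal = (pgf p s - r) / (s - r) := by
  refine tendsto_nhds_unique (hr.tendsto_returnWeight hp hs hs1) ?_
  have h1 : Tendsto (pgf p) (𝓝[<] r) (𝓝 r) := by
    have := continuousOn_pgf hp r ⟨hr.pos.le, hr.le_one⟩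
    rw [ContinuousWithinAt, hr.eq] at this
    exact this.mono_left hr.le_nhdsWithin
  have h2 : Tendsto (fun z : ℝ => z) (𝓝[<] r) (𝓝 r) := nhdsWithin_le_nhds
  exact (h1.const_sub _).div (h2.const_sub _) (sub_ne_zero.2 hsr)

/-- A factorization of the generating function determines the descending ladder exponent. -/
lemma IsMinFixedPoint.lam_mul_one_sub_eq (hr : IsMinFixedPoint p r) (hp : ∑' k, p k = 1)
    (hl : lam ≠ 0) {Λ : ℝ → ℝ} (hΛ : ContinuousOn Λ (Icc 0 1))
    (hfac : ∀ y, 0 ≤ y → y ≤ 1 → lam * (pgf p y - y) = (1 - r⁻¹ * y) * Λ y) {s : ℝ}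
    (hs : 0 < s) (hs1 : s ≤ 1) :
    lam * (1 - (returnWeight p (downWeight s) fun d k => d + 1 - k).toReal) * r = Λ s := by
  have hr0 := hr.pos.ne'
  rcases eq_or_ne s r with rfl | hsr
  -- At `s = r` the quotient is of the form 0/0; the factorization makes it explicit for `z < r`,
  -- and continuity of `Λ` gives the limit, without any derivative of the generating function.
  · have h1 : Tendsto (fun z => (pgf p s - pgf p z) / (s - z)) (𝓝[<] s)
        (𝓝 (1 - Λ s / (lam * s))) := by
      have h2 : Tendsto Λ (𝓝[<] s) (𝓝 (Λ s)) :=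
        (hΛ s ⟨hs.le, hs1⟩).tendsto.mono_left hr.le_nhdsWithin
      refine ((h2.div_const _).const_sub 1).congr' ?_
      filter_upwards [hr.Ioo_mem] with z hz
      have h3 : pgf p z = z + (1 - s⁻¹ * z) * Λ z / lam := by
        rw [← hfac z hz.1.le (hz.2.le.trans hs1)]
        field_simp
        ring
      have h4 : s - z ≠ 0 := (sub_pos.2 hz.2).ne'
      rw [hr.eq, h3]
      field_simp
      ring
    rw [tendsto_nhds_unique (hr.tendsto_returnWeight hp hs hs1) h1]
    field_simp
    ring
  · have h1 := hfac s hs.le hs1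
    have h2 : pgf p s = s + (1 - r⁻¹ * s) * Λ s / lam := by
      rw [← h1]
      field_simp
      ring
    have h3 : s - r ≠ 0 := sub_ne_zero.2 hsr
    rw [hr.returnWeight_down_eq hp hs hs1 hsr, h2]
    field_simp
    ring

/-- The descending ladder exponent factorizes the generating function. -/
lemma IsMinFixedPoint.factorization (hr : IsMinFixedPoint p r) (hp : ∑' k, p k = 1) {s Λ : ℝ}
    (hs : 0 < s) (hs1 : s ≤ 1)
    (hΛ : lam * (1 - (returnWeight p (downWeight s) fun d k => d + 1 - k).toReal) * r = Λ) :
    lam * (pgf p s - s) = (1 - r⁻¹ * s) * Λ := by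
  have hr0 := hr.pos.ne'
  rcases eq_or_ne s r with rfl | hsr
  · rw [hr.eq, inv_mul_cancel₀ hr0]
    ring
  · have h3 : s - r ≠ 0 := sub_ne_zero.2 hsr
    rw [← hΛ, hr.returnWeight_down_eq hp hs hs1 hsr]
    field_simp
    ring

end factorization

/-! ### The coefficients of the Lévy measure -/

section coefficients

/-- The constant coefficient is the limit as `s → 0+`; dividing by `s` shifts the series and yields
the next one. -/
lemma eq_zero_of_tsum_mul_pow_eq_zero (n : ℕ) : ∀ {c : ℕ → ℝ}, Summable (fun k => |c k|) →
    (∀ s, 0 < s → s < 1 → ∑' k, c k * s ^ k = 0) → c n = 0 := by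
  have hzero : ∀ {c : ℕ → ℝ}, Summable (fun k => |c k|) →
      (∀ s, 0 < s → s < 1 → ∑' k, c k * s ^ k = 0) → c 0 = 0 := by
    intro c hc h0
    have hcont : ContinuousOn (fun s : ℝ => ∑' k, c k * s ^ k) (Icc 0 1) := by
      refine continuousOn_tsum (fun k => by fun_prop) hc fun k s hs => ?_
      rw [norm_mul, norm_pow, Real.norm_of_nonneg hs.1, Real.norm_eq_abs]
      exact mul_le_of_le_one_right (abs_nonneg _) (pow_le_one₀ hs.1 hs.2)
    have h1 : Tendsto (fun s : ℝ => ∑' k, c k * s ^ k) (𝓝[>] 0) (𝓝 (∑' k, c k * 0 ^ k)) :=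
      (hcont 0 ⟨le_rfl, zero_le_one⟩).tendsto.mono_left (le_inf nhdsWithin_le_nhds
        (le_principal_iff.2 (mem_of_superset (Ioo_mem_nhdsGT zero_lt_one) Ioo_subset_Icc_self)))
    have h2 : Tendsto (fun s : ℝ => ∑' k, c k * s ^ k) (𝓝[>] 0) (𝓝 0) := by
      refine tendsto_const_nhds.congr' ?_
      filter_upwards [Ioo_mem_nhdsGT zero_lt_one] with s hs
      exact (h0 s hs.1 hs.2).symm
    have h3 := tendsto_nhds_unique h1 h2
    rwa [tsum_eq_single 0 fun k hk => by simp [hk], pow_zero, mul_one] at h3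
  induction n with
  | zero => exact hzero
  | succ n ih =>
    intro c hc h0
    refine ih (c := fun k => c (k + 1)) ((summable_nat_add_iff 1).2 hc) fun s hs hs1 => ?_
    have hsum : Summable fun k => c k * s ^ k := by
      refine hc.of_norm_bounded fun k => ?_
      rw [norm_mul, norm_pow, Real.norm_of_nonneg hs.le, Real.norm_eq_abs]
      exact mul_le_of_le_one_right (abs_nonneg _) (pow_le_one₀ hs.le hs1.le)
    have h1 := h0 s hs hs1
    rw [hsum.tsum_eq_zero_add, hzero hc h0, zero_mul, zero_add] at h1
    have h2 : ∑' k, c (k + 1) * s ^ (k + 1) = s * ∑' k, c (k + 1) * s ^ k := by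
      rw [← tsum_mul_left]
      exact tsum_congr fun k => by ring
    rw [h2, mul_eq_zero, or_iff_right hs.ne'] at h1
    exact h1

variable {q x : ℝ} {φ : ℕ+ → ℝ}

/-- The weights of the Lévy measure of the parent process, indexed by drop codes. -/
noncomputable def levyCoeff (q : ℝ) (φ : ℕ+ → ℝ) (x : ℝ) : ℕ → ℝ
  | 0 => q + ∑' k, φ k
  | 1 => 0
  | n + 2 => x * φ n.succPNat - φ (n + 1).succPNat

/-- The descending ladder exponent as a function of `s = exp (-β h)`. -/
noncomputable def ladderExponent (q : ℝ) (φ : ℕ+ → ℝ) (s : ℝ) : ℝ :=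
  q + ∑' k : ℕ+, φ k * (1 - s ^ (k : ℕ))

lemma summable_mul_pow (hφ : ∀ k, 0 ≤ φ k) (hsum : Summable φ) {s : ℝ} (hs : 0 ≤ s)
    (hs1 : s ≤ 1) : Summable fun k : ℕ+ => φ k * s ^ (k : ℕ) :=
  hsum.of_nonneg_of_le (fun k => mul_nonneg (hφ k) (pow_nonneg hs _)) fun k =>
    mul_le_of_le_one_right (hφ k) (pow_le_one₀ hs hs1)

lemma ladderExponent_eq (hφ : ∀ k, 0 ≤ φ k) (hsum : Summable φ) {s : ℝ} (hs : 0 ≤ s)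
    (hs1 : s ≤ 1) :
    ladderExponent q φ s = q + ∑' k, φ k - ∑' k : ℕ+, φ k * s ^ (k : ℕ) := by
  simp only [ladderExponent, mul_sub, mul_one]
  rw [hsum.tsum_sub (summable_mul_pow hφ hsum hs hs1)]
  ring

lemma ladderExponent_one : ladderExponent q φ 1 = q := by
  simp [ladderExponent]

lemma continuousOn_ladderExponent (hφ : ∀ k, 0 ≤ φ k) (hsum : Summable φ) :
    ContinuousOn (ladderExponent q φ) (Icc 0 1) := by
  refine continuousOn_const.add (continuousOn_tsum (fun k => by fun_prop) hsum fun k s hs => ?_)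
  have h1 := pow_le_one₀ (n := k) hs.1 hs.2
  have h2 := pow_nonneg hs.1 (k : ℕ)
  rw [norm_mul, Real.norm_of_nonneg (hφ k), Real.norm_of_nonneg (by linarith)]
  exact mul_le_of_le_one_right (hφ k) (by linarith)

/-- As `s ^ k ≤ s` for `k ≥ 1`, the exponent is at least `(1 - s)` times `q + ∑' k, φ k`. -/
lemma ladderExponent_pos (hq : 0 ≤ q) (hφ : ∀ k, 0 ≤ φ k) (hsum : Summable φ)
    (hpos : 0 < q + ∑' k, φ k) {s : ℝ} (hs : 0 ≤ s) (hs1 : s < 1) : 0 < ladderExponent q φ s := by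
  have h1 : ∑' k : ℕ+, φ k * s ^ (k : ℕ) ≤ s * ∑' k, φ k := by
    rw [← tsum_mul_left]
    refine (summable_mul_pow hφ hsum hs hs1.le).tsum_le_tsum (fun k => ?_) (hsum.mul_left s)
    rw [mul_comm]
    exact mul_le_mul_of_nonneg_right (pow_le_of_le_one hs hs1.le k.ne_zero) (hφ k)
  rw [ladderExponent_eq hφ hsum hs hs1.le]
  nlinarith [mul_pos (sub_pos.2 hs1) hpos]

/-- The Wiener–Hopf identity as a power series. Multiplying out `(1 - x s) Λ(s)` produces the Lévy
coefficients together with a term linear in `s`; the first summand on the right removes that term,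
since there are no void moves. -/
lemma hasSum_levyCoeff (hφ : ∀ k, 0 ≤ φ k) (hsum : Summable φ) (x : ℝ) {s : ℝ} (hs : 0 ≤ s)
    (hs1 : s ≤ 1) : HasSum (fun n => levyCoeff q φ x n * s ^ n)
      ((x * (q + ∑' k, φ k) + φ 1) * s + (1 - x * s) * ladderExponent q φ s) := by
  set S := ∑' k : ℕ+, φ k * s ^ (k : ℕ) with hS
  have h1 : HasSum (fun n : ℕ => φ n.succPNat * s ^ (n + 1)) S :=
    (Equiv.pnatEquivNat.symm.hasSum_iff).2 (summable_mul_pow hφ hsum hs hs1).hasSum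
  have h2 : HasSum (fun n : ℕ => φ (n + 1).succPNat * s ^ (n + 2)) (S - φ 1 * s) := by
    have := (hasSum_nat_add_iff' 1).2 h1
    simpa [show Nat.succPNat 0 = 1 from rfl] using this
  have h3 : HasSum (fun n => levyCoeff q φ x (n + 2) * s ^ (n + 2))
      (x * s * S - (S - φ 1 * s)) := by
    have heq : (fun n => levyCoeff q φ x (n + 2) * s ^ (n + 2)) = fun n : ℕ =>
        x * s * (φ n.succPNat * s ^ (n + 1)) - φ (n + 1).succPNat * s ^ (n + 2) := by
      ext n
      rw [levyCoeff]
      ring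
    rw [heq]
    exact (h1.mul_left (x * s)).sub h2
  have h4 := (hasSum_nat_add_iff (f := fun n => levyCoeff q φ x n * s ^ n) 2).1 h3
  have h5 : (x * (q + ∑' k, φ k) + φ 1) * s + (1 - x * s) * ladderExponent q φ s =
      x * s * S - (S - φ 1 * s) + ∑ i ∈ Finset.range 2, levyCoeff q φ x i * s ^ i := by
    rw [ladderExponent_eq hφ hsum hs hs1, ← hS, Finset.sum_range_succ, Finset.sum_range_one,
      levyCoeff, levyCoeff]
    ring
  rw [h5]
  exact h4

lemma walkMeasure_eq_parentLevyMeasure {h lam : ℝ} {p : ℕ → ℝ≥0∞} (hl : 0 < lam)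
    (hp : ∑' k, p k = 1) (hco : ∀ n, lam * (p n).toReal = levyCoeff q φ x n) :
    walkMeasure h lam p = parentLevyMeasure h q φ x := by
  have hmul : ∀ n, ENNReal.ofReal lam * p n = ENNReal.ofReal (levyCoeff q φ x n) := fun n => by
    rw [← hco, ENNReal.ofReal_mul hl.le, ENNReal.ofReal_toReal (ne_top_of_tsum_le_one hp.le n)]
  ext A hA
  rw [walkMeasure_apply hA, ← ENNReal.tsum_mul_left, parentLevyMeasure, Measure.add_apply,
    Measure.sum_apply _ hA, ← Equiv.pnatEquivNat.symm.tsum_eq, tsum_eq_zero_add' ENNReal.summable,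
    tsum_eq_zero_add' ENNReal.summable, add_comm]
  simp_rw [← mul_assoc, hmul]
  congr 1
  · simp only [levyCoeff, zero_add, ENNReal.ofReal_zero, zero_mul]
    refine tsum_congr fun n => ?_
    rw [Measure.smul_apply, smul_eq_mul, Measure.dirac_apply' _ hA]
    congr 2
    simp only [stepValue, Equiv.pnatEquivNat_symm_apply, Nat.succPNat_coe]
    push_cast
    ring
  · simp [levyCoeff, stepValue, Measure.dirac_apply' _ hA]

end coefficients

/-! ### Parent processes -/

section parent

variable {h γ q x : ℝ} {φ : ℕ+ → ℝ}

/-- Needed to lift the model to a sample space in an arbitrary universe. -/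
lemma IsUpwardsSkipFreeLevyChain.comp {Ω Ω' : Type*} [MeasurableSpace Ω] [MeasurableSpace Ω']
    {P : Measure Ω} [IsProbabilityMeasure P] {f : Ω → Ω'} (hf : Measurable f) {X : ℝ≥0 → Ω' → ℝ}
    {ν : Measure ℝ} (hX : IsUpwardsSkipFreeLevyChain h X (P.map f) ν) :
    IsUpwardsSkipFreeLevyChain h (fun t ω => X t (f ω)) P ν where
  measurable t := (hX.measurable t).comp hf
  cadlag ω := hX.cadlag (f ω)
  zero := ae_of_ae_map hf.aemeasurable hX.zero
  indep n t ht := by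
    have := Measure.isProbabilityMeasure_map (μ := P) hf.aemeasurable
    have hm : ∀ i : Fin n, Measurable fun ω => X (t i.succ) ω - X (t i.castSucc) ω := fun i =>
      (hX.measurable _).sub (hX.measurable _)
    have h1 := (iIndepFun_iff_map_fun_eq_pi_map fun i => (hm i).aemeasurable).1 (hX.indep n t ht)
    rw [Measure.map_map (measurable_pi_lambda _ hm) hf] at h1
    simp_rw [Measure.map_map (hm _) hf] at h1
    exact (iIndepFun_iff_map_fun_eq_pi_map fun i => ((hm i).comp hf).aemeasurable).2 h1
  stationary s t := by
    have hm : Measurable fun ω => X (s + t) ω - X s ω := (hX.measurable _).sub (hX.measurable _)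
    have h1 := (hX.stationary s t).map_eq
    rw [Measure.map_map hm hf, Measure.map_map (hX.measurable t) hf] at h1
    exact ⟨(hm.comp hf).aemeasurable, ((hX.measurable t).comp hf).aemeasurable, h1⟩
  finite := hX.finite
  ne_zero := hX.ne_zero
  no_atom_zero := hX.no_atom_zero
  charFun_eq t p := by
    rw [← hX.charFun_eq t p, Measure.map_map (hX.measurable t) hf]
    rfl
  supp_lattice := hX.supp_lattice
  supp_pos := hX.supp_pos

/-- The right side of the equation is strictly increasing in `x > 1` unless its second factor
vanishes, which would force `γ = 0`. -/
lemma IsRatio.eq (hφ : ∀ k, 0 ≤ φ k) {x y : ℝ} (hx : IsRatio γ φ x) (hy : IsRatio γ φ y) :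
    x = y := by
  by_cases hγ : γ = 0
  · rw [hx.1 hγ, hy.1 hγ]
  obtain ⟨hx1, hxe⟩ := hx.2 hγ
  obtain ⟨hy1, hye⟩ := hy.2 hγ
  have hS : 0 ≤ ∑' k, φ k := tsum_nonneg hφ
  have key : ∀ {x y : ℝ}, 1 < x → x < y → γ = (1 - 1 / x) * (φ 1 + x * ∑' k, φ k) →
      γ ≠ (1 - 1 / y) * (φ 1 + y * ∑' k, φ k) := by
    intro x y hx hxy h1 h2
    have hinv : 1 / y < 1 / x := one_div_lt_one_div_of_lt (by linarith) hxy
    have hinv1 : 1 / x < 1 := (div_lt_one (by linarith)).2 hx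
    have hle : φ 1 + x * ∑' k, φ k ≤ φ 1 + y * ∑' k, φ k := by nlinarith
    have h0 : 0 ≤ φ 1 + x * ∑' k, φ k :=
      add_nonneg (hφ 1) (mul_nonneg (by linarith) hS)
    rcases h0.lt_or_eq with h0 | h0
    · nlinarith
    · exact hγ (by rw [h1, ← h0, mul_zero])
  rcases lt_trichotomy x y with hxy | hxy | hxy
  · exact absurd hye (key hx1 hxy hxe)
  · exact hxy
  · exact absurd hxe (key hy1 hxy hye)

lemma laplaceExponent_eq_ladderExponent (β : ℝ) :
    q + ∑' k : ℕ+, φ k * (1 - Real.exp (-(β * (k : ℝ) * h))) =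
      ladderExponent q φ (Real.exp (-(β * h))) := by
  unfold ladderExponent
  congr 1
  refine tsum_congr fun k => ?_
  rw [← Real.exp_nat_mul]
  ring_nf

/-- Necessity: both ladder laws are expressed through `lam`, `p` and `r`, and the coefficients of
the Wiener–Hopf identity are compared. -/
lemma IsParentProcess.conditions {Ω : Type*} [MeasurableSpace Ω] {P : Measure Ω}
    [IsProbabilityMeasure P] {X : ℝ≥0 → Ω → ℝ} {ν : Measure ℝ} (hh : 0 < h)
    (hφ : ∀ k, 0 ≤ φ k) (hsum : Summable φ) (hX : IsParentProcess h γ q φ X P ν) :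
    γ * q = 0 ∧ IsRatio γ φ (Real.exp (Phi0 ν * h)) ∧
      (∀ k, 0 ≤ Real.exp (Phi0 ν * h) * φ k - φ (k + 1)) ∧
      ν = parentLevyMeasure h q φ (Real.exp (Phi0 ν * h)) := by
  obtain ⟨lam, p, hl, hp, hp0, hp1, rfl⟩ := hX.chain.exists_eq_walkMeasure hh
  obtain ⟨r, hr⟩ := exists_isMinFixedPoint hp hp0
  rw [Phi0_walkMeasure hl hp hh hr]
  have hr0 := hr.pos
  have hγ : γ = lam * (1 - r) := by
    have h1 := hX.chain.measure_strictAsc hX.mem_lattice hh hl hp hp0 hp1 hr 1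
    rw [hX.killing 1, ENNReal.ofReal_eq_ofReal_iff (Real.exp_pos _).le (Real.exp_pos _).le,
      Real.exp_eq_exp] at h1
    simpa using h1
  have hfac : ∀ s, 0 < s → s ≤ 1 →
      lam * (pgf p s - s) = (1 - r⁻¹ * s) * ladderExponent q φ s := by
    intro s hs hs1
    refine hr.factorization hp hs hs1 ?_
    -- Every `s` in `(0, 1]` is `exp (-(β * h))` for this `β ≥ 0`.
    have hβ : 0 ≤ -Real.log s / h := div_nonneg (neg_nonneg.2 (Real.log_nonpos hs.le hs1)) hh.le
    have h1 := hX.chain.integral_desc hX.mem_lattice hh hl hp hp0 hp1 hr hβ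
    rw [hX.laplace _ hβ] at h1
    beta_reduce at h1
    rw [laplaceExponent_eq_ladderExponent, Real.exp_eq_exp, neg_inj,
      div_mul_cancel₀ _ hh.ne', neg_neg, Real.exp_log hs] at h1
    exact h1.symm
  set x := r⁻¹ with hx
  have hqx : (1 - x) * q = 0 := by
    have := hfac 1 zero_lt_one le_rfl
    rw [pgf_one hp, sub_self, mul_zero, ladderExponent_one, mul_one] at this
    exact this.symm
  set c := q + ∑' k, φ k with hc
  -- The possible discrepancy between `lam` and its expected value affects only the coefficient of
  -- order one, where `p 1 = 0` then forces it to vanish.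
  set δ := lam - (x * c + φ 1) with hδ
  have hz : ∀ n, lam * (p n).toReal - levyCoeff q φ x n - (if n = 1 then δ else 0) = 0 := by
    have hs3 : Summable fun n : ℕ => |if n = 1 then δ else 0| :=
      summable_of_ne_finset_zero (s := {1}) fun n hn => by simp_all
    have hs1 := (summable_toReal_of_tsum_le_one hp.le).mul_left lam
    have hs2 : Summable (levyCoeff q φ x) := by
      simpa using (hasSum_levyCoeff (q := q) hφ hsum x zero_le_one le_rfl).summable
    refine fun n => eq_zero_of_tsum_mul_pow_eq_zero n
      (c := fun n => lam * (p n).toReal - levyCoeff q φ x n - (if n = 1 then δ else 0))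
      ((hs1.sub hs2).sub (summable_abs_iff.1 hs3)).abs fun s hs hs1 => ?_
    have e1 := (summable_pgf hp hs.le hs1.le).hasSum.mul_left lam
    have e2 := hasSum_levyCoeff (q := q) hφ hsum x hs.le hs1.le
    have e3 : HasSum (fun n : ℕ => (if n = 1 then δ else 0) * s ^ n) (δ * s) := by
      convert hasSum_single 1 fun n hn => ?_ using 1
      · simp
      · simp [hn]
    have e4 := ((e1.sub e2).sub e3).tsum_eq
    calc _ = ∑' n, (lam * ((p n).toReal * s ^ n) - levyCoeff q φ x n * s ^ n -
          (if n = 1 then δ else 0) * s ^ n) := tsum_congr fun n => by ring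
      _ = _ := e4
      _ = 0 := by
        have := hfac s hs hs1.le
        change lam * pgf p s - _ - _ = 0
        rw [hδ]
        linear_combination this
  have hlam : lam = x * c + φ 1 := by
    have := hz 1
    simp only [hp1, ENNReal.toReal_zero, mul_zero, levyCoeff, if_true] at this
    linarith
  have hco : ∀ n, lam * (p n).toReal = levyCoeff q φ x n := fun n => by
    have := hz n
    rw [show δ = 0 by rw [hδ, hlam, sub_self], ite_self] at this
    linarith
  have hxr : x * r = 1 := inv_mul_cancel₀ hr0.ne'
  refine ⟨?_, ⟨fun h0 => ?_, fun h0 => ?_⟩, fun k => ?_,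
    walkMeasure_eq_parentLevyMeasure hl hp hco⟩
  · have : γ = -(lam * r * (1 - x)) := by
      rw [hγ]
      linear_combination -lam * hxr
    rw [this]
    linear_combination -(lam * r) * hqx
  · rw [hγ, mul_eq_zero, or_iff_right hl.ne'] at h0
    rw [hx, ← sub_eq_zero.1 h0, inv_one]
  · have hr1 : r < 1 := hr.le_one.lt_of_ne fun h1 => h0 (by rw [hγ, h1, sub_self, mul_zero])
    have hx1 : 1 < x := (one_lt_inv₀ hr0).2 hr1
    have hq0 : q = 0 := by
      rcases mul_eq_zero.1 hqx with h1 | h1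
      · linarith
      · exact h1
    refine ⟨hx1, ?_⟩
    rw [hγ, hlam, hc, hq0, hx, one_div, inv_inv]
    ring
  · have h1 := hco (k.natPred + 2)
    rw [levyCoeff, PNat.succPNat_natPred] at h1
    have h2 : (k.natPred + 1).succPNat = k + 1 := by
      rw [← PNat.coe_inj, Nat.succPNat_coe, PNat.natPred_add_one, PNat.add_coe, PNat.one_coe]
    rw [← h2, ← h1]
    positivity

/-- Sufficiency: the coefficients prescribed by the Wiener–Hopf identity define the step law of a
model, to which the computed ladder laws apply. -/
lemma exists_isParentProcess (hh : 0 < h) (hq : 0 ≤ q) (hφ : ∀ k, 0 ≤ φ k) (hsum : Summable φ)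
    (hpos : 0 < q + ∑' k, φ k) (hγq : γ * q = 0) (hx : IsRatio γ φ x)
    (hco : ∀ k, 0 ≤ x * φ k - φ (k + 1)) :
    ∃ (Ω : Type u) (_ : MeasurableSpace Ω) (P : Measure Ω) (_ : IsProbabilityMeasure P)
      (X : ℝ≥0 → Ω → ℝ) (ν : Measure ℝ), IsParentProcess h γ q φ X P ν := by
  have hx1 : 1 ≤ x := by
    by_cases hγ : γ = 0
    · exact (hx.1 hγ).ge
    · exact (hx.2 hγ).1.le
  have hx0 : 0 < x := zero_lt_one.trans_le hx1
  have hqx : (1 - x) * q = 0 := by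
    rcases mul_eq_zero.1 hγq with h0 | h0
    · rw [hx.1 h0, sub_self, zero_mul]
    · rw [h0, mul_zero]
  set lam := x * (q + ∑' k, φ k) + φ 1 with hlam
  have hl : 0 < lam := add_pos_of_pos_of_nonneg (mul_pos hx0 hpos) (hφ 1)
  have hγ : lam * (1 - x⁻¹) = γ := by
    by_cases h0 : γ = 0
    · rw [hx.1 h0, inv_one, sub_self, mul_zero, h0]
    · have hq0 : q = 0 := (mul_eq_zero.1 hγq).resolve_left h0
      rw [(hx.2 h0).2, hlam, hq0, one_div]
      ring
  have hnn : ∀ n, 0 ≤ levyCoeff q φ x n := by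
    intro n
    match n with
    | 0 => exact hpos.le
    | 1 => exact le_rfl
    | n + 2 => exact hco n.succPNat
  set p : ℕ → ℝ≥0∞ := fun n => ENNReal.ofReal (levyCoeff q φ x n / lam) with hpdef
  have hpn : ∀ n, (p n).toReal = levyCoeff q φ x n / lam := fun n =>
    ENNReal.toReal_ofReal (div_nonneg (hnn n) hl.le)
  have hp : ∑' k, p k = 1 := by
    have h1 := (hasSum_levyCoeff (q := q) hφ hsum x zero_le_one le_rfl).div_const lam
    -- At `s = 1` the coefficients sum to `lam + (1 - x) * q`; the second term vanishes by `γ * q =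
    -- 0`.
    simp only [one_pow, mul_one, ladderExponent_one, ← hlam] at h1
    rw [hpdef, ← ENNReal.ofReal_tsum_of_nonneg (fun n => div_nonneg (hnn n) hl.le) h1.summable,
      h1.tsum_eq, hqx, add_zero, div_self hl.ne', ENNReal.ofReal_one]
  have hp0 : p 0 ≠ 0 := by
    rw [hpdef, ENNReal.ofReal_ne_zero_iff]
    exact div_pos hpos hl
  have hp1 : p 1 = 0 := by simp [hpdef, levyCoeff]
  have hfac : ∀ y, 0 ≤ y → y ≤ 1 →
      lam * (pgf p y - y) = (1 - x⁻¹⁻¹ * y) * ladderExponent q φ y := by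
    intro y hy hy1
    have h1 := (hasSum_levyCoeff (q := q) hφ hsum x hy hy1).div_const lam
    have h2 : pgf p y = (lam * y + (1 - x * y) * ladderExponent q φ y) / lam := by
      rw [← h1.tsum_eq, pgf]
      exact tsum_congr fun n => by rw [hpn, div_mul_eq_mul_div]
    rw [h2, inv_inv]
    field_simp
    ring
  -- Below `x⁻¹` both factors of the factorization are positive, so no smaller fixed point exists.
  have hr : IsMinFixedPoint p x⁻¹ := by
    have hxi : x⁻¹ ≤ 1 := inv_le_one_of_one_le₀ hx1
    refine ⟨inv_pos.2 hx0, hxi, ?_, fun z hz hzx => ?_⟩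
    · have := hfac x⁻¹ (inv_pos.2 hx0).le hxi
      rw [inv_mul_cancel₀ (inv_pos.2 hx0).ne', sub_self, zero_mul, mul_eq_zero,
        or_iff_right hl.ne'] at this
      linarith
    · have h1 := hfac z hz.le (hzx.le.trans hxi)
      have h2 := ladderExponent_pos hq hφ hsum hpos hz.le (hzx.trans_le hxi)
      have h3 : 0 < 1 - x⁻¹⁻¹ * z := by
        rw [inv_inv, sub_pos, mul_comm, ← lt_div_iff₀ hx0, one_div]
        exact hzx
      have h4 : 0 < lam * (pgf p z - z) := h1 ▸ mul_pos h3 h2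
      linarith [(mul_pos_iff_of_pos_left hl).1 h4]
  have := Fact.mk hl
  have := Fact.mk hp
  have hW := isUpwardsSkipFreeLevyChain_walkPath hh hp0 hp1 (lam := lam)
  have hup : Measurable (ULift.up : (ℕ → ℝ≥0 × ℕ) → ULift.{u} (ℕ → ℝ≥0 × ℕ)) := measurable_up
  have hPu := Measure.isProbabilityMeasure_map (μ := seqLaw lam p) hup.aemeasurable
  have hdown : ((seqLaw lam p).map ULift.up).map (ULift.down.{u}) = seqLaw lam p := by
    rw [Measure.map_map measurable_down hup]
    exact Measure.map_id
  rw [← hdown] at hW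
  have hU := hW.comp (P := (seqLaw lam p).map (ULift.up.{u})) measurable_down
  have hlat : ∀ t (ω : ULift.{u} (ℕ → ℝ≥0 × ℕ)), walkPath h t ω.down ∈ lattice h := fun t ω =>
    walkPath_mem_lattice t ω.down
  refine ⟨ULift.{u} (ℕ → ℝ≥0 × ℕ), inferInstance, (seqLaw lam p).map ULift.up, hPu,
    fun t ω => walkPath h t ω.down, walkMeasure h lam p, hU, hlat, fun t => ?_, fun β hβ => ?_⟩
  · rw [hU.measure_strictAsc hlat hh hl hp hp0 hp1 hr, hγ]
  · beta_reduce
    rw [hU.integral_desc hlat hh hl hp hp0 hp1 hr hβ, laplaceExponent_eq_ladderExponent]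
    congr 2
    refine hr.lam_mul_one_sub_eq hp hl.ne' (continuousOn_ladderExponent hφ hsum) hfac
      (Real.exp_pos _) ?_
    rw [Real.exp_le_one_iff]
    linarith [mul_nonneg hβ hh.le]

end parent
end SkipFree

theorem mainTheorem6 (h γ q : ℝ) (φ : ℕ+ → ℝ) (hh : 0 < h) (hγ : 0 ≤ γ) (hq : 0 ≤ q)
    (hφ : ∀ k, 0 ≤ φ k) (hsum : Summable φ) (hpos : 0 < q + ∑' k, φ k) :
    -- there is at most one admissible `x`
    (∀ x y, SkipFree.IsRatio γ φ x → SkipFree.IsRatio γ φ y → x = y) ∧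
    -- existence of the chain is equivalent to the two conditions
    ((∃ (Ω : Type u) (_ : MeasurableSpace Ω) (P : Measure Ω) (_ : IsProbabilityMeasure P)
        (X : ℝ≥0 → Ω → ℝ) (ν : Measure ℝ), SkipFree.IsParentProcess h γ q φ X P ν) ↔
      γ * q = 0 ∧ ∃ x, SkipFree.IsRatio γ φ x ∧ ∀ k, 0 ≤ x * φ k - φ (k + 1)) ∧
    -- the Lévy measure of such a chain, and the identification of `x`
    (∀ (Ω : Type u) [MeasurableSpace Ω] (P : Measure Ω) [IsProbabilityMeasure P]
        (X : ℝ≥0 → Ω → ℝ) (ν : Measure ℝ), SkipFree.IsParentProcess h γ q φ X P ν →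
      ∃ x, SkipFree.IsRatio γ φ x ∧ ν = SkipFree.parentLevyMeasure h q φ x ∧ x = Real.exp (SkipFree.Phi0 ν * h)) ∧
    -- uniqueness in law of such a chain
    (∀ (Ω : Type u) [MeasurableSpace Ω] (P : Measure Ω) [IsProbabilityMeasure P]
        (X : ℝ≥0 → Ω → ℝ) (ν : Measure ℝ)
        (Ω' : Type v) [MeasurableSpace Ω'] (P' : Measure Ω') [IsProbabilityMeasure P']
        (X' : ℝ≥0 → Ω' → ℝ) (ν' : Measure ℝ),
      SkipFree.IsParentProcess h γ q φ X P ν → SkipFree.IsParentProcess h γ q φ X' P' ν' →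
      P.map (fun ω t => X t ω) = P'.map (fun ω t => X' t ω)) := by
  refine ⟨fun x y hx hy => hx.eq hφ hy, ⟨?_, ?_⟩, ?_, ?_⟩
  · rintro ⟨Ω, _, P, _, X, ν, hX⟩
    obtain ⟨h1, h2, h3, -⟩ := hX.conditions hh hφ hsum
    exact ⟨h1, _, h2, h3⟩
  · rintro ⟨h1, x, h2, h3⟩
    exact SkipFree.exists_isParentProcess hh hq hφ hsum hpos h1 h2 h3
  · intro Ω _ P _ X ν hX
    obtain ⟨-, h2, -, h4⟩ := hX.conditions hh hφ hsum
    exact ⟨_, h2, h4, rfl⟩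
  · intro Ω _ P _ X ν Ω' _ P' _ X' ν' hX hX'
    obtain ⟨-, h2, -, h4⟩ := hX.conditions hh hφ hsum
    obtain ⟨-, h2', -, h4'⟩ := hX'.conditions hh hφ hsum
    -- Uniqueness of `x` gives both chains the same Lévy measure, which determines the law.
    rw [← h2.eq hφ h2', ← h4] at h4'
    subst h4'
    exact hX.chain.toIsCompoundPoisson.map_eq_map hX'.chain.toIsCompoundPoisson
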